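/- A sub-distribution on a finite set $S$ is a function $\mu:S\to[0,\infty)$ with $\mu(S)\le 1$. A finite probabilistic automaton (PA) consists of finite sets $S$ and $Act$ and a finite set of transitions $s\xrightarrow{a}\mu$, where $s\in S$, $a\in Act$ and $\mu$ is a sub-distribution on $S$. For $\epsilon\ge 0$, an $\epsilon$-bisimulation is a symmetric relation $R\subseteq S\times S$ such that, whenever $s\,R\,t$ and $s\xrightarrow{a}\mu$, there is $t\xrightarrow{a}\nu$ with $\mu(E)\le\nu(R(E))+\epsilon$ for all $E\subseteq S$; we write $s\sim_\epsilon t$ if some $\epsilon$-bisimulation relates $s$ and $t$. Let $d(s,t)=\inf\{\epsilon\ge 0 : s\sim_\epsilon t\}$, with $\inf\emptyset=1$. For sub-distributions $\mu,\nu$ and $R\subseteq S\times S$, let $\mathcal N(\mu,\nu,R)$ be the network whose vertices are a source $\bot$, a sink $\top$, and the elements $s$ of $S$ and $t'$ of a disjoint copy of $S$, with an edge $\bot\to s$ of capacity $\mu(s)$ for each $s\in S$, an edge $s\to t'$ of capacity $1$ for each $(s,t)\in R$, and an edge $t'\to\top$ of capacity $\nu(t)$ for each $t\in S$. Algorithm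 $\mathcal A$: start with $d_0=0$ on $S\times S$. Given $d_j$, compute $d_{j+1}$ as follows. Put $d_{j+1}:=d_j$. For all $(s,t)\in S\times S$, all $a\in Act$ and all $s\xrightarrow{a}\mu$, let $\epsilon$ be the smallest number in $[0,1]$ such that for some $t\xrightarrow{a}\nu$ the maximum flow of $\mathcal N(\mu,\nu,\{(x,y): d_j(x,y)\le\epsilon\})$ is at least $\mu(S)-\epsilon$ (and $\epsilon=1$ if $t$ has no $a$-transition), and raise $d_{j+1}(s,t)$ and $d_{j+1}(t,s)$ to at least $\epsilon$. Stop as soon as $d_{j+1}=d_j$ and return $d_j$. The machine model is a random access machine with arrays of natural numbers and arrays of real numbers, in which every memory access, addition, subtraction and comparison (for both kinds of numbers) takes one step; no other arithmetic is available. Proposition. For every finite PA, Algorithm $\mathcal A$, with any correct implementation of the instruction "let $\epsilon$ be the smallest number such that ...", halts and outputs $d(s,t)$ for all pairs of states $s,t\in S$. Moreover, with a suitable implementation of that instruction (one program for all finite PAs), Algorithm $\mathcal A$ runs in time $O(|S|^9\cdot|Act|\cdot l^2)$, where $l$ is the maximal number of transitions with the same label issued from a single state: there is a constant $C$ such that for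 every finite PA with at least one state, one action and one transition it halts after at most $C\cdot|S|^9\cdot|Act|\cdot l^2$ steps. -/

import Mathlib

/-! Finite probabilistic automata, approximate bisimulation and the distance it induces, the flow
network of a relation, and a random access machine with real arithmetic and an explicit step count,
in which the iterative algorithm is written down. -/

universe u v

namespace BisimDistance

open Finset

/-! ### Probabilistic automata and the bisimulation distance -/

/-- A sub-distribution on a finite set. -/
structure SubDist (S : Type u) [Fintype S] where
  mass : S → ℝ
  nonneg : ∀ x, 0 ≤ mass x
  sum_le_one : ∑ x, mass x ≤ 1

/-- The probability `μ(E)` of a set of states. -/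
noncomputable def SubDist.prob {S : Type u} [Fintype S] (μ : SubDist S) (E : Set S) : ℝ :=
  ∑ x, E.indicator μ.mass x

/-- A finite probabilistic automaton: `μ ∈ trans s a` is the transition from `s` to `μ` with
label `a`. -/
structure PA (S : Type u) (Act : Type v) [Fintype S] where
  trans : S → Act → Finset (SubDist S)

/-- The maximal number of transitions with the same label issued from a single state. -/
def PA.maxBranching {S : Type u} {Act : Type v} [Fintype S] [Fintype Act] (P : PA S Act) : ℕ :=
  univ.sup fun s : S => univ.sup fun a : Act => (P.trans s a).card

/-- The lifting of `R` up to `ε`: `μ(E) ≤ ν(R(E)) + ε` for every set `E` of states. -/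
def Lift {S : Type u} [Fintype S] (ε : ℝ) (R : S → S → Prop) (μ ν : SubDist S) : Prop :=
  ∀ E : Set S, μ.prob E ≤ ν.prob {y | ∃ x ∈ E, R x y} + ε

def IsSimulation {S : Type u} {Act : Type v} [Fintype S] (P : PA S Act) (ε : ℝ)
    (R : S → S → Prop) : Prop :=
  ∀ s t, R s t → ∀ a, ∀ μ ∈ P.trans s a, ∃ ν ∈ P.trans t a, Lift ε R μ ν

def IsBisimulation {S : Type u} {Act : Type v} [Fintype S] (P : PA S Act) (ε : ℝ)
    (R : S → S → Prop) : Prop :=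
  (∀ s t, R s t → R t s) ∧ IsSimulation P ε R

/-- The states `s` and `t` are `ε`-bisimilar. -/
def Bisimilar {S : Type u} {Act : Type v} [Fintype S] (P : PA S Act) (ε : ℝ) (s t : S) : Prop :=
  ∃ R : S → S → Prop, IsBisimulation P ε R ∧ R s t

/-- The distance `d(s,t) = inf {ε ≥ 0 | s ∼_ε t}`, as an infimum in `[0,1]`: the infimum of the
empty set is `1`.  (If `s ∼_ε t` for some `ε ≥ 1` then `s ∼_1 t`, so that adding `1` to the set
changes nothing when the set is not empty.) -/
noncomputable def bisimDist {S : Type u} {Act : Type v} [Fintype S] (P : PA S Act) (s t : S) : ℝ :=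
  sInf (insert 1 {ε : ℝ | 0 ≤ ε ∧ Bisimilar P ε s t})

/-! ### Networks -/

/-- A network: a pair of vertices which is not an edge has capacity `0`. -/
structure Network (V : Type u) where
  cap : V → V → ℝ
  source : V
  sink : V

structure Network.IsFlow {V : Type u} [Fintype V] (N : Network V) (f : V → V → ℝ) : Prop where
  nonneg : ∀ x y, 0 ≤ f x y
  le_cap : ∀ x y, f x y ≤ N.cap x y
  conserve : ∀ x, x ≠ N.source → x ≠ N.sink → ∑ y, f y x = ∑ y, f x y

/-- The value of a flow: what leaves the source minus what enters it. -/
def Network.flowValue {V : Type u} [Fintype V] (N : Network V) (f : V → V → ℝ) : ℝ :=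
  ∑ y, f N.source y - ∑ y, f y N.source

/-- The maximum flow (the set is nonempty and compact for nonnegative capacities). -/
noncomputable def Network.maxFlow {V : Type u} [Fintype V] (N : Network V) : ℝ :=
  sSup {r | ∃ f, N.IsFlow f ∧ N.flowValue f = r}

/-- Source, sink, and two disjoint copies of `S`. -/
abbrev NetVertex (S : Type u) : Type u := Bool ⊕ (S ⊕ S)

open Classical in
/-- The network `N(μ,ν,R)`: edges from the source to `s` with capacity `μ(s)`, from `s` to the
copy `t'` of `t` with capacity `1` when `R s t`, and from `t'` to the sink with capacity `ν(t)`. -/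
noncomputable def relNetwork {S : Type u} [Fintype S] (μ ν : SubDist S) (R : S → S → Prop) :
    Network (NetVertex S) where
  source := Sum.inl false
  sink := Sum.inl true
  cap := fun x y =>
    match x, y with
    | Sum.inl false, Sum.inr (Sum.inl s) => μ.mass s
    | Sum.inr (Sum.inl s), Sum.inr (Sum.inr t) => if R s t then 1 else 0
    | Sum.inr (Sum.inr t), Sum.inl true => ν.mass t
    | _, _ => 0

/-- The `ε` in `[0,1]` for which some transition of `t` with label `a` goes to a `ν` such that the
maximum flow of `N(μ, ν, {(x,y) | d(x,y) ≤ ε})` is at least `μ(S) - ε`. -/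
def feasible {S : Type u} {Act : Type v} [Fintype S] (P : PA S Act) (d : S → S → ℝ)
    (t : S) (a : Act) (μ : SubDist S) : Set ℝ :=
  {ε : ℝ | 0 ≤ ε ∧ ε ≤ 1 ∧ ∃ ν ∈ P.trans t a,
    μ.prob Set.univ - ε ≤ (relNetwork μ ν fun x y => d x y ≤ ε).maxFlow}

/-- `r` is the smallest feasible `ε`, and `1` if there is none.  (If there is a feasible `ε` then
`1` is feasible.) -/
def IsStepValue {S : Type u} {Act : Type v} [Fintype S] (P : PA S Act) (d : S → S → ℝ)
    (t : S) (a : Act) (μ : SubDist S) (r : ℝ) : Prop :=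
  IsLeast (insert 1 (feasible P d t a μ)) r

/-! ### A random access machine with step count

The memory consists of arrays of natural numbers and arrays of real numbers, with any number of
indices; a scalar is an entry with no index.  The operations are addition, subtraction and
comparison (natural subtraction truncates); every operation and every memory access is counted.
There is no multiplication, no rounding, and no conversion between the two kinds of numbers. -/

inductive NatVar where
  | numStates | numActs | branch
  | s | t | a | i | x | y | changed
  | scratch (j : ℕ)

inductive RealVar where
  | prob | old | new | eps
  | scratch (j : ℕ)

structure State where
  nat : NatVar → List ℕ → ℕ
  real : RealVar → List ℕ → ℝ

/-- Indices of arrays are given by scalar variables. -/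
def State.index (σ : State) (l : List NatVar) : List ℕ := l.map fun z => σ.nat z []

open Classical in
noncomputable def State.setNat (σ : State) (z : NatVar) (l : List ℕ) (c : ℕ) : State :=
  { σ with nat := fun z' l' => if z' = z ∧ l' = l then c else σ.nat z' l' }

open Classical in
noncomputable def State.setReal (σ : State) (z : RealVar) (l : List ℕ) (c : ℝ) : State :=
  { σ with real := fun z' l' => if z' = z ∧ l' = l then c else σ.real z' l' }

inductive NatExpr where
  | const (c : ℕ)
  | get (z : NatVar) (l : List NatVar)
  | add (e₁ e₂ : NatExpr)
  | sub (e₁ e₂ : NatExpr)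

def NatExpr.eval : NatExpr → State → ℕ
  | .const c, _ => c
  | .get z l, σ => σ.nat z (σ.index l)
  | .add e₁ e₂, σ => e₁.eval σ + e₂.eval σ
  | .sub e₁ e₂, σ => e₁.eval σ - e₂.eval σ

def NatExpr.cost : NatExpr → ℕ
  | .const _ => 1
  | .get _ l => 1 + l.length
  | .add e₁ e₂ => 1 + e₁.cost + e₂.cost
  | .sub e₁ e₂ => 1 + e₁.cost + e₂.cost

inductive RealExpr where
  | zero
  | one
  | get (z : RealVar) (l : List NatVar)
  | add (e₁ e₂ : RealExpr)
  | sub (e₁ e₂ : RealExpr)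

noncomputable def RealExpr.eval : RealExpr → State → ℝ
  | .zero, _ => 0
  | .one, _ => 1
  | .get z l, σ => σ.real z (σ.index l)
  | .add e₁ e₂, σ => e₁.eval σ + e₂.eval σ
  | .sub e₁ e₂, σ => e₁.eval σ - e₂.eval σ

def RealExpr.cost : RealExpr → ℕ
  | .zero => 1
  | .one => 1
  | .get _ l => 1 + l.length
  | .add e₁ e₂ => 1 + e₁.cost + e₂.cost
  | .sub e₁ e₂ => 1 + e₁.cost + e₂.cost

inductive Test where
  | natLt (e₁ e₂ : NatExpr)
  | realLt (e₁ e₂ : RealExpr)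
  | not (b : Test)
  | and (b₁ b₂ : Test)

def Test.Holds : Test → State → Prop
  | .natLt e₁ e₂, σ => e₁.eval σ < e₂.eval σ
  | .realLt e₁ e₂, σ => e₁.eval σ < e₂.eval σ
  | .not b, σ => ¬ b.Holds σ
  | .and b₁ b₂, σ => b₁.Holds σ ∧ b₂.Holds σ

def Test.cost : Test → ℕ
  | .natLt e₁ e₂ => 1 + e₁.cost + e₂.cost
  | .realLt e₁ e₂ => 1 + e₁.cost + e₂.cost
  | .not b => 1 + b.cost
  | .and b₁ b₂ => 1 + b₁.cost + b₂.cost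

/-- Programs. -/
inductive Cmd where
  | skip
  | natSet (z : NatVar) (l : List NatVar) (e : NatExpr)
  | realSet (z : RealVar) (l : List NatVar) (e : RealExpr)
  | seq (c₁ c₂ : Cmd)
  | ite (b : Test) (c₁ c₂ : Cmd)
  | loop (b : Test) (c : Cmd)

infixr:60 " ;; " => Cmd.seq

/-- `Exec c σ T σ'`: started in `σ`, the program `c` halts in `σ'` after `T` steps. -/
inductive Exec : Cmd → State → ℕ → State → Prop where
  | skip (σ : State) : Exec .skip σ 1 σ
  | natSet (z : NatVar) (l : List NatVar) (e : NatExpr) (σ : State) :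
      Exec (.natSet z l e) σ (1 + l.length + e.cost) (σ.setNat z (σ.index l) (e.eval σ))
  | realSet (z : RealVar) (l : List NatVar) (e : RealExpr) (σ : State) :
      Exec (.realSet z l e) σ (1 + l.length + e.cost) (σ.setReal z (σ.index l) (e.eval σ))
  | seq {c₁ c₂ : Cmd} {σ₁ σ₂ σ₃ : State} {T₁ T₂ : ℕ} :
      Exec c₁ σ₁ T₁ σ₂ → Exec c₂ σ₂ T₂ σ₃ → Exec (.seq c₁ c₂) σ₁ (T₁ + T₂) σ₃
  | iteTrue {b : Test} {c₁ c₂ : Cmd} {σ₁ σ₂ : State} {T : ℕ} :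
      b.Holds σ₁ → Exec c₁ σ₁ T σ₂ → Exec (.ite b c₁ c₂) σ₁ (1 + b.cost + T) σ₂
  | iteFalse {b : Test} {c₁ c₂ : Cmd} {σ₁ σ₂ : State} {T : ℕ} :
      ¬ b.Holds σ₁ → Exec c₂ σ₁ T σ₂ → Exec (.ite b c₁ c₂) σ₁ (1 + b.cost + T) σ₂
  | loopDone {b : Test} {c : Cmd} {σ : State} :
      ¬ b.Holds σ → Exec (.loop b c) σ (1 + b.cost) σ
  | loopStep {b : Test} {c : Cmd} {σ₁ σ₂ σ₃ : State} {T₁ T₂ : ℕ} :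
      b.Holds σ₁ → Exec c σ₁ T₁ σ₂ → Exec (.loop b c) σ₂ T₂ σ₃ →
        Exec (.loop b c) σ₁ (1 + b.cost + T₁ + T₂) σ₃

/-- `for z = 0, …, e - 1 do c`. -/
def forLoop (z : NatVar) (e : NatExpr) (c : Cmd) : Cmd :=
  .natSet z [] (.const 0) ;;
  .loop (.natLt (.get z []) e) (c ;; .natSet z [] (.add (.get z []) (.const 1)))

/-! ### The algorithm -/

/-- A numbering of the states, the actions and the transitions of an automaton. -/
structure InputNumbering {S : Type u} {Act : Type v} [Fintype S] [Fintype Act] (P : PA S Act) where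
  state : S ≃ Fin (Fintype.card S)
  act : Act ≃ Fin (Fintype.card Act)
  tr : ∀ s a, {μ // μ ∈ P.trans s a} ≃ Fin (P.trans s a).card

/-- The memory contains the description of the automaton (and anything elsewhere):
`branch[s,a]` is the number of transitions from `s` with label `a`, and `prob[s,a,i,x]` is the
probability of `x` in the `i`-th one. -/
structure HoldsInput {S : Type u} {Act : Type v} [Fintype S] [Fintype Act] (P : PA S Act)
    (N : InputNumbering P) (σ : State) : Prop where
  numStates : σ.nat .numStates [] = Fintype.card S
  numActs : σ.nat .numActs [] = Fintype.card Act
  branch : ∀ s a, σ.nat .branch [(N.state s : ℕ), (N.act a : ℕ)] = (P.trans s a).card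
  prob : ∀ s a (μ : {μ // μ ∈ P.trans s a}) (x : S),
    σ.real .prob [(N.state s : ℕ), (N.act a : ℕ), (N.tr s a μ : ℕ), (N.state x : ℕ)]
      = μ.1.mass x

/-- Everything but the scratch memory and the variable `eps` is the same in both states. -/
structure SameOutside (σ σ' : State) : Prop where
  nat : ∀ z l, (∀ j, z ≠ .scratch j) → σ'.nat z l = σ.nat z l
  real : ∀ z l, (∀ j, z ≠ .scratch j) → z ≠ .eps → σ'.real z l = σ.real z l

/-- The program `K` is an implementation of the instruction "let `eps` be the smallest `ε` in
`[0,1]` such that some transition of `t` with label `a` goes to a `ν` for which the maximum flow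
of `N(μ, ν, {(x,y) | d(x,y) ≤ ε})` is at least `μ(S) - ε`, and `1` if there is none", where `μ` is
the target of the `i`-th transition of `s` with label `a`, and `d` is the current content of the
array `old`. -/
def ImplementsStep (K : Cmd) : Prop :=
  ∀ (S : Type u) (Act : Type v) [Fintype S] [Fintype Act] (P : PA S Act) (N : InputNumbering P)
    (d : S → S → ℝ) (s t : S) (a : Act) (μ : {μ // μ ∈ P.trans s a}) (σ : State),
    (∀ x y, 0 ≤ d x y ∧ d x y ≤ 1) →
    HoldsInput P N σ →
    (∀ x y, σ.real .old [(N.state x : ℕ), (N.state y : ℕ)] = d x y) →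
    σ.nat .s [] = N.state s → σ.nat .t [] = N.state t → σ.nat .a [] = N.act a →
    σ.nat .i [] = N.tr s a μ →
    ∃ T σ', Exec K σ T σ' ∧ IsStepValue P d t a μ.1 (σ'.real .eps []) ∧ SameOutside σ σ'

/-- One pass over all pairs of states: `new := old`; then for all `(s,t)`, all `a` and all
transitions from `s` with label `a`, compute `eps` and raise `new[s,t]` and `new[t,s]` to at least
`eps`. -/
def updateAll (K : Cmd) : Cmd :=
  forLoop .x (.get .numStates []) (forLoop .y (.get .numStates [])
    (.realSet .new [.x, .y] (.get .old [.x, .y]))) ;;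
  forLoop .s (.get .numStates []) (forLoop .t (.get .numStates [])
    (forLoop .a (.get .numActs []) (forLoop .i (.get .branch [.s, .a])
      (K ;;
       .ite (.realLt (.get .new [.s, .t]) (.get .eps []))
         (.realSet .new [.s, .t] (.get .eps [])) .skip ;;
       .ite (.realLt (.get .new [.t, .s]) (.get .eps []))
         (.realSet .new [.t, .s] (.get .eps [])) .skip))))

/-- `changed := 0`; for all `(x,y)`, if `new[x,y] ≠ old[x,y]` then `changed := 1`;
`old := new`. -/
def compareAndCopy : Cmd :=
  .natSet .changed [] (.const 0) ;;
  forLoop .x (.get .numStates []) (forLoop .y (.get .numStates [])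
    (.ite (.and (.not (.realLt (.get .new [.x, .y]) (.get .old [.x, .y])))
                (.not (.realLt (.get .old [.x, .y]) (.get .new [.x, .y]))))
       .skip
       (.natSet .changed [] (.const 1)) ;;
     .realSet .old [.x, .y] (.get .new [.x, .y])))

/-- The algorithm, with `K` as the implementation of its innermost instruction: start with
`old = 0` and repeat the pass until nothing changes.  The output is the array `old`. -/
def algorithmA (K : Cmd) : Cmd :=
  forLoop .x (.get .numStates []) (forLoop .y (.get .numStates [])
    (.realSet .old [.x, .y] .zero)) ;;
  .natSet .changed [] (.const 1) ;;
  .loop (.natLt (.const 0) (.get .changed [])) (updateAll K ;; compareAndCopy)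

end BisimDistance

open BisimDistance

/-! Correctness and running time of the iterative algorithm for the bisimulation distance. The
implementation of its innermost instruction searches the smallest feasible number among finitely
many candidates by repeated halving, and decides each candidate by a push-relabel algorithm for the
maximum flow in the bipartite network of a relation. -/

namespace BisimDistance

open Finset

/-! ### Reading an updated memory -/

section Memory

variable (σ : State) (z : NatVar) (w : RealVar) (l : List ℕ)

/-! Correctness. A set `E` of states determines a cut of the network of `R` with capacity μ(S) -
μ(E) + ν(R(E)). By max-flow min-cut, the maximum flow is therefore at least μ(S) - ε exactly when
μ(E) ≤ ν(R(E)) + ε for all `E` (`lift_iff_maxFlow`). Hence, for ε < 1, one pass shrinks the relation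
{d ≤ ε} to those of its pairs whose transitions can be matched in both directions up to ε with
respect to {d ≤ ε} itself (`IsUpdate.le_iff`). The algorithm thus performs, for all ε at once, the
usual iteration towards the greatest ε-bisimulation. Pairs of an ε-bisimulation are never removed,
so the matrix stays below the distance. For each single ε a pass either meets a bisimulation, which
it and all later passes leave alone, or removes a pair. After more than |S|² passes all the
relations {d ≤ ε} with ε < 1 are bisimulations simultaneously, although there are infinitely many ε
(`IsUpdate.iterInv`). An entry ε < 1 of the matrix is then witnessed by the ε-bisimulation {d ≤ ε},
and the entry 1 is the default value, so the matrix is the distance (`IterInv.eq_bisimDist`).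

The innermost number. The relation {d ≤ ε} changes only at entries of `d`. So the least feasible ε
for one ν, capped at 1, is the minimum over the thresholds v (zero and the entries of `d`) of max(v,
mass not transportable along {d ≤ v}) (`isStepValue_of_candidates`). The first argument of the
maximum increases with v and the second decreases, so bisection applies. A round takes a median of
the remaining entries, found by counting, and one maximum flow; each costs O(|S|⁴) steps. The number
of rounds is 3|S|, which is more than enough to halve |S|² entries down to none and needs no
logarithm. One ν costs O(|S|⁵), the instruction O(l|S|⁵), and O(|S|²) passes over |S|²·|Act|·l
transitions give the bound.

The maximum flow. The program is a push-relabel method in sweeps, with labels capped at 2|S|+1. The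
2|S| labels cannot occupy all levels below the cap, and an unoccupied level gives a cut whose
capacity is what has reached the sink (`Preflow.Valid.exists_cut`). Twice the label sum minus a
bound for the active labels grows in every sweep (`Preflow.RightInv.passInv`), so O(|S|²) sweeps of
O(|S|²) steps suffice. The min-cut theorem itself is read off from a terminated run.

The time bound in `Runs g` is conditional on `g`. With `g` false, `runs_algorithmA` yields halting
and correctness for an arbitrary implementation; with `g` true, it yields the running time for the
constructed one. -/

@[simp] theorem State.setNat_real (c : ℕ) : (σ.setNat z l c).real = σ.real := rfl

@[simp] theorem State.setReal_nat (c : ℝ) : (σ.setReal w l c).nat = σ.nat := rfl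

@[simp] theorem State.setNat_nat_self (c : ℕ) : (σ.setNat z l c).nat z l = c := by
  simp [State.setNat]

@[simp] theorem State.setReal_real_self (c : ℝ) : (σ.setReal w l c).real w l = c := by
  simp [State.setReal]

theorem State.setNat_nat_of_ne {z' : NatVar} (h : z' ≠ z) (c : ℕ) :
    (σ.setNat z l c).nat z' = σ.nat z' := by
  funext l'; simp [State.setNat, h]

theorem State.setReal_real_of_ne {w' : RealVar} (h : w' ≠ w) (c : ℝ) :
    (σ.setReal w l c).real w' = σ.real w' := by
  funext l'; simp [State.setReal, h]

end Memory

/-! ### Written variables and determinism -/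

/-- The program contains an assignment to (an entry of) `z`. -/
def Cmd.WritesNat (z : NatVar) : Cmd → Prop
  | .skip => False
  | .natSet z' _ _ => z = z'
  | .realSet _ _ _ => False
  | .seq c₁ c₂ => c₁.WritesNat z ∨ c₂.WritesNat z
  | .ite _ c₁ c₂ => c₁.WritesNat z ∨ c₂.WritesNat z
  | .loop _ c => c.WritesNat z

/-- The program contains an assignment to (an entry of) `z`. -/
def Cmd.WritesReal (z : RealVar) : Cmd → Prop
  | .skip => False
  | .natSet _ _ _ => False
  | .realSet z' _ _ => z = z'
  | .seq c₁ c₂ => c₁.WritesReal z ∨ c₂.WritesReal z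
  | .ite _ c₁ c₂ => c₁.WritesReal z ∨ c₂.WritesReal z
  | .loop _ c => c.WritesReal z

/-- The two states agree on all variables which the program does not write. -/
structure Frame (c : Cmd) (σ σ' : State) : Prop where
  nat : ∀ z, ¬ c.WritesNat z → σ'.nat z = σ.nat z
  real : ∀ z, ¬ c.WritesReal z → σ'.real z = σ.real z

theorem Frame.refl (c : Cmd) (σ : State) : Frame c σ σ := ⟨fun _ _ => rfl, fun _ _ => rfl⟩

/-- What a program may change can be read off its text. This keeps loop invariants small: untouched
variables need not occur in them. -/
theorem Exec.frame {c : Cmd} {σ σ' : State} {T : ℕ} (h : Exec c σ T σ') : Frame c σ σ' := by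
  induction h with
  | skip σ => exact Frame.refl _ _
  | natSet z l e σ => exact ⟨fun z' h => σ.setNat_nat_of_ne _ _ h _, fun _ _ => rfl⟩
  | realSet z l e σ => exact ⟨fun _ _ => rfl, fun z' h => σ.setReal_real_of_ne _ _ h _⟩
  | seq _ _ ih₁ ih₂ =>
    refine ⟨fun z h => ?_, fun z h => ?_⟩
    · have := not_or.1 h
      rw [ih₂.nat z this.2, ih₁.nat z this.1]
    · have := not_or.1 h
      rw [ih₂.real z this.2, ih₁.real z this.1]
  | iteTrue _ _ ih =>
    exact ⟨fun z h => ih.nat z (not_or.1 h).1, fun z h => ih.real z (not_or.1 h).1⟩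
  | iteFalse _ _ ih =>
    exact ⟨fun z h => ih.nat z (not_or.1 h).2, fun z h => ih.real z (not_or.1 h).2⟩
  | loopDone _ => exact Frame.refl _ _
  | loopStep _ _ _ ih₁ ih₂ =>
    refine ⟨fun z h => ?_, fun z h => ?_⟩
    · rw [ih₂.nat z h, ih₁.nat z h]
    · rw [ih₂.real z h, ih₁.real z h]

/-- The time bound is claimed for every execution, whereas the program logic produces one;
determinism identifies the two. -/
theorem Exec.deterministic {c : Cmd} {σ σ₁ σ₂ : State} {T₁ T₂ : ℕ} (h₁ : Exec c σ T₁ σ₁)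
    (h₂ : Exec c σ T₂ σ₂) : T₁ = T₂ ∧ σ₁ = σ₂ := by
  induction h₁ generalizing T₂ σ₂ with
  | skip | natSet | realSet => cases h₂; exact ⟨rfl, rfl⟩
  | seq _ _ ih₁ ih₂ =>
    cases h₂ with
    | seq h h' =>
      obtain ⟨rfl, rfl⟩ := ih₁ h
      obtain ⟨rfl, rfl⟩ := ih₂ h'
      exact ⟨rfl, rfl⟩
  | iteTrue hb _ ih =>
    cases h₂ with
    | iteTrue _ h => obtain ⟨rfl, rfl⟩ := ih h; exact ⟨rfl, rfl⟩
    | iteFalse hb' _ => exact absurd hb hb'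
  | iteFalse hb _ ih =>
    cases h₂ with
    | iteTrue hb' _ => exact absurd hb' hb
    | iteFalse _ h => obtain ⟨rfl, rfl⟩ := ih h; exact ⟨rfl, rfl⟩
  | loopDone hb =>
    cases h₂ with
    | loopDone _ => exact ⟨rfl, rfl⟩
    | loopStep hb' _ _ => exact absurd hb' hb
  | loopStep hb _ _ ih₁ ih₂ =>
    cases h₂ with
    | loopDone hb' => exact absurd hb hb'
    | loopStep _ h h' =>
      obtain ⟨rfl, rfl⟩ := ih₁ h
      obtain ⟨rfl, rfl⟩ := ih₂ h'
      exact ⟨rfl, rfl⟩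

/-! ### A program logic with time bounds -/

/-- Started in `σ`, the program `c` halts in a state satisfying `Q`, and if `g` holds it does so
after at most `B` steps. -/
def Runs (g : Prop) (c : Cmd) (σ : State) (B : ℕ) (Q : State → Prop) : Prop :=
  ∃ T σ', Exec c σ T σ' ∧ (g → T ≤ B) ∧ Q σ'

namespace Runs

variable {g : Prop} {c c₁ c₂ : Cmd} {σ : State} {B B₁ B₂ : ℕ} {Q Q' : State → Prop}

theorem mono (h : Runs g c σ B₁ Q) (hB : g → B₁ ≤ B₂) (hQ : ∀ σ', Frame c σ σ' → Q σ' → Q' σ') :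
    Runs g c σ B₂ Q' := by
  obtain ⟨T, σ', hE, hT, hq⟩ := h
  exact ⟨T, σ', hE, fun hg => (hT hg).trans (hB hg), hQ _ hE.frame hq⟩

theorem mono_bound (h : Runs g c σ B₁ Q) (hB : B₁ ≤ B₂) : Runs g c σ B₂ Q :=
  h.mono (fun _ => hB) fun _ _ h => h

theorem mono_post (h : Runs g c σ B Q) (hQ : ∀ σ', Frame c σ σ' → Q σ' → Q' σ') :
    Runs g c σ B Q' :=
  h.mono (fun _ => le_rfl) hQ

theorem skip (h : Q σ) : Runs g .skip σ 1 Q := ⟨_, _, .skip σ, fun _ => le_rfl, h⟩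

theorem natSet {z : NatVar} {l : List NatVar} {e : NatExpr}
    (h : Q (σ.setNat z (σ.index l) (e.eval σ))) :
    Runs g (.natSet z l e) σ (1 + l.length + e.cost) Q :=
  ⟨_, _, .natSet z l e σ, fun _ => le_rfl, h⟩

theorem realSet {z : RealVar} {l : List NatVar} {e : RealExpr}
    (h : Q (σ.setReal z (σ.index l) (e.eval σ))) :
    Runs g (.realSet z l e) σ (1 + l.length + e.cost) Q :=
  ⟨_, _, .realSet z l e σ, fun _ => le_rfl, h⟩

theorem seq (h₁ : Runs g c₁ σ B₁ Q') (h₂ : ∀ σ', Frame c₁ σ σ' → Q' σ' → Runs g c₂ σ' B₂ Q) :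
    Runs g (c₁ ;; c₂) σ (B₁ + B₂) Q := by
  obtain ⟨T₁, σ₁, hE₁, hT₁, hq₁⟩ := h₁
  obtain ⟨T₂, σ₂, hE₂, hT₂, hq₂⟩ := h₂ _ hE₁.frame hq₁
  exact ⟨_, _, hE₁.seq hE₂, fun hg => Nat.add_le_add (hT₁ hg) (hT₂ hg), hq₂⟩

theorem natSet_seq {z : NatVar} {l : List NatVar} {e : NatExpr}
    (h : Runs g c (σ.setNat z (σ.index l) (e.eval σ)) B Q) :
    Runs g (.natSet z l e ;; c) σ (1 + l.length + e.cost + B) Q :=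
  seq (Q' := fun σ' => σ' = σ.setNat z (σ.index l) (e.eval σ)) (natSet rfl)
    fun _ _ hσ => hσ ▸ h

theorem realSet_seq {z : RealVar} {l : List NatVar} {e : RealExpr}
    (h : Runs g c (σ.setReal z (σ.index l) (e.eval σ)) B Q) :
    Runs g (.realSet z l e ;; c) σ (1 + l.length + e.cost + B) Q :=
  seq (Q' := fun σ' => σ' = σ.setReal z (σ.index l) (e.eval σ)) (realSet rfl)
    fun _ _ hσ => hσ ▸ h

theorem ite {b : Test} (h₁ : b.Holds σ → Runs g c₁ σ B₁ Q) (h₂ : ¬ b.Holds σ → Runs g c₂ σ B₂ Q) :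
    Runs g (.ite b c₁ c₂) σ (1 + b.cost + (B₁ + B₂)) Q := by
  by_cases hb : b.Holds σ
  · obtain ⟨T, σ', hE, hT, hq⟩ := h₁ hb
    exact ⟨_, _, .iteTrue hb hE, fun hg => by have := hT hg; omega, hq⟩
  · obtain ⟨T, σ', hE, hT, hq⟩ := h₂ hb
    exact ⟨_, _, .iteFalse hb hE, fun hg => by have := hT hg; omega, hq⟩

theorem loop_of_not {b : Test} (hb : ¬ b.Holds σ) (h : Q σ) : Runs g (.loop b c) σ (1 + b.cost) Q :=
  ⟨_, _, .loopDone hb, fun _ => le_rfl, h⟩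

theorem loop_of_holds {b : Test} (hb : b.Holds σ) (h : Runs g c σ B₁ Q')
    (h' : ∀ σ', Frame c σ σ' → Q' σ' → Runs g (.loop b c) σ' B₂ Q) :
    Runs g (.loop b c) σ (1 + b.cost + B₁ + B₂) Q := by
  obtain ⟨T₁, σ₁, hE₁, hT₁, hq₁⟩ := h
  obtain ⟨T₂, σ₂, hE₂, hT₂, hq₂⟩ := h' _ hE₁.frame hq₁
  exact ⟨_, _, .loopStep hb hE₁ hE₂,
    fun hg => by have := hT₁ hg; have := hT₂ hg; omega, hq₂⟩

/-- The rule for counting loops. The invariant may depend on the counter; what the loop does not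
write may be used throughout. -/
theorem forLoop {z : NatVar} {e : NatExpr} {m : ℕ} (I : ℕ → State → Prop)
    (hz : ¬ c.WritesNat z) (he : ∀ σ', Frame (forLoop z e c) σ σ' → e.eval σ' = m)
    (hI : ∀ k σ' r, I k σ' → I k (σ'.setNat z [] r)) (h0 : I 0 σ)
    (body : ∀ k < m, ∀ σ', Frame (BisimDistance.forLoop z e c) σ σ' → σ'.nat z [] = k → I k σ' →
      Runs g c σ' B (I (k + 1))) :
    Runs g (BisimDistance.forLoop z e c) σ ((m + 1) * (7 + e.cost + B)) (I m) := by
  -- A round costs `3 + e.cost` for the test, `B` for the body and 4 for the increment. The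
  -- initialisation and the last, failing test are paid by the extra round in `m + 1`.
  have key : ∀ r k, k + r = m → ∀ σ', Frame (BisimDistance.forLoop z e c) σ σ' →
      σ'.nat z [] = k → I k σ' →
      Runs g (.loop (.natLt (.get z []) e) (c ;; .natSet z [] (.add (.get z []) (.const 1)))) σ'
        (r * (7 + e.cost + B) + 3 + e.cost) (I m) := by
    intro r
    induction r with
    | zero =>
      intro k hk σ' hF hc hIk
      obtain rfl : k = m := by omega
      refine (loop_of_not ?_ hIk).mono_bound ?_
      · simp [Test.Holds, he σ' hF, NatExpr.eval, State.index, hc]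
      · simp [Test.cost, NatExpr.cost]; omega
    | succ r ih =>
      intro k hk σ' hF hc hIk
      have hb : (Test.natLt (.get z []) e).Holds σ' := by
        simp only [Test.Holds, he σ' hF, NatExpr.eval, State.index, List.map_nil, hc]
        omega
      refine (loop_of_holds (B₂ := r * (7 + e.cost + B) + 3 + e.cost) (Q' := fun σ₂ => Frame (BisimDistance.forLoop z e c) σ σ₂ ∧
        σ₂.nat z [] = k + 1 ∧ I (k + 1) σ₂) hb
        (seq (B₂ := 4) (body k (by omega) σ' hF hc hIk) ?_) fun σ₂ _ h₂ => ?_).mono_bound ?_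
      · intro σ₁ hF₁ hI₁
        have hc₁ : σ₁.nat z [] = k := by rw [hF₁.nat z hz, hc]
        refine natSet ⟨⟨fun z' hz' => ?_, fun z' hz' => ?_⟩, ?_, hI _ _ _ hI₁⟩
        · have h1 : z' ≠ z ∧ ¬ c.WritesNat z' := by
            simpa [BisimDistance.forLoop, Cmd.WritesNat, not_or, and_comm] using hz'
          rw [State.setNat_nat_of_ne _ _ _ h1.1, hF₁.nat z' h1.2, hF.nat z' hz']
        · have h1 : ¬ c.WritesReal z' := by
            simpa [BisimDistance.forLoop, Cmd.WritesReal] using hz'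
          rw [State.setNat_real, hF₁.real z' h1, hF.real z' hz']
        · simp [State.index, NatExpr.eval, hc₁]
      · exact ih (k + 1) (by omega) σ₂ h₂.1 h₂.2.1 h₂.2.2
      · simp only [Test.cost, NatExpr.cost, List.length_nil, add_mul]; omega
  refine (natSet_seq (key m 0 (by omega) _ ⟨fun z' hz' => ?_, fun z' _ => rfl⟩ ?_
    (hI _ _ _ h0))).mono_bound ?_
  · have h1 : z' ≠ z := by
      rintro rfl
      exact hz' (Or.inl rfl)
    exact State.setNat_nat_of_ne _ _ _ h1 _
  · simp [State.index, NatExpr.eval]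
  · simp only [NatExpr.cost, List.length_nil, add_mul]; omega

end Runs

/-! ### Flows in the network of a relation are transport plans -/

/-- A partial transport plan from `μ` to `ν` along `R`. -/
structure IsPlan {S : Type u} [Fintype S] (μ ν : SubDist S) (R : S → S → Prop) (F : S → S → ℝ) :
    Prop where
  nonneg : ∀ x y, 0 ≤ F x y
  rel : ∀ x y, F x y ≠ 0 → R x y
  row : ∀ x, ∑ y, F x y ≤ μ.mass x
  col : ∀ y, ∑ x, F x y ≤ ν.mass y

section Plans

variable {S : Type u} [Fintype S] {μ ν : SubDist S} {R : S → S → Prop}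

theorem SubDist.mass_le_one (μ : SubDist S) (x : S) : μ.mass x ≤ 1 :=
  (single_le_sum (fun y _ => μ.nonneg y) (mem_univ x)).trans μ.sum_le_one

/-- The flow that sends `F x y` through `x` and the copy of `y`. -/
def planFlow (F : S → S → ℝ) : NetVertex S → NetVertex S → ℝ
  | Sum.inl false, Sum.inr (Sum.inl s) => ∑ y, F s y
  | Sum.inr (Sum.inl s), Sum.inr (Sum.inr t) => F s t
  | Sum.inr (Sum.inr t), Sum.inl true => ∑ x, F x t
  | _, _ => 0

theorem IsPlan.isFlow {F : S → S → ℝ} (h : IsPlan μ ν R F) :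
    (relNetwork μ ν R).IsFlow (planFlow F) where
  nonneg x y := by
    rcases x with (_ | _) | x | x <;> rcases y with (_ | _) | y | y <;>
      simp only [planFlow, le_refl, h.nonneg, sum_nonneg, implies_true]
  le_cap x y := by
    rcases x with (_ | _) | x | x <;> rcases y with (_ | _) | y | y <;>
      simp only [planFlow, relNetwork, le_refl, h.row, h.col]
    -- The capacity 1 of the middle edges never binds, because all that leaves `x` is at most μ(x) ≤
    -- 1.
    split_ifs with hR
    · exact (single_le_sum (fun z _ => h.nonneg x z) (mem_univ y)).trans
        ((h.row x).trans (μ.mass_le_one x))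
    · exact le_of_eq (not_not.1 fun h0 => hR (h.rel x y h0))
  conserve x h1 h2 := by
    rcases x with (_ | _) | x | x
    · exact absurd rfl h1
    · exact absurd rfl h2
    · simp [planFlow, Fintype.sum_sum_type]
    · simp [planFlow, Fintype.sum_sum_type]

theorem flowValue_planFlow (F : S → S → ℝ) :
    (relNetwork μ ν R).flowValue (planFlow F) = ∑ x, ∑ y, F x y := by
  simp [Network.flowValue, relNetwork, planFlow, Fintype.sum_sum_type]

/-- The middle layer of a flow is a plan: by conservation its row and column sums are the flows on
the source and sink edges, whose capacities are the masses. Non-edges have capacity 0 and carry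
nothing. -/
theorem Network.IsFlow.exists_isPlan {f : NetVertex S → NetVertex S → ℝ}
    (h : (relNetwork μ ν R).IsFlow f) :
    ∃ F, IsPlan μ ν R F ∧ ∑ x, ∑ y, F x y = (relNetwork μ ν R).flowValue f := by
  have zero : ∀ x y, (relNetwork μ ν R).cap x y = 0 → f x y = 0 := fun x y h0 =>
    le_antisymm (h0 ▸ h.le_cap x y) (h.nonneg x y)
  have row : ∀ x, ∑ y, f (Sum.inr (Sum.inl x)) (Sum.inr (Sum.inr y)) =
      f (Sum.inl false) (Sum.inr (Sum.inl x)) := by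
    intro x
    have := h.conserve (Sum.inr (Sum.inl x)) (by simp [relNetwork]) (by simp [relNetwork])
    simp only [Fintype.sum_sum_type, Fintype.sum_bool] at this
    rw [zero (Sum.inl true) (Sum.inr (Sum.inl x)) rfl,
      zero (Sum.inr (Sum.inl x)) (Sum.inl true) rfl,
      zero (Sum.inr (Sum.inl x)) (Sum.inl false) rfl,
      sum_eq_zero fun y _ => zero (Sum.inr (Sum.inl y)) (Sum.inr (Sum.inl x)) rfl,
      sum_eq_zero fun y _ => zero (Sum.inr (Sum.inr y)) (Sum.inr (Sum.inl x)) rfl,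
      sum_eq_zero fun y _ => zero (Sum.inr (Sum.inl x)) (Sum.inr (Sum.inl y)) rfl] at this
    linarith
  have col : ∀ y, ∑ x, f (Sum.inr (Sum.inl x)) (Sum.inr (Sum.inr y)) =
      f (Sum.inr (Sum.inr y)) (Sum.inl true) := by
    intro x
    have := h.conserve (Sum.inr (Sum.inr x)) (by simp [relNetwork]) (by simp [relNetwork])
    simp only [Fintype.sum_sum_type, Fintype.sum_bool] at this
    rw [zero (Sum.inl true) (Sum.inr (Sum.inr x)) rfl,
      zero (Sum.inl false) (Sum.inr (Sum.inr x)) rfl,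
      zero (Sum.inr (Sum.inr x)) (Sum.inl false) rfl,
      sum_eq_zero fun y _ => zero (Sum.inr (Sum.inr y)) (Sum.inr (Sum.inr x)) rfl,
      sum_eq_zero fun y _ => zero (Sum.inr (Sum.inr x)) (Sum.inr (Sum.inl y)) rfl,
      sum_eq_zero fun y _ => zero (Sum.inr (Sum.inr x)) (Sum.inr (Sum.inr y)) rfl] at this
    linarith
  refine ⟨fun x y => f (Sum.inr (Sum.inl x)) (Sum.inr (Sum.inr y)),
    ⟨fun x y => h.nonneg _ _, fun x y hxy => ?_, fun x => ?_, fun y => ?_⟩, ?_⟩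
  · by_contra hR
    exact hxy (zero _ _ (by simp [relNetwork, hR]))
  · rw [row]; exact h.le_cap _ _
  · rw [col]; exact h.le_cap _ _
  · simp only [row, Network.flowValue]
    have h1 : ∑ y, f y (relNetwork μ ν R).source = 0 :=
      sum_eq_zero fun y _ => zero _ _ (by rcases y with (_ | _) | y | y <;> rfl)
    rw [h1, sub_zero]
    simp only [Fintype.sum_sum_type, Fintype.sum_bool, relNetwork]
    rw [zero (Sum.inl false) (Sum.inl true) rfl, zero (Sum.inl false) (Sum.inl false) rfl,
      sum_eq_zero fun y _ => zero (Sum.inl false) (Sum.inr (Sum.inr y)) rfl]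
    ring

/-- The image `R(E)`. -/
def relImage (R : S → S → Prop) (E : Set S) : Set S := {y | ∃ x ∈ E, R x y}

theorem SubDist.prob_mono (μ : SubDist S) {E E' : Set S} (h : E ⊆ E') : μ.prob E ≤ μ.prob E' :=
  sum_le_sum fun x _ => Set.indicator_le_indicator_of_subset h μ.nonneg x

theorem SubDist.prob_univ (μ : SubDist S) : μ.prob Set.univ = ∑ x, μ.mass x := by
  simp [SubDist.prob]

/-- A plan is bounded by the capacity of every cut. -/
theorem IsPlan.sum_le_cut {F : S → S → ℝ} (h : IsPlan μ ν R F) (E : Set S) :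
    ∑ x, ∑ y, F x y ≤ μ.prob Set.univ - μ.prob E + ν.prob (relImage R E) := by
  classical
  have h1 : ∑ x, ∑ y, F x y ≤ ∑ x, ((Set.univ.indicator μ.mass x - E.indicator μ.mass x) +
      ∑ y, (relImage R E).indicator (fun y => F x y) y) := by
    refine sum_le_sum fun x _ => ?_
    by_cases hx : x ∈ E
    · have : ∀ y, (relImage R E).indicator (fun y => F x y) y = F x y := by
        intro y
        by_cases hR : R x y
        · exact Set.indicator_of_mem (show y ∈ relImage R E from ⟨x, hx, hR⟩) _
        · have h0 : F x y = 0 := not_not.1 fun h0 => hR (h.rel x y h0)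
          simp [Set.indicator_apply, h0]
      simp [hx, this]
    · have : 0 ≤ ∑ y, (relImage R E).indicator (fun y => F x y) y :=
        sum_nonneg fun y _ => Set.indicator_nonneg (fun y _ => h.nonneg x y) y
      simpa [hx] using (h.row x).trans (le_add_of_nonneg_right this)
  have h2 : ∑ x, ∑ y, (relImage R E).indicator (fun y => F x y) y ≤ ν.prob (relImage R E) := by
    rw [sum_comm]
    refine sum_le_sum fun y _ => ?_
    by_cases hy : y ∈ relImage R E
    · simpa [hy] using h.col y
    · simp [hy]
  rw [sum_add_distrib, sum_sub_distrib] at h1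
  exact h1.trans (add_le_add le_rfl h2)

theorem bddAbove_flowValue :
    BddAbove {r | ∃ f, (relNetwork μ ν R).IsFlow f ∧ (relNetwork μ ν R).flowValue f = r} := by
  refine ⟨μ.prob Set.univ - μ.prob ∅ + ν.prob (relImage R ∅), ?_⟩
  rintro _ ⟨f, hf, rfl⟩
  obtain ⟨F, hF, h⟩ := hf.exists_isPlan
  exact h ▸ hF.sum_le_cut ∅

theorem isPlan_zero : IsPlan μ ν R 0 where
  nonneg _ _ := le_rfl
  rel _ _ h := absurd rfl h
  row x := by simpa using μ.nonneg x
  col x := by simpa using ν.nonneg x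

theorem IsPlan.sum_le_maxFlow {F : S → S → ℝ} (h : IsPlan μ ν R F) :
    ∑ x, ∑ y, F x y ≤ (relNetwork μ ν R).maxFlow :=
  le_csSup bddAbove_flowValue ⟨_, h.isFlow, flowValue_planFlow F⟩

/-- The easy half of the max-flow min-cut theorem. -/
theorem maxFlow_le_cut (E : Set S) :
    (relNetwork μ ν R).maxFlow ≤ μ.prob Set.univ - μ.prob E + ν.prob (relImage R E) := by
  refine csSup_le ⟨_, _, isPlan_zero.isFlow, flowValue_planFlow 0⟩ ?_
  rintro _ ⟨f, hf, rfl⟩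
  obtain ⟨F, hF, h⟩ := hf.exists_isPlan
  exact h ▸ hF.sum_le_cut E

end Plans

/-! ### Preflows

The states `s` (left) send their mass to the copies `t'` (right), which pass it on to the sink as
long as this is possible and otherwise send it back. -/

/-- A preflow with labels: `excL`, `excR` are the amounts that have not been passed on, and `room`
is the residual capacity of the edges into the sink. -/
@[ext] structure Preflow (S : Type u) where
  flow : S → S → ℝ
  excL : S → ℝ
  excR : S → ℝ
  room : S → ℝ
  labL : S → ℕ
  labR : S → ℕ

namespace Preflow

section Operations

variable {S : Type u} (p : Preflow S)

open Classical in
/-- Push all the excess of `s` to the copy of `t`. -/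
noncomputable def toRight (s t : S) : Preflow S :=
  { p with
    flow := fun x y => if x = s ∧ y = t then p.flow s t + p.excL s else p.flow x y
    excL := fun x => if x = s then 0 else p.excL x
    excR := fun y => if y = t then p.excR t + p.excL s else p.excR y }

open Classical in
/-- Push `δ` from the copy of `t` back to `s`. -/
noncomputable def toLeft (s t : S) (δ : ℝ) : Preflow S :=
  { p with
    flow := fun x y => if x = s ∧ y = t then p.flow s t - δ else p.flow x y
    excL := fun x => if x = s then p.excL s + δ else p.excL x
    excR := fun y => if y = t then p.excR t - δ else p.excR y }

open Classical in
/-- Push `δ` from the copy of `t` to the sink. -/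
noncomputable def toSink (t : S) (δ : ℝ) : Preflow S :=
  { p with
    excR := fun y => if y = t then p.excR t - δ else p.excR y
    room := fun y => if y = t then p.room t - δ else p.room y }

open Classical in
/-- Raise the label of `s`. -/
noncomputable def raiseL (s : S) : Preflow S :=
  { p with labL := fun x => if x = s then p.labL s + 1 else p.labL x }

open Classical in
/-- Raise the label of the copy of `t`. -/
noncomputable def raiseR (t : S) : Preflow S :=
  { p with labR := fun y => if y = t then p.labR t + 1 else p.labR y }

end Operations

/-! ### Pushes and relabellings preserve validity. -/

section Valid

variable {S : Type u} [Fintype S]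

/-- The invariant of the flow computation: residual edges descend by at most one level. -/
structure Valid (μ ν : SubDist S) (R : S → S → Prop) (H : ℕ) (p : Preflow S) : Prop where
  flow_nonneg : ∀ x y, 0 ≤ p.flow x y
  rel : ∀ x y, p.flow x y ≠ 0 → R x y
  excL_nonneg : ∀ x, 0 ≤ p.excL x
  excR_nonneg : ∀ x, 0 ≤ p.excR x
  room_nonneg : ∀ x, 0 ≤ p.room x
  room_le : ∀ x, p.room x ≤ ν.mass x
  row : ∀ x, p.excL x + ∑ y, p.flow x y = μ.mass x
  col : ∀ y, p.room y + ∑ x, p.flow x y = ν.mass y + p.excR y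
  labL_le : ∀ x, p.labL x ≤ H
  labR_le : ∀ x, p.labR x ≤ H
  lab_forward : ∀ x y, R x y → p.labL x ≤ p.labR y + 1
  lab_backward : ∀ x y, 0 < p.flow x y → p.labR y ≤ p.labL x + 1
  lab_sink : ∀ y, 0 < p.room y → p.labR y = 0

variable {μ ν : SubDist S} {R : S → S → Prop} {H : ℕ} {p : Preflow S}

/-- The only residual edge that may appear leads from the copy of `t` back to `s`, and it goes up
one level. -/
theorem Valid.toRight (h : p.Valid μ ν R H) {s t : S} (hR : R s t)
    (hlab : p.labL s = p.labR t + 1) : (p.toRight s t).Valid μ ν R H where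
  flow_nonneg x y := by
    simp only [Preflow.toRight]
    split_ifs with hxy
    · exact add_nonneg (h.flow_nonneg _ _) (h.excL_nonneg _)
    · exact h.flow_nonneg _ _
  rel x y := by
    simp only [Preflow.toRight]
    split_ifs with hxy
    · rw [hxy.1, hxy.2]; exact fun _ => hR
    · exact h.rel x y
  excL_nonneg x := by
    simp only [Preflow.toRight]
    split_ifs
    · exact le_rfl
    · exact h.excL_nonneg x
  excR_nonneg x := by
    simp only [Preflow.toRight]
    split_ifs
    · exact add_nonneg (h.excR_nonneg _) (h.excL_nonneg _)
    · exact h.excR_nonneg x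
  room_nonneg := h.room_nonneg
  room_le := h.room_le
  row x := by
    classical
    have h1 : ∀ y, (p.toRight s t).flow x y =
        p.flow x y + if y = t then (if x = s then p.excL s else 0) else 0 := by
      intro y
      by_cases hx : x = s <;> by_cases hy : y = t <;> simp [Preflow.toRight, hx, hy]
    rw [sum_congr rfl fun y _ => h1 y, sum_add_distrib, sum_ite_eq' univ t, if_pos (mem_univ _),
      ← h.row x]
    by_cases hx : x = s
    · simp [Preflow.toRight, hx, add_comm]
    · simp [Preflow.toRight, hx]
  col y := by
    classical
    have h1 : ∀ x, (p.toRight s t).flow x y =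
        p.flow x y + if x = s then (if y = t then p.excL s else 0) else 0 := by
      intro x
      by_cases hx : x = s <;> by_cases hy : y = t <;> simp [Preflow.toRight, hx, hy]
    have h2 := h.col y
    rw [sum_congr rfl fun y _ => h1 y, sum_add_distrib, sum_ite_eq' univ s, if_pos (mem_univ _)]
    by_cases hy : y = t
    · simp only [Preflow.toRight, hy, if_true] at h2 ⊢
      linarith
    · simpa [Preflow.toRight, hy] using h2
  labL_le := h.labL_le
  labR_le := h.labR_le
  lab_forward := h.lab_forward
  lab_backward x y := by
    simp only [Preflow.toRight]
    split_ifs with hxy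
    · rw [hxy.1, hxy.2]; intro _; omega
    · exact h.lab_backward x y
  lab_sink := h.lab_sink

/-- No residual edge appears, since forward edges along `R` are treated as having unlimited capacity
and are residual all the time. -/
theorem Valid.toLeft (h : p.Valid μ ν R H) {s t : S} {δ : ℝ} (h0 : 0 ≤ δ) (h1 : δ ≤ p.excR t)
    (h2 : δ ≤ p.flow s t) (hlab : p.labR t = p.labL s + 1) : (p.toLeft s t δ).Valid μ ν R H where
  flow_nonneg x y := by
    simp only [Preflow.toLeft]
    split_ifs with hxy
    · linarith
    · exact h.flow_nonneg _ _
  rel x y := by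
    simp only [Preflow.toLeft]
    split_ifs with hxy
    · rw [hxy.1, hxy.2]
      intro hne
      refine h.rel s t fun h3 => hne ?_
      linarith
    · exact h.rel x y
  excL_nonneg x := by
    simp only [Preflow.toLeft]
    split_ifs
    · exact add_nonneg (h.excL_nonneg s) h0
    · exact h.excL_nonneg x
  excR_nonneg x := by
    simp only [Preflow.toLeft]
    split_ifs
    · linarith
    · exact h.excR_nonneg x
  room_nonneg := h.room_nonneg
  room_le := h.room_le
  row x := by
    classical
    have h1 : ∀ y, (p.toLeft s t δ).flow x y =
        p.flow x y - if y = t then (if x = s then δ else 0) else 0 := by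
      intro y
      by_cases hx : x = s <;> by_cases hy : y = t <;> simp [Preflow.toLeft, hx, hy]
    rw [sum_congr rfl fun y _ => h1 y, sum_sub_distrib, sum_ite_eq' univ t, if_pos (mem_univ _),
      ← h.row x]
    by_cases hx : x = s
    · simp [Preflow.toLeft, hx]
    · simp [Preflow.toLeft, hx]
  col y := by
    classical
    have h1 : ∀ x, (p.toLeft s t δ).flow x y =
        p.flow x y - if x = s then (if y = t then δ else 0) else 0 := by
      intro x
      by_cases hx : x = s <;> by_cases hy : y = t <;> simp [Preflow.toLeft, hx, hy]
    have h2 := h.col y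
    rw [sum_congr rfl fun y _ => h1 y, sum_sub_distrib, sum_ite_eq' univ s, if_pos (mem_univ _)]
    by_cases hy : y = t
    · simp only [Preflow.toLeft, hy, if_true] at h2 ⊢
      linarith
    · simpa [Preflow.toLeft, hy] using h2
  labL_le := h.labL_le
  labR_le := h.labR_le
  lab_forward := h.lab_forward
  lab_backward x y := by
    simp only [Preflow.toLeft]
    split_ifs with hxy
    · rw [hxy.1, hxy.2]; intro _; omega
    · exact h.lab_backward x y
  lab_sink := h.lab_sink

theorem Valid.toSink (h : p.Valid μ ν R H) {t : S} {δ : ℝ} (h0 : 0 ≤ δ) (h1 : δ ≤ p.excR t)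
    (h2 : δ ≤ p.room t) : (p.toSink t δ).Valid μ ν R H where
  flow_nonneg := h.flow_nonneg
  rel := h.rel
  excL_nonneg := h.excL_nonneg
  excR_nonneg x := by
    simp only [Preflow.toSink]
    split_ifs
    · linarith
    · exact h.excR_nonneg x
  room_nonneg x := by
    simp only [Preflow.toSink]
    split_ifs
    · linarith
    · exact h.room_nonneg x
  room_le x := by
    simp only [Preflow.toSink]
    split_ifs with hx
    · rw [hx]; have := h.room_le t; linarith
    · exact h.room_le x
  row := h.row
  col y := by
    have := h.col y
    simp only [Preflow.toSink]
    split_ifs with hy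
    · subst hy; linarith
    · exact this
  labL_le := h.labL_le
  labR_le := h.labR_le
  lab_forward := h.lab_forward
  lab_backward := h.lab_backward
  lab_sink y := by
    simp only [Preflow.toSink]
    split_ifs with hy
    · rw [hy]; intro _; exact h.lab_sink t (by linarith)
    · exact h.lab_sink y

/-- Together with `lab_forward`, the hypothesis `hs` says that no residual edge out of `s` descends,
which leaves one level to spare. -/
theorem Valid.raiseL (h : p.Valid μ ν R H) {s : S} (hH : p.labL s < H)
    (hs : ∀ t, R s t → p.labL s ≠ p.labR t + 1) : (p.raiseL s).Valid μ ν R H where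
  flow_nonneg := h.flow_nonneg
  rel := h.rel
  excL_nonneg := h.excL_nonneg
  excR_nonneg := h.excR_nonneg
  room_nonneg := h.room_nonneg
  room_le := h.room_le
  row := h.row
  col := h.col
  labL_le x := by
    simp only [Preflow.raiseL]
    split_ifs
    · exact hH
    · exact h.labL_le x
  labR_le := h.labR_le
  lab_forward x y hR := by
    have := h.lab_forward x y hR
    simp only [Preflow.raiseL]
    split_ifs with hx
    · subst hx
      have := hs y hR
      omega
    · exact this
  lab_backward x y hf := by
    have := h.lab_backward x y hf
    simp only [Preflow.raiseL]
    split_ifs with hx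
    · subst hx; omega
    · exact this
  lab_sink := h.lab_sink

/-- As for `raiseL`; in addition the sink edge must be saturated, because `lab_sink` holds a vertex
with an open sink edge at level 0. -/
theorem Valid.raiseR (h : p.Valid μ ν R H) {t : S} (hH : p.labR t < H) (hroom : p.room t = 0)
    (ht : ∀ s, 0 < p.flow s t → p.labR t ≠ p.labL s + 1) : (p.raiseR t).Valid μ ν R H where
  flow_nonneg := h.flow_nonneg
  rel := h.rel
  excL_nonneg := h.excL_nonneg
  excR_nonneg := h.excR_nonneg
  room_nonneg := h.room_nonneg
  room_le := h.room_le
  row := h.row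
  col := h.col
  labL_le := h.labL_le
  labR_le x := by
    simp only [Preflow.raiseR]
    split_ifs
    · exact hH
    · exact h.labR_le x
  lab_forward x y hR := by
    have := h.lab_forward x y hR
    simp only [Preflow.raiseR]
    split_ifs with hx
    · subst hx; omega
    · exact this
  lab_backward x y hf := by
    have := h.lab_backward x y hf
    simp only [Preflow.raiseR]
    split_ifs with hx
    · subst hx
      have := ht x hf
      omega
    · exact this
  lab_sink y hy := by
    have := h.lab_sink y hy
    simp only [Preflow.raiseR]
    split_ifs with hx
    · subst hx
      exact absurd hroom hy.ne'
    · exact this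

end Valid

/-! ### Progress of a pass -/

section Progress

variable {S : Type u}

def ActiveL (H : ℕ) (p : Preflow S) (s : S) : Prop := 0 < p.excL s ∧ p.labL s < H

def ActiveR (H : ℕ) (p : Preflow S) (t : S) : Prop := 0 < p.excR t ∧ p.labR t < H

variable [Fintype S]

/-- The sum of all labels. -/
def labelSum (p : Preflow S) : ℤ := ∑ x, ((p.labL x : ℤ) + p.labR x)

theorem labelSum_raiseL (p : Preflow S) (s : S) : (p.raiseL s).labelSum = p.labelSum + 1 := by
  classical
  have : ∀ x, ((if x = s then p.labL s + 1 else p.labL x : ℕ) : ℤ) + p.labR x =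
      (p.labL x + p.labR x) + if x = s then 1 else 0 := by
    intro x; split_ifs with h
    · subst h; push_cast; ring
    · ring
  simp only [labelSum, Preflow.raiseL]
  rw [sum_congr rfl fun x _ => this x, sum_add_distrib]
  simp

theorem labelSum_raiseR (p : Preflow S) (t : S) : (p.raiseR t).labelSum = p.labelSum + 1 := by
  classical
  have : ∀ x, (p.labL x : ℤ) + ((if x = t then p.labR t + 1 else p.labR x : ℕ) : ℤ) =
      (p.labL x + p.labR x) + if x = t then 1 else 0 := by
    intro x; split_ifs with h
    · subst h; push_cast; ring
    · ring
  simp only [labelSum, Preflow.raiseR]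
  rw [sum_congr rfl fun x _ => this x, sum_add_distrib]
  simp

/-- The situation in the first half of a pass which starts with label sum `L` and with active
labels at most `k`, when the vertices in `D` have been treated. -/
structure LeftInv (μ ν : SubDist S) (R : S → S → Prop) (H : ℕ) (k L : ℤ) (D : S → Prop)
    (p : Preflow S) : Prop where
  valid : p.Valid μ ν R H
  sum_le : L ≤ p.labelSum
  right : ∀ t, ActiveR H p t → (p.labR t : ℤ) ≤ k
  todo : ∀ s, ActiveL H p s → ¬ D s → (p.labL s : ℤ) ≤ k
  done : ∀ s, ActiveL H p s → D s → (p.labL s : ℤ) ≤ k + 1 ∧ L < p.labelSum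

/-- The situation in the second half of a pass. -/
structure RightInv (μ ν : SubDist S) (R : S → S → Prop) (H : ℕ) (k L : ℤ) (D : S → Prop)
    (p : Preflow S) : Prop where
  valid : p.Valid μ ν R H
  sum_le : L ≤ p.labelSum
  left : ∀ s, ActiveL H p s → (p.labL s : ℤ) ≤ k - 1 ∨ (p.labL s : ℤ) ≤ k + 1 ∧ L < p.labelSum
  todo : ∀ t, ActiveR H p t → ¬ D t → (p.labR t : ℤ) ≤ k
  done : ∀ t, ActiveR H p t → D t → (p.labR t : ℤ) ≤ k + 1 ∧ L < p.labelSum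

variable {μ ν : SubDist S} {R : S → S → Prop} {H : ℕ} {k L : ℤ} {D D' : S → Prop} {p : Preflow S}

/-- Only the copy of `t` can become active, and its label is one below that of the untreated vertex
`s`, which is at most `k`. -/
theorem LeftInv.toRight (h : p.LeftInv μ ν R H k L D) {s t : S} (hR : R s t)
    (hs : ActiveL H p s) (hD : ¬ D s) (hlab : p.labL s = p.labR t + 1) :
    (p.toRight s t).LeftInv μ ν R H k L D where
  valid := h.valid.toRight hR hlab
  sum_le := h.sum_le
  right t' ht' := by
    by_cases htt : t' = t
    · have := h.todo s hs hD
      subst htt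
      simp only [Preflow.toRight]
      omega
    · exact h.right t' (by simpa [ActiveR, Preflow.toRight, htt] using ht')
  todo s' hs' hD' := by
    by_cases hss : s' = s
    · simp [ActiveL, Preflow.toRight, hss] at hs'
    · exact h.todo s' (by simpa [ActiveL, Preflow.toRight, hss] using hs') hD'
  done s' hs' hD' := by
    by_cases hss : s' = s
    · simp [ActiveL, Preflow.toRight, hss] at hs'
    · exact h.done s' (by simpa [ActiveL, Preflow.toRight, hss] using hs') hD'

theorem LeftInv.raiseL (h : p.LeftInv μ ν R H k L D) {s : S} (hs : ActiveL H p s) (hD : ¬ D s)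
    (hD' : ∀ x, D' x ↔ D x ∨ x = s) (hlab : ∀ t, R s t → p.labL s ≠ p.labR t + 1) :
    (p.raiseL s).LeftInv μ ν R H k L D' where
  valid := h.valid.raiseL hs.2 hlab
  sum_le := by rw [labelSum_raiseL]; linarith [h.sum_le]
  right := h.right
  todo s' hs' hDs := by
    rw [hD', not_or] at hDs
    have := h.todo s' (by simpa [ActiveL, Preflow.raiseL, hDs.2] using hs') hDs.1
    simpa [Preflow.raiseL, hDs.2] using this
  done s' hs' hDs := by
    have hL := h.sum_le
    rw [labelSum_raiseL]
    by_cases hss : s' = s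
    · subst hss
      have := h.todo s' hs hD
      simp only [Preflow.raiseL, if_true]
      push_cast
      constructor <;> linarith
    · have hds : D s' := ((hD' s').1 hDs).resolve_right hss
      have := h.done s' (by simpa [ActiveL, Preflow.raiseL, hss] using hs') hds
      simp only [Preflow.raiseL, if_neg hss]
      exact ⟨this.1, by linarith⟩

theorem LeftInv.of_not_active (h : p.LeftInv μ ν R H k L D) {s : S} (hs : ¬ ActiveL H p s)
    (hD' : ∀ x, D' x ↔ D x ∨ x = s) : p.LeftInv μ ν R H k L D' where
  valid := h.valid
  sum_le := h.sum_le
  right := h.right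
  todo s' hs' hDs := h.todo s' hs' fun hd => hDs ((hD' s').2 (Or.inl hd))
  done s' hs' hDs := h.done s' hs' (((hD' s').1 hDs).resolve_right (by rintro rfl; exact hs hs'))

/-- A left vertex still active after its treatment has been relabelled in this sweep, which is the
second alternative of `left`. -/
theorem LeftInv.rightInv (h : p.LeftInv μ ν R H k L D) (hD : ∀ x, D x) (hD' : ∀ x, ¬ D' x) :
    p.RightInv μ ν R H k L D' where
  valid := h.valid
  sum_le := h.sum_le
  left s hs := Or.inr (h.done s hs (hD s))
  todo t ht _ := h.right t ht
  done t _ hDt := absurd hDt (hD' t)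

theorem RightInv.toSink (h : p.RightInv μ ν R H k L D) {t : S} {δ : ℝ} (h0 : 0 ≤ δ)
    (h1 : δ ≤ p.excR t) (h2 : δ ≤ p.room t) : (p.toSink t δ).RightInv μ ν R H k L D := by
  have hact : ∀ t', ActiveR H (p.toSink t δ) t' → ActiveR H p t' := by
    intro t' ht'
    by_cases htt : t' = t
    · subst htt
      simp only [ActiveR, Preflow.toSink, if_true] at ht'
      exact ⟨by linarith, ht'.2⟩
    · simpa [ActiveR, Preflow.toSink, htt] using ht'
  exact ⟨h.valid.toSink h0 h1 h2, h.sum_le, h.left, fun t' ht' => h.todo t' (hact t' ht'),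
    fun t' ht' => h.done t' (hact t' ht')⟩

/-- The receiving vertex `s` lies one level below an untreated vertex, hence at level at most `k -
1`; this is the first alternative of `left`. -/
theorem RightInv.toLeft (h : p.RightInv μ ν R H k L D) {s t : S} {δ : ℝ} (h0 : 0 ≤ δ)
    (h1 : δ ≤ p.excR t) (h2 : δ ≤ p.flow s t) (ht : ActiveR H p t) (hD : ¬ D t)
    (hlab : p.labR t = p.labL s + 1) : (p.toLeft s t δ).RightInv μ ν R H k L D := by
  have hact : ∀ t', ActiveR H (p.toLeft s t δ) t' → ActiveR H p t' := by
    intro t' ht'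
    by_cases htt : t' = t
    · subst htt
      simp only [ActiveR, Preflow.toLeft, if_true] at ht'
      exact ⟨by linarith, ht'.2⟩
    · simpa [ActiveR, Preflow.toLeft, htt] using ht'
  refine ⟨h.valid.toLeft h0 h1 h2 hlab, h.sum_le, fun s' hs' => ?_,
    fun t' ht' => h.todo t' (hact t' ht'), fun t' ht' => h.done t' (hact t' ht')⟩
  by_cases hss : s' = s
  · have := h.todo t ht hD
    subst hss
    left
    simp only [Preflow.toLeft]
    omega
  · exact h.left s' (by simpa [ActiveL, Preflow.toLeft, hss] using hs')

theorem RightInv.raiseR (h : p.RightInv μ ν R H k L D) {t : S} (ht : ActiveR H p t) (hD : ¬ D t)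
    (hD' : ∀ x, D' x ↔ D x ∨ x = t) (hroom : p.room t = 0)
    (hlab : ∀ s, 0 < p.flow s t → p.labR t ≠ p.labL s + 1) :
    (p.raiseR t).RightInv μ ν R H k L D' where
  valid := h.valid.raiseR ht.2 hroom hlab
  sum_le := by rw [labelSum_raiseR]; linarith [h.sum_le]
  left s hs := by
    rw [labelSum_raiseR]
    refine (h.left s hs).imp id fun h' => ⟨h'.1, ?_⟩
    linarith [h'.2]
  todo t' ht' hDt := by
    rw [hD', not_or] at hDt
    have := h.todo t' (by simpa [ActiveR, Preflow.raiseR, hDt.2] using ht') hDt.1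
    simpa [Preflow.raiseR, hDt.2] using this
  done t' ht' hDt := by
    have hL := h.sum_le
    rw [labelSum_raiseR]
    by_cases htt : t' = t
    · subst htt
      have := h.todo t' ht hD
      simp only [Preflow.raiseR, if_true]
      push_cast
      constructor <;> linarith
    · have hds : D t' := ((hD' t').1 hDt).resolve_right htt
      have := h.done t' (by simpa [ActiveR, Preflow.raiseR, htt] using ht') hds
      simp only [Preflow.raiseR, if_neg htt]
      exact ⟨this.1, by linarith⟩

theorem RightInv.of_not_active (h : p.RightInv μ ν R H k L D) {t : S} (ht : ¬ ActiveR H p t)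
    (hD' : ∀ x, D' x ↔ D x ∨ x = t) : p.RightInv μ ν R H k L D' where
  valid := h.valid
  sum_le := h.sum_le
  left := h.left
  todo t' ht' hDt := h.todo t' ht' fun hd => hDt ((hD' t').2 (Or.inl hd))
  done t' ht' hDt := h.done t' ht' (((hD' t').1 hDt).resolve_right (by rintro rfl; exact ht ht'))

/-- The situation after `j` passes: the number of passes is bounded in terms of the label sum and
of a bound for the labels of active vertices. -/
def PassInv (μ ν : SubDist S) (R : S → S → Prop) (H j : ℕ) (p : Preflow S) : Prop :=
  p.Valid μ ν R H ∧ ∃ k : ℤ, (j : ℤ) ≤ 2 * p.labelSum - k ∧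
    (∀ s, ActiveL H p s → (p.labL s : ℤ) ≤ k) ∧ ∀ t, ActiveR H p t → (p.labR t : ℤ) ≤ k

theorem PassInv.exists_leftInv {j : ℕ} (h : p.PassInv μ ν R H j) (hD : ∀ x, ¬ D x) :
    ∃ k L : ℤ, (j : ℤ) ≤ 2 * L - k ∧ p.LeftInv μ ν R H k L D := by
  obtain ⟨hv, k, hj, hl, hr⟩ := h
  exact ⟨k, p.labelSum, hj, hv, le_rfl, hr, fun s hs _ => hl s hs, fun s _ hd => absurd hd (hD s)⟩

/-- If no label was raised, all excess has moved down a level and the bound `k` drops by one.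
Otherwise the label sum grows by at least 1 while `k` grows by at most 1. In both cases twice the
label sum minus the bound grows by at least 1. -/
theorem RightInv.passInv {j : ℕ} (h : p.RightInv μ ν R H k L D) (hD : ∀ x, D x)
    (hj : (j : ℤ) ≤ 2 * L - k) : p.PassInv μ ν R H (j + 1) := by
  refine ⟨h.valid, ?_⟩
  rcases h.sum_le.eq_or_lt with hL | hL
  · refine ⟨k - 1, by push_cast; linarith, fun s hs => ?_, fun t ht => ?_⟩
    · exact (h.left s hs).resolve_right fun h' => h'.2.ne hL
    · exact absurd hL (h.done t ht (hD t)).2.ne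
  · refine ⟨k + 1, by push_cast; linarith, fun s hs => ?_, fun t ht => (h.done t ht (hD t)).1⟩
    rcases h.left s hs with h' | h'
    · linarith
    · exact h'.1

theorem Valid.labelSum_le (h : p.Valid μ ν R H) : p.labelSum ≤ 2 * Fintype.card S * H := by
  have : p.labelSum ≤ ∑ _x : S, (2 * H : ℤ) :=
    sum_le_sum fun x _ => by have := h.labL_le x; have := h.labR_le x; omega
  simpa [mul_comm, mul_left_comm] using this

/-- After this many passes the integer bound `k` for the active labels has become negative, and
labels are natural numbers. -/
theorem PassInv.not_active {j : ℕ} (h : p.PassInv μ ν R H j) (hj : 4 * Fintype.card S * H < j) :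
    (∀ s, ¬ ActiveL H p s) ∧ ∀ t, ¬ ActiveR H p t := by
  obtain ⟨hv, k, hk, hl, hr⟩ := h
  have h1 := hv.labelSum_le
  have h2 : ((4 * Fintype.card S * H : ℕ) : ℤ) < j := by exact_mod_cast hj
  have hk0 : k < 0 := by push_cast at h2; linarith
  exact ⟨fun s hs => by have := hl s hs; omega, fun t ht => by have := hr t ht; omega⟩

end Progress

/-! ### The value computed by a terminated flow computation -/

section Terminal

variable {S : Type u} [Fintype S] {μ ν : SubDist S} {R : S → S → Prop} {H : ℕ} {p : Preflow S}

/-- The mass which has not reached the sink. -/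
def deficit (p : Preflow S) : ℝ := ∑ x, (p.excL x + p.excR x)

theorem Valid.sum_sink (h : p.Valid μ ν R H) :
    ∑ y, (ν.mass y - p.room y) = μ.prob Set.univ - p.deficit := by
  have h1 : ∑ x, (p.excL x + ∑ y, p.flow x y) = ∑ x, μ.mass x := sum_congr rfl fun x _ => h.row x
  have h2 : ∑ y, (p.room y + ∑ x, p.flow x y) = ∑ y, (ν.mass y + p.excR y) :=
    sum_congr rfl fun x _ => h.col x
  have h3 := sum_comm (f := p.flow) (s := univ) (t := univ)
  simp only [sum_add_distrib, sum_sub_distrib, deficit, μ.prob_univ] at *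
  linarith

/-- Each column of the preflow is scaled down to the part which went on to the sink; this discards
the excess on the right and only lowers the row sums. -/
theorem Valid.exists_isPlan (h : p.Valid μ ν R H) :
    ∃ F, IsPlan μ ν R F ∧ ∑ x, ∑ y, F x y = μ.prob Set.univ - p.deficit := by
  have hin : ∀ y, ∑ x, p.flow x y = ν.mass y - p.room y + p.excR y := fun y => by
    linarith [h.col y]
  have hq : ∀ y, 0 ≤ (ν.mass y - p.room y) / ∑ x, p.flow x y := fun y =>
    div_nonneg (by linarith [h.room_le y]) (sum_nonneg fun x _ => h.flow_nonneg x y)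
  have hq1 : ∀ y, (ν.mass y - p.room y) / ∑ x, p.flow x y ≤ 1 := fun y =>
    div_le_one_of_le₀ (by linarith [hin y, h.excR_nonneg y])
      (sum_nonneg fun x _ => h.flow_nonneg x y)
  have hcol : ∀ y, ∑ x, p.flow x y * ((ν.mass y - p.room y) / ∑ x, p.flow x y) =
      ν.mass y - p.room y := by
    intro y
    rw [← sum_mul]
    -- The quotient may be 0/0: a column without inflow has sent nothing to the sink, since the
    -- excess is nonnegative and `room` is at most the mass.
    refine mul_div_cancel_of_imp' fun h0 => ?_
    linarith [hin y, h.excR_nonneg y, h.room_le y]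
  refine ⟨fun x y => p.flow x y * ((ν.mass y - p.room y) / ∑ x, p.flow x y),
    ⟨fun x y => mul_nonneg (h.flow_nonneg x y) (hq y), fun x y hne => h.rel x y (left_ne_zero_of_mul hne),
      fun x => ?_, fun y => ?_⟩, ?_⟩
  · refine (sum_le_sum fun y _ => mul_le_of_le_one_right (h.flow_nonneg x y) (hq1 y)).trans ?_
    linarith [h.row x, h.excL_nonneg x]
  · rw [hcol]; linarith [h.room_nonneg y]
  · rw [sum_comm, ← h.sum_sink]
    exact sum_congr rfl fun y _ => hcol y

/-- If no vertex is active, some level below `H` separates the vertices with an excess from those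
which are connected to the sink. -/
theorem Valid.exists_cut (h : p.Valid μ ν R (2 * Fintype.card S + 1))
    (hl : ∀ s, ¬ ActiveL (2 * Fintype.card S + 1) p s)
    (hr : ∀ t, ¬ ActiveR (2 * Fintype.card S + 1) p t) :
    ∃ E : Set S, μ.prob Set.univ - μ.prob E + ν.prob (relImage R E) ≤
      μ.prob Set.univ - p.deficit := by
  classical
  -- At most 2|S| labels occur, but there are 2|S|+1 levels below the cap, so some level `k` is
  -- empty. As residual edges descend by at most one level, none of them crosses it downwards.
  obtain ⟨k, hk, hkL, hkR⟩ : ∃ k < 2 * Fintype.card S + 1,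
      (∀ x, p.labL x ≠ k) ∧ ∀ x, p.labR x ≠ k := by
    have hc : (univ.image p.labL ∪ univ.image p.labR).card < (range (2 * Fintype.card S + 1)).card := by
      have h1 := card_union_le (univ.image p.labL) (univ.image p.labR)
      have h2 : (univ.image p.labL).card ≤ Fintype.card S := card_image_le
      have h3 : (univ.image p.labR).card ≤ Fintype.card S := card_image_le
      rw [card_range]; omega
    obtain ⟨k, hk, hk'⟩ := exists_mem_notMem_of_card_lt_card hc
    simp only [mem_union, mem_image, mem_univ, true_and, not_or, not_exists] at hk'
    exact ⟨k, mem_range.1 hk, hk'.1, hk'.2⟩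
  have hexL : ∀ s, p.labL s < k → p.excL s = 0 := fun s hs =>
    le_antisymm (not_lt.1 fun h0 => hl s ⟨h0, by omega⟩) (h.excL_nonneg s)
  have hexR : ∀ s, p.labR s < k → p.excR s = 0 := fun s hs =>
    le_antisymm (not_lt.1 fun h0 => hr s ⟨h0, by omega⟩) (h.excR_nonneg s)
  have hroom : ∀ t, k < p.labR t → p.room t = 0 := fun t ht =>
    le_antisymm (not_lt.1 fun h0 => by have := h.lab_sink t h0; omega) (h.room_nonneg t)
  have hcross : ∀ s t, p.labL s < k → k < p.labR t → p.flow s t = 0 := fun s t hs ht =>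
    le_antisymm (not_lt.1 fun h0 => by have := h.lab_backward s t h0; omega) (h.flow_nonneg s t)
  have hfor : ∀ s t, k < p.labL s → R s t → k < p.labR t := fun s t hs hR => by
    have := h.lab_forward s t hR
    have := hkR t
    omega
  -- Above `k` all sink edges are saturated and edges of `R` stay above. Below `k` there is no
  -- excess and no flow runs from below to above. Hence the capacity of this cut is at most the
  -- amount that reached the sink.
  refine ⟨{s | k < p.labL s}, ?_⟩
  have hT : ν.prob (relImage R {s | k < p.labL s}) ≤ ν.prob {t | k < p.labR t} := by
    refine ν.prob_mono ?_
    rintro t ⟨s, hs, hR⟩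
    exact hfor s t hs hR
  have hflow : ∑ x, {s | k < p.labL s}ᶜ.indicator (fun x => ∑ y, p.flow x y) x ≤
      ∑ y, {t | k < p.labR t}ᶜ.indicator (fun y => ∑ x, p.flow x y) y := by
    have : ∀ x, {s | k < p.labL s}ᶜ.indicator (fun x => ∑ y, p.flow x y) x ≤
        ∑ y, {t | k < p.labR t}ᶜ.indicator (fun y => p.flow x y) y := by
      intro x
      by_cases hx : k < p.labL x
      · simp only [Set.indicator_apply, Set.mem_compl_iff, Set.mem_ofPred_eq, hx, not_true, if_false]
        exact sum_nonneg fun y _ => by split_ifs <;> first | exact h.flow_nonneg x y | exact le_rfl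
      · simp only [Set.indicator_apply, Set.mem_compl_iff, Set.mem_ofPred_eq, hx, not_false_iff,
          if_true]
        refine sum_le_sum fun y _ => ?_
        split_ifs with hy
        · exact (hcross x y (by have := hkL x; omega) hy).le
        · exact le_rfl
    refine (sum_le_sum fun x _ => this x).trans ?_
    rw [sum_comm]
    refine sum_le_sum fun y _ => ?_
    by_cases hy : k < p.labR y <;> simp [hy]
  have hsrc : μ.prob Set.univ - μ.prob {s | k < p.labL s} =
      ∑ x, {s | k < p.labL s}ᶜ.indicator (fun x => ∑ y, p.flow x y) x := by
    simp only [SubDist.prob, ← sum_sub_distrib]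
    refine sum_congr rfl fun x _ => ?_
    by_cases hx : k < p.labL x
    · simp [hx]
    · have := h.row x
      rw [hexL x (by have := hkL x; omega)] at this
      simp only [Set.indicator_apply, Set.mem_univ, Set.mem_compl_iff, Set.mem_ofPred_eq, hx,
        if_true, if_false, not_false_iff]
      linarith
  have hsnk : ∑ y, {t | k < p.labR t}ᶜ.indicator (fun y => ∑ x, p.flow x y) y +
      ν.prob {t | k < p.labR t} = ∑ y, (ν.mass y - p.room y) := by
    simp only [SubDist.prob, ← sum_add_distrib]
    refine sum_congr rfl fun y _ => ?_
    by_cases hy : k < p.labR y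
    · simp [hy, hroom y hy]
    · have := h.col y
      rw [hexR y (by have := hkR y; omega)] at this
      simp only [Set.indicator_apply, Set.mem_compl_iff, Set.mem_ofPred_eq, hy,
        if_true, if_false, not_false_iff]
      linarith
  rw [← h.sum_sink, ← hsnk, hsrc]
  linarith

theorem Valid.maxFlow_eq (h : p.Valid μ ν R (2 * Fintype.card S + 1))
    (hl : ∀ s, ¬ ActiveL (2 * Fintype.card S + 1) p s)
    (hr : ∀ t, ¬ ActiveR (2 * Fintype.card S + 1) p t) :
    (relNetwork μ ν R).maxFlow = μ.prob Set.univ - p.deficit := by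
  obtain ⟨F, hF, hFv⟩ := h.exists_isPlan
  obtain ⟨E, hE⟩ := h.exists_cut hl hr
  exact le_antisymm ((maxFlow_le_cut E).trans hE) (hFv ▸ hF.sum_le_maxFlow)

end Terminal

end Preflow

/-! ### The flow program -/

namespace FlowProgram

abbrev labL : NatVar := .scratch 0
abbrev labR : NatVar := .scratch 1
abbrev target : NatVar := .scratch 2
abbrev cu : NatVar := .scratch 3
abbrev cw : NatVar := .scratch 4
abbrev cp : NatVar := .scratch 5
abbrev cq : NatVar := .scratch 6
abbrev cr : NatVar := .scratch 7
abbrev flow : RealVar := .scratch 0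
abbrev excL : RealVar := .scratch 1
abbrev excR : RealVar := .scratch 2
abbrev room : RealVar := .scratch 3
abbrev thr : RealVar := .scratch 4
abbrev rest : RealVar := .scratch 5

/-- The number of states. -/
abbrev nS : NatExpr := .get .numStates []

/-- The level that labels never exceed. -/
abbrev top : NatExpr := .add (.add nS nS) (.const 1)

abbrev natEq (e₁ e₂ : NatExpr) : Test := .and (.not (.natLt e₁ e₂)) (.not (.natLt e₂ e₁))

/-- Treat the vertex `cu` on the left. -/
def dischargeL : Cmd :=
  .ite (.and (.realLt .zero (.get excL [cu])) (.natLt (.get labL [cu]) top))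
    (forLoop cw nS
      (.ite (.and (.realLt .zero (.get excL [cu]))
          (.and (.not (.realLt (.get thr []) (.get .old [cu, cw])))
            (natEq (.get labL [cu]) (.add (.get labR [cw]) (.const 1)))))
        (.realSet flow [cu, cw] (.add (.get flow [cu, cw]) (.get excL [cu])) ;;
         .realSet excR [cw] (.add (.get excR [cw]) (.get excL [cu])) ;;
         .realSet excL [cu] .zero)
        .skip) ;;
     .ite (.realLt .zero (.get excL [cu]))
       (.natSet labL [cu] (.add (.get labL [cu]) (.const 1))) .skip)
    .skip

/-- Treat the vertex `cw` on the right. -/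
def dischargeR : Cmd :=
  .ite (.and (.realLt .zero (.get excR [cw])) (.natLt (.get labR [cw]) top))
    (.ite (.realLt (.get excR [cw]) (.get room [cw]))
       (.realSet room [cw] (.sub (.get room [cw]) (.get excR [cw])) ;;
        .realSet excR [cw] .zero)
       (.realSet excR [cw] (.sub (.get excR [cw]) (.get room [cw])) ;;
        .realSet room [cw] .zero) ;;
     forLoop cu nS
      (.ite (.and (.realLt .zero (.get excR [cw]))
          (.and (.realLt .zero (.get flow [cu, cw]))
            (natEq (.get labR [cw]) (.add (.get labL [cu]) (.const 1)))))
        (.ite (.realLt (.get excR [cw]) (.get flow [cu, cw]))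
          (.realSet flow [cu, cw] (.sub (.get flow [cu, cw]) (.get excR [cw])) ;;
           .realSet excL [cu] (.add (.get excL [cu]) (.get excR [cw])) ;;
           .realSet excR [cw] .zero)
          (.realSet excL [cu] (.add (.get excL [cu]) (.get flow [cu, cw])) ;;
           .realSet excR [cw] (.sub (.get excR [cw]) (.get flow [cu, cw])) ;;
           .realSet flow [cu, cw] .zero))
        .skip) ;;
     .ite (.realLt .zero (.get excR [cw]))
       (.natSet labR [cw] (.add (.get labR [cw]) (.const 1))) .skip)
    .skip

def sweep : Cmd := forLoop cu nS dischargeL ;; forLoop cw nS dischargeR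

/-- Start with all the mass of the `i`-th transition of `s` on the left; the transition of `t` in
question is the one with number `target`. -/
def load : Cmd :=
  forLoop cu nS
    (.realSet excL [cu] (.get .prob [.s, .a, .i, cu]) ;;
     .realSet excR [cu] .zero ;;
     .realSet room [cu] (.get .prob [.t, .a, target, cu]) ;;
     .natSet labL [cu] (.const 0) ;;
     .natSet labR [cu] (.const 0) ;;
     forLoop cw nS (.realSet flow [cu, cw] .zero))

def sweeps : Cmd := forLoop cp nS (forLoop cq nS (forLoop cr (.const 13) sweep))

/-- `rest := μ(S) - maxflow`, where the edges of the network are the pairs with `old ≤ thr`. -/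
def computeRest : Cmd :=
  load ;; sweeps ;; .realSet rest [] .zero ;;
  forLoop cu nS (.realSet rest []
    (.add (.get rest []) (.add (.get excL [cu]) (.get excR [cu]))))

end FlowProgram

open FlowProgram

attribute [local simp] NatExpr.cost RealExpr.cost Test.cost

/-! ### Reading a preflow off the memory. -/

section View

variable {S : Type u} [Fintype S] (ι : S ≃ Fin (Fintype.card S))

/-- The preflow in the memory. -/
def view (σ : State) : Preflow S where
  flow x y := σ.real flow [(ι x : ℕ), (ι y : ℕ)]
  excL x := σ.real excL [(ι x : ℕ)]
  excR x := σ.real excR [(ι x : ℕ)]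
  room x := σ.real room [(ι x : ℕ)]
  labL x := σ.nat labL [(ι x : ℕ)]
  labR x := σ.nat labR [(ι x : ℕ)]

theorem num_inj {x y : S} : (ι x : ℕ) = (ι y : ℕ) ↔ x = y := by
  rw [Fin.val_inj, ι.apply_eq_iff_eq]

theorem num_surj {k : ℕ} (hk : k < Fintype.card S) : ∃ x, (ι x : ℕ) = k :=
  ⟨ι.symm ⟨k, hk⟩, by simp⟩

/-- In the loop invariants the treated vertices are those with a number below the counter; one round
adds one vertex to them. -/
theorem num_lt_succ {x y : S} : (ι y : ℕ) < ι x + 1 ↔ (ι y : ℕ) < ι x ∨ y = x := by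
  rw [← num_inj ι]; omega

theorem view_setNat {σ : State} {z : NatVar} {l : List ℕ} {r : ℕ} (h0 : labL ≠ z)
    (h1 : labR ≠ z) : view ι (σ.setNat z l r) = view ι σ := by
  simp only [view, State.setNat_real, State.setNat_nat_of_ne _ _ _ h0,
    State.setNat_nat_of_ne _ _ _ h1]

/-- The memory contains the number of states, and the relation `R` by means of `old` and `thr`. -/
structure FlowCtx (R : S → S → Prop) (σ : State) : Prop where
  numStates : σ.nat .numStates [] = Fintype.card S
  rel : ∀ x y, R x y ↔ σ.real .old [(ι x : ℕ), (ι y : ℕ)] ≤ σ.real thr []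

variable {ι} {R : S → S → Prop} {c : Cmd} {σ σ' : State}

theorem FlowCtx.frame (h : FlowCtx ι R σ) (hF : Frame c σ σ') (h1 : ¬ c.WritesNat .numStates)
    (h2 : ¬ c.WritesReal .old) (h3 : ¬ c.WritesReal thr) : FlowCtx ι R σ' where
  numStates := by rw [hF.nat _ h1, h.numStates]
  rel x y := by rw [hF.real _ h2, hF.real _ h3, h.rel]

theorem FlowCtx.eval_nS (h : FlowCtx ι R σ) : nS.eval σ = Fintype.card S := h.numStates

end View

open Classical in
theorem State.setNat_nat (σ : State) (z z' : NatVar) (l l' : List ℕ) (c : ℕ) :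
    (σ.setNat z l c).nat z' l' = if z' = z ∧ l' = l then c else σ.nat z' l' := by
  simp [State.setNat]

open Classical in
theorem State.setReal_real (σ : State) (z z' : RealVar) (l l' : List ℕ) (c : ℝ) :
    (σ.setReal z l c).real z' l' = if z' = z ∧ l' = l then c else σ.real z' l' := by
  simp [State.setReal]

/-! ### The treatment of one vertex, and one sweep over all vertices. -/

section Discharge

variable {S : Type u} [Fintype S] {ι : S ≃ Fin (Fintype.card S)} {μ ν : SubDist S}
  {R : S → S → Prop} {k L : ℤ} {D D' : S → Prop} {σ : State} {g : Prop}

theorem runs_dischargeL (hC : FlowCtx ι R σ) {s : S} (hs : σ.nat cu [] = ι s)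
    (h : (view ι σ).LeftInv μ ν R (2 * Fintype.card S + 1) k L D) (hD : ¬ D s)
    (hD' : ∀ x, D' x ↔ D x ∨ x = s) :
    Runs g dischargeL σ (100 * (Fintype.card S + 1))
      fun σ' => (view ι σ').LeftInv μ ν R (2 * Fintype.card S + 1) k L D' := by
  classical
  unfold dischargeL
  refine Runs.mono_bound (Runs.ite (B₁ := (Fintype.card S + 1) * 68 + 20) (B₂ := 1)
    (fun hb => ?_) (fun hb => ?_)) ?_
  · have hact : Preflow.ActiveL (2 * Fintype.card S + 1) (view ι σ) s := by
      simpa [Test.Holds, RealExpr.eval, NatExpr.eval, State.index, hs, hC.numStates, two_mul,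
        Preflow.ActiveL, view] using hb
    -- While an excess remains at `s`, no neighbour scanned so far is exactly one level below.
    -- Labels are constant during the scan, so at its end this is the condition for raising `s`.
    refine Runs.seq (B₂ := 20) (Runs.forLoop (B := 60) (m := Fintype.card S) (fun y σ' =>
      (view ι σ').LeftInv μ ν R (2 * Fintype.card S + 1) k L D ∧
      (view ι σ').labL s < 2 * Fintype.card S + 1 ∧ (0 < (view ι σ').excL s →
        ∀ t, (ι t : ℕ) < y → R s t → (view ι σ').labL s ≠ (view ι σ').labR t + 1)) ?_ ?_ ?_ ?_ ?_)
      ?_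
    · simp [Cmd.WritesNat]
    · exact fun σ' hF => (hC.frame hF (by simp [forLoop, Cmd.WritesNat])
        (by simp [forLoop, Cmd.WritesReal]) (by simp [forLoop, Cmd.WritesReal])).eval_nS
    · intro y σ' r h'
      rwa [view_setNat ι (by simp) (by simp)]
    · exact ⟨h, hact.2, fun _ t ht => absurd ht (Nat.not_lt_zero _)⟩
    · rintro y hy σ' hF hw ⟨h1, h2, h3⟩
      obtain ⟨t, rfl⟩ := num_surj ι hy
      have hC' : FlowCtx ι R σ' := hC.frame hF (by simp [forLoop, Cmd.WritesNat])
        (by simp [forLoop, Cmd.WritesReal]) (by simp [forLoop, Cmd.WritesReal])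
      have hs' : σ'.nat cu [] = ι s := by
        rw [hF.nat cu (by simp [forLoop, Cmd.WritesNat]), hs]
      refine Runs.mono_bound (Runs.ite (B₁ := 24) (B₂ := 1) (fun hb => ?_) (fun hb => ?_))
        (by simp)
      · have hb' : 0 < (view ι σ').excL s ∧ R s t ∧
            (view ι σ').labL s = (view ι σ').labR t + 1 := by
          simp only [Test.Holds, RealExpr.eval, NatExpr.eval, State.index, List.map_cons,
            List.map_nil, hs', hw, not_lt, ← hC'.rel] at hb
          exact ⟨hb.1, hb.2.1, le_antisymm hb.2.2.2 hb.2.2.1⟩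
        refine Runs.mono_bound (Runs.realSet_seq (Runs.realSet_seq (Runs.realSet ?_))) (by simp)
        have hview : ∀ σ₂, σ₂ = (((σ'.setReal flow (σ'.index [cu, cw])
            ((RealExpr.add (.get flow [cu, cw]) (.get excL [cu])).eval σ')).setReal excR
            (σ'.index [cw]) (σ'.real excR [(ι t : ℕ)] + σ'.real excL [(ι s : ℕ)])).setReal excL
            (σ'.index [cu]) 0) → view ι σ₂ = (view ι σ').toRight s t := by
          rintro _ rfl
          ext <;> simp [view, Preflow.toRight, State.setReal_real, State.index, RealExpr.eval, hs',
            hw, num_inj]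
        rw [hview _ (by simp [State.index, RealExpr.eval, State.setReal_real, hs', hw])]
        -- A push empties `s`, which makes the last clause of the invariant vacuous.
        exact ⟨h1.toRight hb'.2.1 ⟨hb'.1, h2⟩ hD hb'.2.2, h2, fun h0 => by
          simp [Preflow.toRight] at h0⟩
      · refine Runs.skip ⟨h1, h2, fun h0 t' ht' hR heq => ?_⟩
        rcases (num_lt_succ ι).1 ht' with ht' | rfl
        · exact h3 h0 t' ht' hR heq
        · refine hb ?_
          simp only [Test.Holds, RealExpr.eval, NatExpr.eval, State.index, List.map_cons,
            List.map_nil, hs', hw, not_lt, ← hC'.rel]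
          exact ⟨h0, hR, heq.ge, heq.le⟩
    · rintro σ' hF ⟨h1, h2, h3⟩
      have hs' : σ'.nat cu [] = ι s := by
        rw [hF.nat cu (by simp [forLoop, Cmd.WritesNat]), hs]
      refine Runs.mono_bound (Runs.ite (fun hb => Runs.natSet ?_) (fun hb => Runs.skip ?_))
        (by simp)
      · have h0 : 0 < (view ι σ').excL s := by
          simpa [Test.Holds, RealExpr.eval, State.index, hs', view] using hb
        have hview : view ι (σ'.setNat labL (σ'.index [cu])
            ((NatExpr.add (.get labL [cu]) (.const 1)).eval σ')) = (view ι σ').raiseL s := by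
          ext <;> simp [view, Preflow.raiseL, State.setNat_nat, State.index, NatExpr.eval, hs',
            num_inj]
        rw [hview]
        exact h1.raiseL ⟨h0, h2⟩ hD hD' fun t => h3 h0 t (ι t).2
      · refine h1.of_not_active (fun h0 => hb ?_) hD'
        simpa [Test.Holds, RealExpr.eval, State.index, hs', view] using h0.1
  · refine Runs.skip (h.of_not_active (fun h0 => hb ?_) hD')
    simpa [Test.Holds, RealExpr.eval, NatExpr.eval, State.index, hs, hC.numStates, two_mul,
      Preflow.ActiveL, view] using h0
  · simp
    omega

theorem runs_dischargeR (hC : FlowCtx ι R σ) {t : S} (ht : σ.nat cw [] = ι t)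
    (h : (view ι σ).RightInv μ ν R (2 * Fintype.card S + 1) k L D) (hD : ¬ D t)
    (hD' : ∀ x, D' x ↔ D x ∨ x = t) :
    Runs g dischargeR σ (200 * (Fintype.card S + 1))
      fun σ' => (view ι σ').RightInv μ ν R (2 * Fintype.card S + 1) k L D' := by
  classical
  unfold dischargeR
  refine Runs.mono_bound (Runs.ite (B₁ := (Fintype.card S + 1) * 128 + 60) (B₂ := 1)
    (fun hb => ?_) (fun hb => ?_)) (by simp; omega)
  · have hact : Preflow.ActiveR (2 * Fintype.card S + 1) (view ι σ) t := by
      simpa [Test.Holds, RealExpr.eval, NatExpr.eval, State.index, ht, hC.numStates, two_mul,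
        Preflow.ActiveR, view] using hb
    -- The push to the sink moves the smaller of excess and room, so an excess that remains means a
    -- saturated sink edge, as `raiseR` requires.
    refine Runs.mono_bound (Runs.seq (B₁ := 40) (B₂ := (Fintype.card S + 1) * 128 + 20)
      (Q' := fun σ' => (view ι σ').RightInv μ ν R (2 * Fintype.card S + 1) k L D ∧
        (view ι σ').labR t < 2 * Fintype.card S + 1 ∧
        (0 < (view ι σ').excR t → (view ι σ').room t = 0)) ?_ ?_) (by omega)
    · refine Runs.mono_bound (Runs.ite (B₁ := 15) (B₂ := 15) (fun hb => ?_) (fun hb => ?_))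
        (by simp)
      · have hlt : (view ι σ).excR t < (view ι σ).room t := by
          simpa [Test.Holds, RealExpr.eval, State.index, ht, view] using hb
        refine Runs.mono_bound (Runs.realSet_seq (Runs.realSet ?_)) (by simp)
        have hview : ∀ σ₂, σ₂ = ((σ.setReal room (σ.index [cw])
            ((RealExpr.sub (.get room [cw]) (.get excR [cw])).eval σ)).setReal excR
            (σ.index [cw]) 0) → view ι σ₂ = (view ι σ).toSink t ((view ι σ).excR t) := by
          rintro _ rfl
          ext <;> simp [view, Preflow.toSink, State.setReal_real, State.index, RealExpr.eval, ht,
            num_inj]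
        rw [hview _ (by simp [State.index, RealExpr.eval])]
        refine ⟨h.toSink (h.valid.excR_nonneg t) le_rfl hlt.le, hact.2, fun h0 => ?_⟩
        simp [Preflow.toSink] at h0
      · have hle : (view ι σ).room t ≤ (view ι σ).excR t := by
          simpa [Test.Holds, RealExpr.eval, State.index, ht, view] using hb
        refine Runs.mono_bound (Runs.realSet_seq (Runs.realSet ?_)) (by simp)
        have hview : ∀ σ₂, σ₂ = ((σ.setReal excR (σ.index [cw])
            ((RealExpr.sub (.get excR [cw]) (.get room [cw])).eval σ)).setReal room
            (σ.index [cw]) 0) → view ι σ₂ = (view ι σ).toSink t ((view ι σ).room t) := by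
          rintro _ rfl
          ext <;> simp [view, Preflow.toSink, State.setReal_real, State.index, RealExpr.eval, ht,
            num_inj]
        rw [hview _ (by simp [State.index, RealExpr.eval])]
        refine ⟨h.toSink (h.valid.room_nonneg t) hle le_rfl, hact.2, fun h0 => ?_⟩
        simp [Preflow.toSink]
    · rintro σ₁ hF₁ ⟨h1, h2, h3⟩
      have ht₁ : σ₁.nat cw [] = ι t := by
        rw [hF₁.nat cw (by simp [Cmd.WritesNat]), ht]
      have hC₁ : FlowCtx ι R σ₁ := hC.frame hF₁ (by simp [Cmd.WritesNat])
        (by simp [Cmd.WritesReal]) (by simp [Cmd.WritesReal])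
      refine Runs.seq (B₂ := 20) (Runs.forLoop (B := 120) (m := Fintype.card S) (fun y σ' =>
        (view ι σ').RightInv μ ν R (2 * Fintype.card S + 1) k L D ∧
        (view ι σ').labR t < 2 * Fintype.card S + 1 ∧ (0 < (view ι σ').excR t →
          (view ι σ').room t = 0 ∧ ∀ s, (ι s : ℕ) < y → 0 < (view ι σ').flow s t →
            (view ι σ').labR t ≠ (view ι σ').labL s + 1)) ?_ ?_ ?_ ?_ ?_) ?_
      · simp [Cmd.WritesNat]
      · exact fun σ' hF => (hC₁.frame hF (by simp [forLoop, Cmd.WritesNat])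
          (by simp [forLoop, Cmd.WritesReal]) (by simp [forLoop, Cmd.WritesReal])).eval_nS
      · intro y σ' r h'
        rwa [view_setNat ι (by simp) (by simp)]
      · exact ⟨h1, h2, fun h0 => ⟨h3 h0, fun _ hs => absurd hs (Nat.not_lt_zero _)⟩⟩
      · rintro y hy σ' hF hu ⟨h1, h2, h3⟩
        obtain ⟨s, rfl⟩ := num_surj ι hy
        have ht' : σ'.nat cw [] = ι t := by
          rw [hF.nat cw (by simp [forLoop, Cmd.WritesNat]), ht₁]
        refine Runs.mono_bound (Runs.ite (B₁ := 70) (B₂ := 1) (fun hb => ?_) (fun hb => ?_))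
          (by simp)
        · have hb' : 0 < (view ι σ').excR t ∧ 0 < (view ι σ').flow s t ∧
              (view ι σ').labR t = (view ι σ').labL s + 1 := by
            simp only [Test.Holds, RealExpr.eval, NatExpr.eval, State.index, List.map_cons,
              List.map_nil, ht', hu, not_lt] at hb
            exact ⟨hb.1, hb.2.1, le_antisymm hb.2.2.2 hb.2.2.1⟩
          have hact' : Preflow.ActiveR (2 * Fintype.card S + 1) (view ι σ') t := ⟨hb'.1, h2⟩
          refine Runs.mono_bound (Runs.ite (B₁ := 30) (B₂ := 30) (fun hc => ?_) (fun hc => ?_))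
            (by simp)
          · have hlt : (view ι σ').excR t < (view ι σ').flow s t := by
              simpa [Test.Holds, RealExpr.eval, State.index, ht', hu, view] using hc
            refine Runs.mono_bound (Runs.realSet_seq (Runs.realSet_seq (Runs.realSet ?_)))
              (by simp)
            have hview : ∀ σ₂, σ₂ = (((σ'.setReal flow (σ'.index [cu, cw])
                ((RealExpr.sub (.get flow [cu, cw]) (.get excR [cw])).eval σ')).setReal excL
                (σ'.index [cu]) (σ'.real excL [(ι s : ℕ)] + σ'.real excR [(ι t : ℕ)])).setReal
                excR (σ'.index [cw]) 0) →
                view ι σ₂ = (view ι σ').toLeft s t ((view ι σ').excR t) := by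
              rintro _ rfl
              ext <;> simp [view, Preflow.toLeft, State.setReal_real, State.index, RealExpr.eval,
                ht', hu, num_inj]
            rw [hview _ (by simp [State.index, RealExpr.eval, State.setReal_real, ht', hu])]
            refine ⟨h1.toLeft hb'.1.le le_rfl hlt.le hact' hD hb'.2.2, h2, fun h0 => ?_⟩
            simp [Preflow.toLeft] at h0
          · have hle : (view ι σ').flow s t ≤ (view ι σ').excR t := by
              simpa [Test.Holds, RealExpr.eval, State.index, ht', hu, view] using hc
            refine Runs.mono_bound (Runs.realSet_seq (Runs.realSet_seq (Runs.realSet ?_)))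
              (by simp)
            have hview : ∀ σ₂, σ₂ = (((σ'.setReal excL (σ'.index [cu])
                ((RealExpr.add (.get excL [cu]) (.get flow [cu, cw])).eval σ')).setReal excR
                (σ'.index [cw]) (σ'.real excR [(ι t : ℕ)] - σ'.real flow [(ι s : ℕ), (ι t : ℕ)])
                ).setReal flow (σ'.index [cu, cw]) 0) →
                view ι σ₂ = (view ι σ').toLeft s t ((view ι σ').flow s t) := by
              rintro _ rfl
              ext <;> simp [view, Preflow.toLeft, State.setReal_real, State.index, RealExpr.eval,
                ht', hu, num_inj]
            rw [hview _ (by simp [State.index, RealExpr.eval, State.setReal_real, ht', hu])]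
            -- Here all the flow from `s` is returned, so `s` drops out of the vertices to be
            -- compared; the flows from earlier vertices are unchanged.
            refine ⟨h1.toLeft hb'.2.1.le hle le_rfl hact' hD hb'.2.2, h2, fun h0 =>
              ⟨(h3 hb'.1).1, fun s' hs' hf => ?_⟩⟩
            rcases (num_lt_succ ι).1 hs' with hs' | rfl
            · have hss : s' ≠ s := by rintro rfl; exact lt_irrefl _ hs'
              exact (h3 hb'.1).2 s' hs' (by simpa [Preflow.toLeft, hss] using hf)
            · simp [Preflow.toLeft] at hf
        · refine Runs.skip ⟨h1, h2, fun h0 => ⟨(h3 h0).1, fun s' hs' hf heq => ?_⟩⟩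
          rcases (num_lt_succ ι).1 hs' with hs' | rfl
          · exact (h3 h0).2 s' hs' hf heq
          · refine hb ?_
            simp only [Test.Holds, RealExpr.eval, NatExpr.eval, State.index, List.map_cons,
              List.map_nil, ht', hu, not_lt]
            exact ⟨h0, hf, heq.ge, heq.le⟩
      · rintro σ' hF ⟨h1, h2, h3⟩
        have ht' : σ'.nat cw [] = ι t := by
          rw [hF.nat cw (by simp [forLoop, Cmd.WritesNat]), ht₁]
        refine Runs.mono_bound (Runs.ite (fun hb => Runs.natSet ?_) (fun hb => Runs.skip ?_))
          (by simp)
        · have h0 : 0 < (view ι σ').excR t := by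
            simpa [Test.Holds, RealExpr.eval, State.index, ht', view] using hb
          have hview : view ι (σ'.setNat labR (σ'.index [cw])
              ((NatExpr.add (.get labR [cw]) (.const 1)).eval σ')) = (view ι σ').raiseR t := by
            ext <;> simp [view, Preflow.raiseR, State.setNat_nat, State.index, NatExpr.eval, ht',
              num_inj]
          rw [hview]
          exact h1.raiseR ⟨h0, h2⟩ hD hD' (h3 h0).1 fun s => (h3 h0).2 s (ι s).2
        · refine h1.of_not_active (fun h0 => hb ?_) hD'
          simpa [Test.Holds, RealExpr.eval, State.index, ht', view] using h0.1
  · refine Runs.skip (h.of_not_active (fun h0 => hb ?_) hD')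
    simpa [Test.Holds, RealExpr.eval, NatExpr.eval, State.index, ht, hC.numStates, two_mul,
      Preflow.ActiveR, view] using h0

theorem runs_sweep (hC : FlowCtx ι R σ) {j : ℕ}
    (h : (view ι σ).PassInv μ ν R (2 * Fintype.card S + 1) j) :
    Runs g sweep σ (400 * (Fintype.card S + 1) ^ 2)
      fun σ' => (view ι σ').PassInv μ ν R (2 * Fintype.card S + 1) (j + 1) := by
  obtain ⟨k, L, hj, h⟩ := h.exists_leftInv (D := fun x => (ι x : ℕ) < 0) fun x => Nat.not_lt_zero _
  refine Runs.mono_bound (Runs.seq (Runs.forLoop (B := 100 * (Fintype.card S + 1))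
    (m := Fintype.card S) (fun y σ' => (view ι σ').LeftInv μ ν R (2 * Fintype.card S + 1) k L
      fun x => (ι x : ℕ) < y) ?_ ?_ ?_ h ?_) fun σ₁ hF₁ h₁ =>
    (Runs.forLoop (B := 200 * (Fintype.card S + 1))
      (m := Fintype.card S) (fun y σ' => (view ι σ').RightInv μ ν R (2 * Fintype.card S + 1) k L
        fun x => (ι x : ℕ) < y) ?_ ?_ ?_ ?_ ?_).mono_post fun σ₂ hF₂ h₂ => ?_) ?_
  · simp [dischargeL, Cmd.WritesNat, forLoop]
  · exact fun σ' hF => (hC.frame hF (by simp [dischargeL, forLoop, Cmd.WritesNat])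
      (by simp [dischargeL, forLoop, Cmd.WritesReal])
      (by simp [dischargeL, forLoop, Cmd.WritesReal])).eval_nS
  · intro y σ' r h'
    rwa [view_setNat ι (by simp) (by simp)]
  · rintro y hy σ' hF hw h'
    obtain ⟨t, rfl⟩ := num_surj ι hy
    exact runs_dischargeL (hC.frame hF (by simp [dischargeL, forLoop, Cmd.WritesNat])
      (by simp [dischargeL, forLoop, Cmd.WritesReal])
      (by simp [dischargeL, forLoop, Cmd.WritesReal])) hw h' (lt_irrefl _)
      fun x => num_lt_succ ι
  · simp [dischargeR, Cmd.WritesNat, forLoop]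
  · have hC₁ := hC.frame hF₁ (by simp [dischargeL, forLoop, Cmd.WritesNat])
      (by simp [dischargeL, forLoop, Cmd.WritesReal])
      (by simp [dischargeL, forLoop, Cmd.WritesReal])
    exact fun σ' hF => (hC₁.frame hF (by simp [dischargeR, forLoop, Cmd.WritesNat])
      (by simp [dischargeR, forLoop, Cmd.WritesReal])
      (by simp [dischargeR, forLoop, Cmd.WritesReal])).eval_nS
  · intro y σ' r h'
    rwa [view_setNat ι (by simp) (by simp)]
  · exact h₁.rightInv (fun x => (ι x).2) fun x => Nat.not_lt_zero _
  · rintro y hy σ' hF hw h'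
    obtain ⟨t, rfl⟩ := num_surj ι hy
    have hC₁ := hC.frame hF₁ (by simp [dischargeL, forLoop, Cmd.WritesNat])
      (by simp [dischargeL, forLoop, Cmd.WritesReal])
      (by simp [dischargeL, forLoop, Cmd.WritesReal])
    exact runs_dischargeR (hC₁.frame hF (by simp [dischargeR, forLoop, Cmd.WritesNat])
      (by simp [dischargeR, forLoop, Cmd.WritesReal])
      (by simp [dischargeR, forLoop, Cmd.WritesReal])) hw h' (lt_irrefl _)
      fun x => num_lt_succ ι
  · exact h₂.passInv (fun x => (ι x).2) hj
  · simp
    nlinarith [Nat.zero_le (Fintype.card S)]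

end Discharge

/-! ### The complete flow computation. -/

section MaxFlow

variable {S : Type u} [Fintype S] {ι : S ≃ Fin (Fintype.card S)} {μ ν : SubDist S}
  {R : S → S → Prop} {σ : State} {g : Prop}

/-- Each enclosing loop over the states raises the exponent of the time bound by one; `a` is the
overhead of a round. -/
theorem loop_bound {X a B b k : ℕ} (hX : 1 ≤ X) (hB : B ≤ b * X ^ k) :
    X * (a + B) ≤ (a + b) * X ^ (k + 1) := by
  have h : a ≤ a * X ^ k := Nat.le_mul_of_pos_right a (Nat.pow_pos hX)
  calc X * (a + B) ≤ X * (a * X ^ k + b * X ^ k) := by gcongr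
    _ = (a + b) * X ^ (k + 1) := by ring

/-- Without multiplication, 13|S|² sweeps are programmed as three nested loops. -/
theorem runs_sweeps (hC : FlowCtx ι R σ)
    (h : (view ι σ).PassInv μ ν R (2 * Fintype.card S + 1) 0) :
    Runs g sweeps σ (6000 * (Fintype.card S + 1) ^ 4)
      fun σ' => (view ι σ').PassInv μ ν R (2 * Fintype.card S + 1)
        (13 * Fintype.card S * Fintype.card S) := by
  have hX : 1 ≤ Fintype.card S + 1 := Nat.le_add_left _ _
  have frame : ∀ {c σ σ'}, FlowCtx ι R σ → Frame c σ σ' →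
      (∀ z, c.WritesNat z → z ≠ .numStates) → (∀ z, c.WritesReal z → z ≠ .old ∧ z ≠ thr) →
      FlowCtx ι R σ' := fun h hF h1 h2 =>
    h.frame hF (fun h => h1 _ h rfl) (fun h => (h2 _ h).1 rfl) (fun h => (h2 _ h).2 rfl)
  have w1 : ∀ z, sweep.WritesNat z → z ≠ .numStates := by
    rintro _ h rfl; simp [sweep, dischargeL, dischargeR, forLoop, Cmd.WritesNat] at h
  have w2 : ∀ z, sweep.WritesReal z → z ≠ .old ∧ z ≠ thr := by
    refine fun z h => ⟨?_, ?_⟩ <;> rintro rfl <;>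
      simp [sweep, dischargeL, dischargeR, forLoop, Cmd.WritesReal] at h
  have hr : ∀ σ j, FlowCtx ι R σ → (view ι σ).PassInv μ ν R (2 * Fintype.card S + 1) j →
      Runs g (forLoop cr (.const 13) sweep) σ (5800 * (Fintype.card S + 1) ^ 2)
      fun σ' => (view ι σ').PassInv μ ν R (2 * Fintype.card S + 1) (j + 13) := by
    intro σ j hC h
    refine Runs.mono_bound (Runs.forLoop (B := 400 * (Fintype.card S + 1) ^ 2) (m := 13)
      (fun y σ' => (view ι σ').PassInv μ ν R (2 * Fintype.card S + 1) (j + y)) ?_ ?_ ?_ h ?_) ?_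
    · simp [sweep, dischargeL, dischargeR, forLoop, Cmd.WritesNat]
    · exact fun _ _ => rfl
    · intro y σ' r h'
      rwa [view_setNat ι (by simp) (by simp)]
    · intro y _ σ' hF _ h'
      refine runs_sweep (frame hC hF ?_ ?_) h'
      · rintro z (rfl | h | rfl) <;> first | exact w1 _ ‹_› | simp
      · rintro z (h | h | h) <;> first | exact absurd h id | exact w2 _ h
    · have := Nat.one_le_pow 2 _ hX
      simp only [NatExpr.cost]
      omega
  have hq : ∀ σ j, FlowCtx ι R σ → (view ι σ).PassInv μ ν R (2 * Fintype.card S + 1) j →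
      Runs g (forLoop cq nS (forLoop cr (.const 13) sweep)) σ (5808 * (Fintype.card S + 1) ^ 3)
      fun σ' => (view ι σ').PassInv μ ν R (2 * Fintype.card S + 1) (j + 13 * Fintype.card S) := by
    intro σ j hC h
    have frame' : ∀ σ', Frame (forLoop cq nS (forLoop cr (.const 13) sweep)) σ σ' →
        FlowCtx ι R σ' := by
      intro σ' hF
      refine frame hC hF ?_ ?_
      · rintro z (rfl | (rfl | h | rfl) | rfl) <;> first | exact w1 _ ‹_› | simp
      · rintro z (h | (h | h | h) | h) <;> first | exact absurd h id | exact w2 _ h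
    refine Runs.mono_bound (Runs.forLoop (B := 5800 * (Fintype.card S + 1) ^ 2)
      (m := Fintype.card S)
      (fun y σ' => (view ι σ').PassInv μ ν R (2 * Fintype.card S + 1) (j + 13 * y)) ?_ ?_ ?_ h ?_)
      ?_
    · simp [sweep, dischargeL, dischargeR, forLoop, Cmd.WritesNat]
    · exact fun σ' hF => (frame' σ' hF).eval_nS
    · intro y σ' r h'
      rwa [view_setNat ι (by simp) (by simp)]
    · exact fun y _ σ' hF _ h' => hr σ' _ (frame' σ' hF) h'
    · exact loop_bound (a := 8) hX le_rfl
  have frame' : ∀ σ', Frame sweeps σ σ' → FlowCtx ι R σ' := by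
    intro σ' hF
    refine frame hC hF ?_ ?_
    · rintro z (rfl | (rfl | (rfl | h | rfl) | rfl) | rfl) <;> first | exact w1 _ ‹_› | simp
    · rintro z (h | (h | (h | h | h) | h) | h) <;> first | exact absurd h id | exact w2 _ h
  refine Runs.mono_bound (Runs.forLoop (B := 5808 * (Fintype.card S + 1) ^ 3)
    (m := Fintype.card S)
    (fun y σ' => (view ι σ').PassInv μ ν R (2 * Fintype.card S + 1)
      (13 * Fintype.card S * y)) ?_ ?_ ?_ h ?_) ?_
  · simp [sweep, dischargeL, dischargeR, forLoop, Cmd.WritesNat]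
  · exact fun σ' hF => (frame' σ' hF).eval_nS
  · intro y σ' r h'
    rwa [view_setNat ι (by simp) (by simp)]
  · intro y _ σ' hF _ h'
    exact (hq σ' _ (frame' σ' hF) h').mono_post fun _ _ h => by rwa [mul_add_one]
  · refine (loop_bound (a := 8) hX le_rfl).trans ?_
    gcongr
    norm_num

/-- All the mass is on the left. -/
def Preflow.start (μ ν : SubDist S) : Preflow S :=
  { flow := fun _ _ => 0, excL := μ.mass, excR := fun _ => 0, room := ν.mass,
    labL := fun _ => 0, labR := fun _ => 0 }

theorem Preflow.passInv_start (H : ℕ) : (Preflow.start μ ν).PassInv μ ν R H 0 := by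
  refine ⟨⟨fun _ _ => le_rfl, fun _ _ h => absurd rfl h, μ.nonneg, fun _ => le_rfl, ν.nonneg,
    fun _ => le_rfl, ?_, ?_, fun _ => Nat.zero_le _, fun _ => Nat.zero_le _,
    fun _ _ _ => Nat.zero_le _, fun _ _ _ => Nat.zero_le _, fun _ _ => rfl⟩, 0, ?_, ?_, ?_⟩ <;>
  simp [Preflow.start, Preflow.labelSum]

theorem runs_load (hn : σ.nat .numStates [] = Fintype.card S)
    (hμ : ∀ x, σ.real .prob [σ.nat .s [], σ.nat .a [], σ.nat .i [], (ι x : ℕ)] = μ.mass x)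
    (hν : ∀ x, σ.real .prob [σ.nat .t [], σ.nat .a [], σ.nat target [], (ι x : ℕ)] = ν.mass x) :
    Runs g load σ (100 * (Fintype.card S + 1) ^ 2)
      fun σ' => view ι σ' = Preflow.start μ ν := by
  have hX : 1 ≤ Fintype.card S + 1 := Nat.le_add_left _ _
  refine Runs.mono (Runs.forLoop (B := 80 * (Fintype.card S + 1))
    (m := Fintype.card S) (fun y σ' => ∀ x, (ι x : ℕ) < y →
      ((view ι σ').excL x = μ.mass x ∧ (view ι σ').excR x = 0 ∧ (view ι σ').room x = ν.mass x ∧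
      (view ι σ').labL x = 0 ∧ (view ι σ').labR x = 0) ∧
      ∀ w, (view ι σ').flow x w = 0) ?_ ?_ ?_ ?_ ?_) (fun _ => ?_) ?_
  · simp [forLoop, Cmd.WritesNat]
  · exact fun σ' hF => by
      rw [← hn, ← hF.nat .numStates (by simp [forLoop, Cmd.WritesNat])]; rfl
  · intro y σ' r h'
    rwa [view_setNat ι (by simp) (by simp)]
  · exact fun x hx => absurd hx (Nat.not_lt_zero _)
  · intro y hy σ₁ hF hu h'
    obtain ⟨s, rfl⟩ := num_surj ι hy
    have hnat : ∀ z, (z = .numStates ∨ z = .s ∨ z = .t ∨ z = .a ∨ z = .i ∨ z = target) →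
        σ₁.nat z = σ.nat z := by
      rintro z (rfl | rfl | rfl | rfl | rfl | rfl) <;>
        exact hF.nat _ (by simp [forLoop, Cmd.WritesNat])
    have hprob : σ₁.real .prob = σ.real .prob := hF.real _ (by simp [forLoop, Cmd.WritesReal])
    have hn₁ : σ₁.nat .numStates [] = Fintype.card S := by rw [hnat _ (by simp), hn]
    refine Runs.mono (Runs.realSet_seq (Runs.realSet_seq (Runs.realSet_seq (Runs.natSet_seq
      (Runs.natSet_seq (Runs.forLoop (B := 4) (m := Fintype.card S) (fun y σ' =>
        (∀ x, (ι x : ℕ) < ι s + 1 →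
          ((view ι σ').excL x = μ.mass x ∧ (view ι σ').excR x = 0 ∧
          (view ι σ').room x = ν.mass x ∧ (view ι σ').labL x = 0 ∧ (view ι σ').labR x = 0)) ∧
        (∀ x, (ι x : ℕ) < ι s → ∀ w, (view ι σ').flow x w = 0) ∧
        ∀ w, (ι w : ℕ) < y → (view ι σ').flow s w = 0) ?_ ?_ ?_ ?_ ?_)))))) (fun _ => ?_) ?_
    · simp [Cmd.WritesNat]
    · intro σ' hF'
      change σ'.nat .numStates [] = _
      rw [hF'.nat .numStates (by simp [forLoop, Cmd.WritesNat])]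
      simp [State.setNat_nat, hn₁]
    · intro y σ' r h'
      rwa [view_setNat ι (by simp) (by simp)]
    · refine ⟨fun x hx => ?_, fun x hx w => ?_, fun w hw => absurd hw (Nat.not_lt_zero _)⟩
      · rcases (num_lt_succ ι).1 hx with hx | rfl
        · have hxs : x ≠ s := by rintro rfl; exact lt_irrefl _ hx
          simpa [view, State.setNat_nat, State.setReal_real, State.index, hu, num_inj, hxs]
            using (h' x hx).1
        · simp [view, State.setNat_nat, State.setReal_real, State.index, hu, RealExpr.eval,
            NatExpr.eval, hprob, hnat, hμ, hν]
      · simpa [view, State.setReal_real, State.index, hu] using (h' x hx).2 w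
    · rintro y hy σ₂ hF₂ hw ⟨h1, h2, h3⟩
      obtain ⟨t, rfl⟩ := num_surj ι hy
      have hu₂ : σ₂.nat cu [] = ι s := by
        rw [hF₂.nat cu (by simp [forLoop, Cmd.WritesNat])]
        simp [State.setNat_nat, hu]
      refine Runs.mono_bound (Runs.realSet ?_) (by simp)
      refine ⟨fun x hx => ?_, fun x hx w => ?_, fun w hw₁ => ?_⟩
      · simpa [view, State.setReal_real] using h1 x hx
      · have hxs : x ≠ s := by rintro rfl; exact lt_irrefl _ hx
        simpa [view, State.setReal_real, State.index, hu₂, num_inj, hxs] using h2 x hx w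
      · rcases (num_lt_succ ι).1 hw₁ with hw' | rfl
        · have hxs : w ≠ t := by rintro rfl; exact lt_irrefl _ hw'
          simpa [view, State.setReal_real, State.index, hu₂, hw, num_inj, hxs] using h3 w hw'
        · simp [view, State.setReal_real, State.index, hu₂, hw, RealExpr.eval]
    · simp
      omega
    · rintro σ₂ _ ⟨h1, h2, h3⟩ x hx
      refine ⟨h1 x hx, fun w => ?_⟩
      rcases (num_lt_succ ι).1 hx with hx' | rfl
      · exact h2 x hx' w
      · exact h3 w (ι w).2
  · simp
    nlinarith [Nat.zero_le (Fintype.card S)]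
  · intro σ' _ h'
    ext x
    · exact (h' x (ι x).2).2 _
    · exact (h' x (ι x).2).1.1
    · exact (h' x (ι x).2).1.2.1
    · exact (h' x (ι x).2).1.2.2.1
    · exact (h' x (ι x).2).1.2.2.2.1
    · exact (h' x (ι x).2).1.2.2.2.2

theorem view_setReal {z : RealVar} {l : List ℕ} {r : ℝ} (h0 : flow ≠ z) (h1 : excL ≠ z)
    (h2 : excR ≠ z) (h3 : room ≠ z) : view ι (σ.setReal z l r) = view ι σ := by
  simp only [view, State.setReal_nat, State.setReal_real_of_ne _ _ _ h0,
    State.setReal_real_of_ne _ _ _ h1, State.setReal_real_of_ne _ _ _ h2,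
    State.setReal_real_of_ne _ _ _ h3]

theorem runs_computeRest (hC : FlowCtx ι R σ)
    (hμ : ∀ x, σ.real .prob [σ.nat .s [], σ.nat .a [], σ.nat .i [], (ι x : ℕ)] = μ.mass x)
    (hν : ∀ x, σ.real .prob [σ.nat .t [], σ.nat .a [], σ.nat target [], (ι x : ℕ)] = ν.mass x) :
    Runs g computeRest σ (7000 * (Fintype.card S + 1) ^ 4)
      fun σ' => ∃ p : Preflow S, p.Valid μ ν R (2 * Fintype.card S + 1) ∧
        (∀ s, ¬ Preflow.ActiveL (2 * Fintype.card S + 1) p s) ∧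
        (∀ t, ¬ Preflow.ActiveR (2 * Fintype.card S + 1) p t) ∧
        σ'.real rest [] = p.deficit := by
  have hX : 1 ≤ Fintype.card S + 1 := Nat.le_add_left _ _
  have h2 : (Fintype.card S + 1) ^ 2 ≤ (Fintype.card S + 1) ^ 4 :=
    Nat.pow_le_pow_right hX (by norm_num)
  have h1 : Fintype.card S + 1 ≤ (Fintype.card S + 1) ^ 4 := Nat.le_self_pow (by norm_num) _
  refine Runs.mono_bound (Runs.seq (runs_load hC.numStates hμ hν) fun σ₁ hF₁ hv₁ => Runs.seq
    (runs_sweeps (hC.frame hF₁ ?_ ?_ ?_) (hv₁ ▸ Preflow.passInv_start _)) fun σ₂ hF₂ hv₂ =>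
    Runs.realSet_seq (Runs.mono_post (Runs.forLoop (B := 20) (m := Fintype.card S)
      (fun y σ' => view ι σ' = view ι σ₂ ∧ σ'.real rest [] =
        ∑ x with (ι x : ℕ) < y, ((view ι σ₂).excL x + (view ι σ₂).excR x)) ?_ ?_ ?_ ?_ ?_) ?_)) ?_
  · simp [load, forLoop, Cmd.WritesNat]
  · simp [load, forLoop, Cmd.WritesReal]
  · simp [load, forLoop, Cmd.WritesReal]
  · simp [Cmd.WritesNat]
  · intro σ' hF
    change σ'.nat .numStates [] = _
    rw [hF.nat .numStates (by simp [forLoop, Cmd.WritesNat]), State.setReal_nat,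
      hF₂.nat .numStates (by simp [sweeps, sweep, dischargeL, dischargeR, forLoop, Cmd.WritesNat]),
      hF₁.nat .numStates (by simp [load, forLoop, Cmd.WritesNat]), hC.numStates]
  · intro y σ' r h'
    rwa [view_setNat ι (by simp) (by simp), State.setNat_real]
  · refine ⟨view_setReal (by simp) (by simp) (by simp) (by simp), ?_⟩
    simp [State.index, RealExpr.eval]
  · rintro y hy σ' - hu ⟨hv, hs⟩
    obtain ⟨t, rfl⟩ := num_surj ι hy
    refine Runs.mono_bound (Runs.realSet ⟨?_, ?_⟩) (by simp)
    · rw [view_setReal (by simp) (by simp) (by simp) (by simp), hv]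
    · classical
      have h1 : (univ.filter fun x => (ι x : ℕ) < ι t + 1) =
          insert t (univ.filter fun x => (ι x : ℕ) < ι t) := by
        ext x
        simp only [mem_filter, mem_univ, true_and, mem_insert, num_lt_succ ι]
        exact or_comm
      rw [h1, sum_insert (by simp), ← hs, ← hv]
      simp [State.index, RealExpr.eval, hu, view, add_comm]
  · rintro σ' - ⟨-, hs⟩
    -- The factor 13 is the least one with 13n² > 4n(2n+1) for all n ≥ 1: at n = 1, the right side
    -- is 12. Without states there is nothing to show.
    have hna := fun hc : 0 < Fintype.card S => hv₂.not_active (by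
      nlinarith : 4 * Fintype.card S * (2 * Fintype.card S + 1) < _)
    refine ⟨view ι σ₂, hv₂.1, fun s => (hna (Fintype.card_pos_iff.2 ⟨s⟩)).1 s,
      fun s => (hna (Fintype.card_pos_iff.2 ⟨s⟩)).2 s, ?_⟩
    simpa [Preflow.deficit] using hs
  · simp
    omega

end MaxFlow

/-! ### The max-flow min-cut theorem for these networks -/

section MinCut

variable {S : Type u} [Fintype S]

open Classical in
/-- A memory which contains `μ`, `ν` and `R`. -/
noncomputable def flowMemory (ι : S ≃ Fin (Fintype.card S)) (μ ν : SubDist S)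
    (R : S → S → Prop) : State where
  nat z _ := match z with
    | .numStates => Fintype.card S
    | .t => 1
    | _ => 0
  real z l := match z, l with
    | .prob, [s, _, _, x] => if hx : x < Fintype.card S then
        (if s = 0 then μ else ν).mass (ι.symm ⟨x, hx⟩) else 0
    | .old, l => if ∃ x y, R x y ∧ l = [(ι x : ℕ), (ι y : ℕ)] then 0 else 1
    | _, _ => 0

/-- The min-cut theorem comes from the flow program: its final preflow has no active vertex and
therefore provides a cut as small as the flow. -/
theorem exists_cut_eq_maxFlow (μ ν : SubDist S) (R : S → S → Prop) :
    ∃ E : Set S, (relNetwork μ ν R).maxFlow =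
      μ.prob Set.univ - μ.prob E + ν.prob (relImage R E) := by
  -- In this memory `s` is 0 and `t` is 1, so the first index of `prob` selects μ or ν; the
  -- threshold is 0 and `old` is 0 exactly on `R`. The running time is irrelevant here.
  have hrun := runs_computeRest (g := False) (ι := Fintype.equivFin S) (μ := μ) (ν := ν) (R := R)
    (σ := flowMemory (Fintype.equivFin S) μ ν R) ⟨rfl, fun x y => ?_⟩ (fun x => ?_) (fun x => ?_)
  · obtain ⟨_, _, _, _, p, hp, hl, hr, _⟩ := hrun
    obtain ⟨E, hE⟩ := hp.exists_cut hl hr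
    exact ⟨E, le_antisymm (maxFlow_le_cut E) (hE.trans (hp.maxFlow_eq hl hr).ge)⟩
  · by_cases hR : R x y
    · simp only [hR, flowMemory, true_iff]
      rw [if_pos ⟨x, y, hR, rfl⟩]
    · have : ¬ ∃ x' y', R x' y' ∧ [(Fintype.equivFin S x : ℕ), (Fintype.equivFin S y : ℕ)] =
          [(Fintype.equivFin S x' : ℕ), (Fintype.equivFin S y' : ℕ)] := by
        rintro ⟨x', y', h, heq⟩
        simp only [List.cons.injEq, num_inj, and_true] at heq
        exact hR (heq.1 ▸ heq.2 ▸ h)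
      simp only [hR, flowMemory, false_iff]
      rw [if_neg this]
      norm_num
  · simp [flowMemory]
  · simp [flowMemory]

theorem relImage_mono {S : Type u} {R R' : S → S → Prop} (h : ∀ x y, R x y → R' x y) (E : Set S) :
    relImage R E ⊆ relImage R' E := by
  rintro y ⟨x, hx, hR⟩
  exact ⟨x, hx, h x y hR⟩

theorem maxFlow_mono (μ ν : SubDist S) {R R' : S → S → Prop} (h : ∀ x y, R x y → R' x y) :
    (relNetwork μ ν R).maxFlow ≤ (relNetwork μ ν R').maxFlow := by
  obtain ⟨E, hE⟩ := exists_cut_eq_maxFlow μ ν R'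
  rw [hE]
  exact (maxFlow_le_cut E).trans (by gcongr; exact ν.prob_mono (relImage_mono h E))

/-- The inequality for `E` says that the cut given by `E` has capacity at least μ(S) - ε, and a
minimum cut is attained by some `E`. -/
theorem lift_iff_maxFlow (ε : ℝ) (R : S → S → Prop) (μ ν : SubDist S) :
    Lift ε R μ ν ↔ μ.prob Set.univ - ε ≤ (relNetwork μ ν R).maxFlow := by
  constructor
  · intro h
    obtain ⟨E, hE⟩ := exists_cut_eq_maxFlow μ ν R
    have := h E
    rw [hE]
    change μ.prob E ≤ ν.prob (relImage R E) + ε at this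
    linarith
  · intro h E
    have := h.trans (maxFlow_le_cut E)
    change μ.prob E ≤ ν.prob (relImage R E) + ε
    linarith

end MinCut

/-! ### Finitely many candidates for the smallest feasible number -/

section Candidates

variable {S : Type u} [Fintype S]

/-- The values at which the relation `d ≤ v` may change, and `0`. -/
def IsThreshold (d : S → S → ℝ) (v : ℝ) : Prop := v = 0 ∨ ∃ x y, v = d x y

/-- The mass of `μ` that cannot be transported to `ν` along pairs at distance at most `v`. -/
noncomputable def untransported (μ ν : SubDist S) (d : S → S → ℝ) (v : ℝ) : ℝ :=
  μ.prob Set.univ - (relNetwork μ ν fun x y => d x y ≤ v).maxFlow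

variable {d : S → S → ℝ} {μ ν : SubDist S}

theorem untransported_anti {v w : ℝ} (h : v ≤ w) :
    untransported μ ν d w ≤ untransported μ ν d v :=
  sub_le_sub_left (maxFlow_mono μ ν fun _ _ h' => h'.trans h) _

theorem IsThreshold.nonneg {S : Type u} {d : S → S → ℝ} (hd : ∀ x y, 0 ≤ d x y ∧ d x y ≤ 1) {v : ℝ} (h : IsThreshold d v) :
    0 ≤ v := by
  rcases h with rfl | ⟨x, y, rfl⟩
  · exact le_rfl
  · exact (hd x y).1

/-- The smallest feasible numbers for the different `ν` are among these. -/
def stepCandidates {Act : Type v} (P : PA S Act) (d : S → S → ℝ) (t : S) (a : Act)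
    (μ : SubDist S) : Set ℝ :=
  {r | ∃ ν ∈ P.trans t a, ∃ v, IsThreshold d v ∧ r = max v (untransported μ ν d v)}

/-- A candidate r = max(v, untransported mass at v) is feasible if r ≤ 1, because passing from v to
r can only decrease that mass. Conversely, a feasible ε can be lowered to the largest threshold v ≤
ε without losing a pair of the relation, so that the candidate of v is at most ε. -/
theorem isStepValue_of_candidates {Act : Type v} {P : PA S Act} {t : S} {a : Act}
    (hd : ∀ x y, 0 ≤ d x y ∧ d x y ≤ 1) {r : ℝ} (hr : r ∈ insert 1 (stepCandidates P d t a μ))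
    (h1 : r ≤ 1) (hle : ∀ q ∈ stepCandidates P d t a μ, r ≤ q) : IsStepValue P d t a μ r := by
  classical
  constructor
  · rcases hr with rfl | ⟨ν, hν, v, hv, rfl⟩
    · exact Or.inl rfl
    · refine Or.inr ⟨(hv.nonneg hd).trans (le_max_left _ _), h1, ν, hν, ?_⟩
      have h2 := le_max_right v (untransported μ ν d v)
      have h3 := untransported_anti (μ := μ) (ν := ν) (d := d)
        (le_max_left v (untransported μ ν d v))
      simp only [untransported] at h2 h3 ⊢
      linarith
  · rintro ε (rfl | ⟨h0, -, ν, hν, hε⟩)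
    · exact h1
    · obtain ⟨v, hv, hmax⟩ := exists_max_image
        (insert 0 ((univ.image fun p : S × S => d p.1 p.2).filter (· ≤ ε))) id (insert_nonempty _ _)
      have hvε : v ≤ ε := by
        rcases mem_insert.1 hv with rfl | h
        · exact h0
        · exact (mem_filter.1 h).2
      have hvT : IsThreshold d v := by
        rcases mem_insert.1 hv with rfl | h
        · exact Or.inl rfl
        · obtain ⟨p, -, hp⟩ := mem_image.1 (mem_filter.1 h).1
          exact Or.inr ⟨p.1, p.2, hp.symm⟩
      have hmono := maxFlow_mono μ ν (R := fun x y => d x y ≤ ε) (R' := fun x y => d x y ≤ v)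
        fun x y hxy => hmax (d x y) (mem_insert_of_mem (mem_filter.2
          ⟨mem_image.2 ⟨(x, y), mem_univ _, rfl⟩, hxy⟩))
      refine (hle _ ⟨ν, hν, v, hvT, rfl⟩).trans (max_le hvε ?_)
      simp only [untransported]
      linarith

/-- There are only finitely many candidates, so the required minimum exists, whatever program
computes it. -/
theorem exists_isStepValue {Act : Type v} (P : PA S Act) (t : S) (a : Act) (μ : SubDist S)
    (hd : ∀ x y, 0 ≤ d x y ∧ d x y ≤ 1) : ∃ r, IsStepValue P d t a μ r := by
  classical
  have hfin : (insert 1 (stepCandidates P d t a μ)).Finite := by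
    have hT : {v | IsThreshold d v}.Finite := by
      refine ((Set.finite_singleton (0 : ℝ)).union
        (Set.finite_range fun p : S × S => d p.1 p.2)).subset ?_
      rintro v (rfl | ⟨x, y, rfl⟩)
      · exact Or.inl rfl
      · exact Or.inr ⟨(x, y), rfl⟩
    refine Set.Finite.insert _ ((Set.Finite.image2
      (fun ν v => max v (untransported μ ν d v)) (P.trans t a).finite_toSet hT).subset ?_)
    rintro r ⟨ν, hν, v, hv, rfl⟩
    exact ⟨ν, hν, v, hv, rfl⟩
  obtain ⟨r, hr, hmin⟩ := hfin.exists_minimalFor id _ (Set.insert_nonempty _ _)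
  have hle : ∀ q ∈ insert 1 (stepCandidates P d t a μ), r ≤ q := fun q hq =>
    (le_total r q).elim id fun h => hmin hq h
  exact ⟨r, isStepValue_of_candidates hd hr (hle 1 (Or.inl rfl)) fun q hq => hle q (Or.inr hq)⟩

end Candidates

/-! ### Medians -/

section Median

variable {α : Type*} [Fintype α] (f : α → ℝ)

open Classical in
/-- The elements with a value strictly between `lo` and `hi`. -/
noncomputable def between (lo hi : ℝ) : Finset α := univ.filter fun p => lo < f p ∧ f p < hi

/-- At most half of the values between `lo` and `hi` are below `v`, at most half are above. -/
structure IsMedian (lo hi v : ℝ) : Prop where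
  lt : lo < v
  gt : v < hi
  below : 2 * (between f lo v).card ≤ (between f lo hi).card
  above : 2 * (between f v hi).card ≤ (between f lo hi).card

/-- Among the values with at most half of the others above them, the smallest is a median. Otherwise
more than half lie below it; the largest of these has fewer than half above it and would have been a
smaller choice. -/
theorem exists_isMedian {lo hi : ℝ} (h : (between f lo hi).Nonempty) :
    ∃ p, IsMedian f lo hi (f p) := by
  classical
  have hsub : ∀ {a b a' b' : ℝ}, a' ≤ a → b ≤ b' → between f a b ⊆ between f a' b' :=
    fun ha hb p hp => by
      simp only [between, mem_filter, mem_univ, true_and] at hp ⊢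
      exact ⟨ha.trans_lt hp.1, hp.2.trans_le hb⟩
  obtain ⟨m, hm, hmax⟩ := exists_max_image _ f h
  let A := (between f lo hi).filter fun p =>
    2 * (between f (f p) hi).card ≤ (between f lo hi).card
  have hA : A.Nonempty := by
    refine ⟨m, mem_filter.2 ⟨hm, ?_⟩⟩
    have : between f (f m) hi = ∅ := by
      refine eq_empty_of_forall_notMem fun p hp => ?_
      have hp' := hsub (by simpa [between] using (mem_filter.1 hm).2.1.le) le_rfl hp
      simp only [between, mem_filter, mem_univ, true_and] at hp
      exact absurd (hmax p hp') (not_le.2 hp.1)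
    simp [this]
  obtain ⟨p, hp, hmin⟩ := exists_min_image _ f hA
  obtain ⟨hpB, hpa⟩ := mem_filter.1 hp
  have hpB' := (mem_filter.1 hpB).2
  refine ⟨p, hpB'.1, hpB'.2, ?_, hpa⟩
  by_contra hcon
  have hne : (between f lo (f p)).Nonempty := card_pos.1 (by omega)
  obtain ⟨q, hq, hqmax⟩ := exists_max_image _ f hne
  have hq' := (mem_filter.1 hq).2
  have hqB : q ∈ between f lo hi := hsub le_rfl hpB'.2.le hq
  have hdis : Disjoint (between f lo (f p)) (between f (f q) hi) := by
    refine disjoint_left.2 fun r hr hr' => ?_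
    have h1 := hqmax r hr
    simp only [between, mem_filter, mem_univ, true_and] at hr'
    exact absurd h1 (not_le.2 hr'.1)
  have hcard : (between f lo (f p)).card + (between f (f q) hi).card ≤ (between f lo hi).card := by
    rw [← card_union_of_disjoint hdis]
    exact card_le_card (union_subset (hsub le_rfl hpB'.2.le) (hsub hq'.1.le le_rfl))
  have hqA : q ∈ A := mem_filter.2 ⟨hqB, by omega⟩
  exact absurd (hmin q hqA) (not_le.2 hq'.2)

theorem card_filter_or_eq (p G : α → Prop) [DecidablePred p]
    [DecidablePred G] [DecidableEq α] (q : α) (hq : ¬ G q) :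
    (univ.filter fun x => p x ∧ (G x ∨ x = q)).card =
      (univ.filter fun x => p x ∧ G x).card + if p q then 1 else 0 := by
  have : (univ.filter fun x => p x ∧ (G x ∨ x = q)) =
      (univ.filter fun x => p x ∧ G x) ∪ (if p q then {q} else ∅) := by
    ext x
    by_cases hx : x = q
    · subst hx; by_cases h : p x <;> simp [h]
    · by_cases h : p q <;> simp [h, hx]
  rw [this, card_union_of_disjoint]
  · split_ifs <;> rfl
  · split_ifs
    · simp [hq]
    · simp

end Median

/-! ### The program for the innermost instruction -/

namespace StepProgram

abbrev rnd : NatVar := .scratch 8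
abbrev below : NatVar := .scratch 9
abbrev above : NatVar := .scratch 10
abbrev total : NatVar := .scratch 11
abbrev lo : RealVar := .scratch 6

/-- Compare the threshold `thr` with the mass that cannot be transported. -/
def tighten : Cmd :=
  computeRest ;;
  .ite (.realLt (.get thr []) (.get rest []))
    (.realSet lo [] (.get thr []) ;;
     .ite (.realLt (.get rest []) (.get .eps [])) (.realSet .eps [] (.get rest [])) .skip)
    (.ite (.realLt (.get thr []) (.get .eps [])) (.realSet .eps [] (.get thr [])) .skip)

abbrev inside (z w : NatVar) : Test :=
  .and (.realLt (.get lo []) (.get .old [z, w])) (.realLt (.get .old [z, w]) (.get .eps []))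

def countStep : Cmd :=
  .ite (inside cp cq)
    (.natSet total [] (.add (.get total []) (.const 1)) ;;
     .ite (.realLt (.get .old [cp, cq]) (.get .old [cu, cw]))
       (.natSet below [] (.add (.get below []) (.const 1))) .skip ;;
     .ite (.realLt (.get .old [cu, cw]) (.get .old [cp, cq]))
       (.natSet above [] (.add (.get above []) (.const 1))) .skip)
    .skip

/-- Count the entries of `old` between `lo` and `eps`, and those of them that are below and above
the entry with index `cu`, `cw`. -/
def count : Cmd :=
  .natSet below [] (.const 0) ;; .natSet above [] (.const 0) ;; .natSet total [] (.const 0) ;;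
  forLoop cp nS (forLoop cq nS countStep)

def selectStep : Cmd :=
  .ite (inside cu cw)
    (count ;;
     .ite (.and (.not (.natLt (.get total []) (.add (.get below []) (.get below []))))
           (.not (.natLt (.get total []) (.add (.get above []) (.get above [])))))
       (.realSet thr [] (.get .old [cu, cw])) .skip)
    .skip

/-- Let `thr` be a median of the entries of `old` between `lo` and `eps`, and `lo` if there are no
such entries. -/
def select : Cmd :=
  .realSet thr [] (.get lo []) ;; forLoop cu nS (forLoop cw nS selectStep)

/-- Search the best threshold for the transition number `target` of `t`. -/
def search : Cmd :=
  .realSet lo [] .zero ;; .realSet thr [] .zero ;; tighten ;;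
  forLoop rnd (.add (.add nS nS) nS) (select ;; tighten)

/-- The instruction, by bisection among the values of `old`. -/
def step : Cmd :=
  .realSet .eps [] .one ;; forLoop target (.get .branch [.t, .a]) search

end StepProgram

open StepProgram

/-! ### Testing one threshold, and counting entries of the matrix. -/

section Step

variable {S : Type u} [Fintype S] {ι : S ≃ Fin (Fintype.card S)} {μ ν : SubDist S}
  {d : S → S → ℝ} {σ : State} {g : Prop}

/-- The memory contains the number of states and the array `d`. -/
structure StepCtx (ι : S ≃ Fin (Fintype.card S)) (d : S → S → ℝ) (σ : State) : Prop where
  numStates : σ.nat .numStates [] = Fintype.card S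
  old : ∀ x y, σ.real .old [(ι x : ℕ), (ι y : ℕ)] = d x y

/-- One flow computation improves `eps` by the candidate of the threshold `thr`. The comparison of
`thr` with the remaining mass also decides on which side of `thr` a better candidate can lie. -/
theorem runs_tighten (hC : StepCtx ι d σ)
    (hμ : ∀ x, σ.real .prob [σ.nat .s [], σ.nat .a [], σ.nat .i [], (ι x : ℕ)] = μ.mass x)
    (hν : ∀ x, σ.real .prob [σ.nat .t [], σ.nat .a [], σ.nat target [], (ι x : ℕ)] = ν.mass x) :
    Runs g tighten σ (7100 * (Fintype.card S + 1) ^ 4) fun σ' =>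
      σ'.real .eps [] = min (σ.real .eps []) (max (σ.real thr [])
        (untransported μ ν d (σ.real thr []))) ∧
      (σ.real thr [] < untransported μ ν d (σ.real thr []) →
        σ'.real lo [] = σ.real thr []) ∧
      (untransported μ ν d (σ.real thr []) ≤ σ.real thr [] →
        σ'.real lo [] = σ.real lo []) := by
  have hX : 1 ≤ (Fintype.card S + 1) ^ 4 := Nat.one_le_pow _ _ (Nat.succ_pos _)
  refine Runs.mono_bound (Runs.seq (runs_computeRest (R := fun x y => d x y ≤ σ.real thr [])
    ⟨hC.numStates, fun x y => by rw [hC.old]⟩ hμ hν) (B₂ := 60) ?_) (by omega)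
  rintro σ₁ hF₁ ⟨p, hp, hl, hr, hrest⟩
  have hrest' : σ₁.real rest [] = untransported μ ν d (σ.real thr []) := by
    rw [hrest, untransported, hp.maxFlow_eq hl hr]; ring
  have hthr : σ₁.real thr [] = σ.real thr [] := by
    rw [hF₁.real thr (by simp [computeRest, load, sweeps, sweep, dischargeL, dischargeR, forLoop,
      Cmd.WritesReal])]
  have heps : σ₁.real .eps [] = σ.real .eps [] := by
    rw [hF₁.real .eps (by simp [computeRest, load, sweeps, sweep, dischargeL, dischargeR, forLoop,
      Cmd.WritesReal])]
  have hlo : σ₁.real lo [] = σ.real lo [] := by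
    rw [hF₁.real lo (by simp [computeRest, load, sweeps, sweep, dischargeL, dischargeR, forLoop,
      Cmd.WritesReal])]
  rw [← hrest', ← hthr, ← heps, ← hlo]
  refine Runs.mono_bound (Runs.ite (B₁ := 20) (B₂ := 20) (fun hb => ?_) (fun hb => ?_)) (by simp)
  · have hlt : σ₁.real thr [] < σ₁.real rest [] := by
      simpa [Test.Holds, RealExpr.eval, State.index] using hb
    refine Runs.mono_bound (Runs.realSet_seq (Runs.ite (fun hc => Runs.realSet ?_)
      fun hc => Runs.skip ?_)) (by simp)
    · have hc' : σ₁.real rest [] < σ₁.real .eps [] := by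
        simpa [Test.Holds, RealExpr.eval, State.index, State.setReal_real] using hc
      refine ⟨?_, fun _ => ?_, fun h => absurd h (not_le.2 hlt)⟩
      · simp [State.setReal_real, State.index, RealExpr.eval, max_eq_right hlt.le,
          min_eq_right hc'.le]
      · simp [State.setReal_real, State.index, RealExpr.eval]
    · have hc' : σ₁.real .eps [] ≤ σ₁.real rest [] := by
        simpa [Test.Holds, RealExpr.eval, State.index, State.setReal_real] using hc
      refine ⟨?_, fun _ => ?_, fun h => absurd h (not_le.2 hlt)⟩
      · simp [State.setReal_real, State.index, RealExpr.eval, max_eq_right hlt.le,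
          min_eq_left hc']
      · simp [State.index, RealExpr.eval]
  · have hle : σ₁.real rest [] ≤ σ₁.real thr [] := by
      simpa [Test.Holds, RealExpr.eval, State.index] using hb
    refine Runs.mono_bound (Runs.ite (fun hc => Runs.realSet ?_)
      fun hc => Runs.skip ?_) (by simp)
    · have hc' : σ₁.real thr [] < σ₁.real .eps [] := by
        simpa [Test.Holds, RealExpr.eval, State.index] using hc
      refine ⟨?_, fun h => absurd h (not_lt.2 hle), fun _ => ?_⟩
      · simp [State.index, RealExpr.eval, max_eq_left hle,
          min_eq_right hc'.le]
      · simp [State.setReal_real]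
    · have hc' : σ₁.real .eps [] ≤ σ₁.real thr [] := by
        simpa [Test.Holds, RealExpr.eval, State.index] using hc
      exact ⟨by rw [max_eq_left hle, min_eq_left hc'], fun h => absurd h (not_lt.2 hle),
        fun _ => rfl⟩

open Classical in
/-- The counters have counted the pairs in `G`. -/
structure CountInv (d : S → S → ℝ) (l e v : ℝ) (G : S × S → Prop) (σ : State) : Prop where
  total_eq : σ.nat total [] =
    (univ.filter fun p : S × S => (l < d p.1 p.2 ∧ d p.1 p.2 < e) ∧ G p).card
  below_eq : σ.nat below [] =
    (univ.filter fun p : S × S => (l < d p.1 p.2 ∧ d p.1 p.2 < v) ∧ G p).card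
  above_eq : σ.nat above [] =
    (univ.filter fun p : S × S => (v < d p.1 p.2 ∧ d p.1 p.2 < e) ∧ G p).card

theorem CountInv.congr {l e v : ℝ} {G G' : S × S → Prop} {σ' : State}
    (h : CountInv d l e v G σ) (hG : ∀ p, G' p ↔ G p) (h1 : σ'.nat total = σ.nat total)
    (h2 : σ'.nat below = σ.nat below) (h3 : σ'.nat above = σ.nat above) :
    CountInv d l e v G' σ' := by
  obtain rfl : G' = G := funext fun p => propext (hG p)
  exact ⟨h1 ▸ h.total_eq, h2 ▸ h.below_eq, h3 ▸ h.above_eq⟩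

theorem runs_countStep (hC : StepCtx ι d σ) {s t x y : S} (hu : σ.nat cu [] = ι s)
    (hw : σ.nat cw [] = ι t) (hp : σ.nat cp [] = ι x) (hq : σ.nat cq [] = ι y)
    (hlt : σ.real lo [] < d s t) (hgt : d s t < σ.real .eps []) {G : S × S → Prop}
    (hG : ¬ G (x, y)) (h : CountInv d (σ.real lo []) (σ.real .eps []) (d s t) G σ) :
    Runs g countStep σ 80
      (CountInv d (σ.real lo []) (σ.real .eps []) (d s t) fun p => G p ∨ p = (x, y)) := by
  classical
  have hst := hC.old s t
  have hxy := hC.old x y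
  unfold countStep
  have e0 : (inside cp cq).Holds σ ↔ σ.real lo [] < d x y ∧ d x y < σ.real .eps [] := by
    simp [Test.Holds, RealExpr.eval, State.index, hp, hq, hxy]
  have key : ∀ σ' : State,
      σ'.nat total [] = σ.nat total [] +
        (if σ.real lo [] < d x y ∧ d x y < σ.real .eps [] then 1 else 0) →
      σ'.nat below [] = σ.nat below [] +
        (if σ.real lo [] < d x y ∧ d x y < d s t then 1 else 0) →
      σ'.nat above [] = σ.nat above [] +
        (if d s t < d x y ∧ d x y < σ.real .eps [] then 1 else 0) →
      CountInv d (σ.real lo []) (σ.real .eps []) (d s t) (fun p => G p ∨ p = (x, y)) σ' := by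
    intro σ' h1 h2 h3
    refine ⟨?_, ?_, ?_⟩
    · rw [h1, h.total_eq]
      convert (card_filter_or_eq (fun p : S × S => σ.real lo [] < d p.1 p.2 ∧
        d p.1 p.2 < σ.real .eps []) G (x, y) hG).symm
    · rw [h2, h.below_eq]
      convert (card_filter_or_eq (fun p : S × S => σ.real lo [] < d p.1 p.2 ∧
        d p.1 p.2 < d s t) G (x, y) hG).symm
    · rw [h3, h.above_eq]
      convert (card_filter_or_eq (fun p : S × S => d s t < d p.1 p.2 ∧
        d p.1 p.2 < σ.real .eps []) G (x, y) hG).symm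
  refine Runs.mono_bound (Runs.ite (B₁ := 60) (B₂ := 1) (fun hb => ?_) (fun hb => ?_)) (by simp)
  · rw [e0] at hb
    refine Runs.mono_bound (Runs.natSet_seq (Runs.seq (B₁ := 20) (B₂ := 20)
      (Q' := fun σ' => σ'.nat total [] = σ.nat total [] + 1 ∧ σ'.nat below [] = σ.nat below [] +
        (if d x y < d s t then 1 else 0)) ?_ fun σ' hF hσ' => ?_)) (by simp)
    · refine Runs.mono_bound (Runs.ite (fun hc => Runs.natSet ?_) fun hc => Runs.skip ?_) (by simp)
      · have hc' : d x y < d s t := by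
          simpa [Test.Holds, RealExpr.eval, State.index, State.setNat_nat, hp, hq, hu, hw, hxy,
            hst] using hc
        simp [State.setNat_nat, NatExpr.eval, State.index, hc']
      · have hc' : ¬ d x y < d s t := by
          simpa [Test.Holds, RealExpr.eval, State.index, State.setNat_nat, hp, hq, hu, hw, hxy,
            hst] using hc
        simp [State.setNat_nat, NatExpr.eval, State.index, hc']
    · have hnat : ∀ z, z ≠ below → z ≠ total → σ'.nat z = σ.nat z := fun z h1 h2 => by
        rw [hF.nat z (by simpa [Cmd.WritesNat] using h1), State.setNat_nat_of_ne _ _ _ h2]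
      have hreal : σ'.real = σ.real := funext fun z => by
        rw [hF.real z (by simp [Cmd.WritesReal]), State.setNat_real]
      have hbel : (if σ.real lo [] < d x y ∧ d x y < d s t then 1 else 0) =
          if d x y < d s t then 1 else 0 := by simp [hb.1]
      have habv : (if d s t < d x y ∧ d x y < σ.real .eps [] then 1 else 0) =
          if d s t < d x y then 1 else 0 := by simp [hb.2]
      refine Runs.mono_bound (Runs.ite (fun hc => Runs.natSet ?_) fun hc => Runs.skip ?_) (by simp)
      · have hc' : d s t < d x y := by
          simpa [Test.Holds, RealExpr.eval, State.index, hnat, hreal, hp, hq, hu, hw, hxy,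
            hst] using hc
        refine key _ ?_ ?_ ?_
        · rw [if_pos hb, ← hσ'.1]; simp [State.setNat_nat]
        · rw [hbel, ← hσ'.2]; simp [State.setNat_nat]
        · rw [habv, if_pos hc']; simp [State.index, NatExpr.eval, hnat]
      · have hc' : ¬ d s t < d x y := by
          simpa [Test.Holds, RealExpr.eval, State.index, hnat, hreal, hp, hq, hu, hw, hxy,
            hst] using hc
        refine key _ ?_ ?_ ?_
        · rw [if_pos hb, ← hσ'.1]
        · rw [hbel, ← hσ'.2]
        · rw [habv, if_neg hc', hnat _ (by simp) (by simp)]; rfl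
  · rw [e0] at hb
    -- The reference value lies between `lo` and `eps`, so an entry outside this interval counts
    -- neither as below nor as above.
    refine Runs.skip (key _ ?_ ?_ ?_)
    · rw [if_neg hb]; rfl
    · rw [if_neg fun h' => hb ⟨h'.1, h'.2.trans hgt⟩]; rfl
    · rw [if_neg fun h' => hb ⟨hlt.trans h'.1, h'.2⟩]; rfl

theorem runs_count (hC : StepCtx ι d σ) {s t : S} (hu : σ.nat cu [] = ι s)
    (hw : σ.nat cw [] = ι t) (hlt : σ.real lo [] < d s t) (hgt : d s t < σ.real .eps []) :
    Runs g count σ (120 * (Fintype.card S + 1) ^ 2) fun σ' =>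
      σ'.nat total [] = (between (fun p : S × S => d p.1 p.2) (σ.real lo [])
        (σ.real .eps [])).card ∧
      σ'.nat below [] = (between (fun p : S × S => d p.1 p.2) (σ.real lo []) (d s t)).card ∧
      σ'.nat above [] = (between (fun p : S × S => d p.1 p.2) (d s t)
        (σ.real .eps [])).card := by
  have hX : 1 ≤ Fintype.card S + 1 := Nat.le_add_left _ _
  have hX2 := Nat.one_le_pow 2 _ hX
  unfold count
  refine Runs.mono (Runs.natSet_seq (Runs.natSet_seq (Runs.natSet_seq (Runs.forLoop
    (B := 88 * (Fintype.card S + 1) ^ 1) (m := Fintype.card S)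
    (fun y σ' => CountInv d (σ.real lo []) (σ.real .eps []) (d s t)
      (fun p => (ι p.1 : ℕ) < y) σ') ?_ ?_ ?_ ?_ ?_)))) (fun _ => ?_) ?_
  · simp [countStep, forLoop, Cmd.WritesNat]
  · intro σ' hF
    change σ'.nat .numStates [] = _
    rw [hF.nat .numStates (by simp [countStep, forLoop, Cmd.WritesNat])]
    simp [State.setNat_nat, hC.numStates]
  · exact fun y σ' r h' => h'.congr (fun _ => Iff.rfl) (State.setNat_nat_of_ne _ _ _ (by simp) _)
      (State.setNat_nat_of_ne _ _ _ (by simp) _) (State.setNat_nat_of_ne _ _ _ (by simp) _)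
  · constructor <;> simp [State.setNat_nat, State.index, NatExpr.eval]
  · intro k hk σ₁ hF₁ hp h₁
    obtain ⟨x, rfl⟩ := num_surj ι hk
    have hnat : ∀ z, (z = .numStates ∨ z = cu ∨ z = cw) → σ₁.nat z = σ.nat z := by
      rintro z (rfl | rfl | rfl) <;>
        rw [hF₁.nat _ (by simp [countStep, forLoop, Cmd.WritesNat])] <;>
        simp [State.setNat_nat_of_ne]
    have hreal : σ₁.real = σ.real := funext fun z => by
      rw [hF₁.real z (by simp [countStep, forLoop, Cmd.WritesReal])]; rfl
    refine Runs.mono (Runs.forLoop (B := 80) (m := Fintype.card S)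
      (fun y σ' => CountInv d (σ.real lo []) (σ.real .eps []) (d s t)
        (fun p => (ι p.1 : ℕ) < ι x ∨ p.1 = x ∧ (ι p.2 : ℕ) < y) σ') ?_ ?_ ?_ ?_ ?_)
      (fun _ => ?_) ?_
    · simp [countStep, Cmd.WritesNat]
    · intro σ' hF
      change σ'.nat .numStates [] = _
      rw [hF.nat .numStates (by simp [countStep, forLoop, Cmd.WritesNat]), hnat _ (by simp),
        hC.numStates]
    · exact fun y σ' r h' => h'.congr (fun _ => Iff.rfl)
        (State.setNat_nat_of_ne _ _ _ (by simp) _)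
        (State.setNat_nat_of_ne _ _ _ (by simp) _) (State.setNat_nat_of_ne _ _ _ (by simp) _)
    · exact h₁.congr (fun p => by simp) rfl rfl rfl
    · intro k hk σ₂ hF₂ hq h₂
      obtain ⟨y, rfl⟩ := num_surj ι hk
      have hnat₂ : ∀ z, (z = .numStates ∨ z = cu ∨ z = cw ∨ z = cp) → σ₂.nat z = σ₁.nat z := by
        rintro z (rfl | rfl | rfl | rfl) <;>
          rw [hF₂.nat _ (by simp [countStep, forLoop, Cmd.WritesNat])]
      have hreal₂ : σ₂.real = σ.real := funext fun z => by
        rw [hF₂.real z (by simp [countStep, forLoop, Cmd.WritesReal]), hreal]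
      have hC₂ : StepCtx ι d σ₂ :=
        ⟨by rw [hnat₂ _ (by simp), hnat _ (by simp), hC.numStates],
          fun x y => by rw [hreal₂, hC.old]⟩
      rw [← hreal₂] at h₂ hlt hgt ⊢
      refine (runs_countStep hC₂ (x := x) (y := y) (by rw [hnat₂ _ (by simp), hnat _ (by simp), hu])
        (by rw [hnat₂ _ (by simp), hnat _ (by simp), hw]) (by rw [hnat₂ _ (by simp), hp]) hq
        hlt hgt ?_ h₂).mono_post fun σ₃ _ h₃ => h₃.congr (fun p => ?_) rfl rfl rfl
      · simp
      · rw [num_lt_succ, Prod.ext_iff]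
        tauto
    · simp
      omega
    · intro σ₂ _ h₂
      refine h₂.congr (fun p => ?_) rfl rfl rfl
      rw [num_lt_succ]
      simp
  · refine (Nat.add_le_add_left (Nat.add_le_add_left (Nat.add_le_add_left
      (loop_bound (a := 8) hX le_rfl) _) _) _).trans ?_
    simp
    omega
  · intro σ' _ h'
    refine ⟨?_, ?_, ?_⟩
    · rw [h'.total_eq]; simp [between]
    · rw [h'.below_eq]; simp [between]
    · rw [h'.above_eq]; simp [between]

end Step

/-! ### Finding a median by exhaustive counting. -/

section Select

variable {S : Type u} [Fintype S] {ι : S ≃ Fin (Fintype.card S)} {μ ν : SubDist S}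
  {d : S → S → ℝ} {σ : State} {g : Prop}

/-- `thr` is a median if there is one among the pairs in `G`. -/
def SelectInv (d : S → S → ℝ) (l e : ℝ) (G : S × S → Prop) (σ : State) : Prop :=
  (σ.real thr [] = l ∨ IsMedian (fun p : S × S => d p.1 p.2) l e (σ.real thr []) ∧
    IsThreshold d (σ.real thr [])) ∧
  ∀ p, G p → IsMedian (fun p : S × S => d p.1 p.2) l e (d p.1 p.2) →
    IsMedian (fun p : S × S => d p.1 p.2) l e (σ.real thr [])

theorem SelectInv.congr {l e : ℝ} {G G' : S × S → Prop} {σ' : State}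
    (h : SelectInv d l e G σ) (hG : ∀ p, G' p ↔ G p) (h1 : σ'.real thr = σ.real thr) :
    SelectInv d l e G' σ' := by
  obtain rfl : G' = G := funext fun p => propext (hG p)
  exact ⟨h1 ▸ h.1, h1 ▸ h.2⟩

theorem runs_selectStep (hC : StepCtx ι d σ) {s t : S} (hu : σ.nat cu [] = ι s)
    (hw : σ.nat cw [] = ι t) {G : S × S → Prop}
    (h : SelectInv d (σ.real lo []) (σ.real .eps []) G σ) :
    Runs g selectStep σ (200 * (Fintype.card S + 1) ^ 2)
      (SelectInv d (σ.real lo []) (σ.real .eps []) fun p => G p ∨ p = (s, t)) := by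
  have hX2 : 1 ≤ (Fintype.card S + 1) ^ 2 := Nat.one_le_pow _ _ (Nat.succ_pos _)
  have hst := hC.old s t
  unfold selectStep
  have e0 : (inside cu cw).Holds σ ↔ σ.real lo [] < d s t ∧ d s t < σ.real .eps [] := by
    simp [Test.Holds, RealExpr.eval, State.index, hu, hw, hst]
  refine Runs.mono_bound (Runs.ite (B₁ := 120 * (Fintype.card S + 1) ^ 2 + 40) (B₂ := 1)
    (fun hb => ?_) (fun hb => ?_)) (by simp; omega)
  · rw [e0] at hb
    refine Runs.seq (runs_count hC hu hw hb.1 hb.2) fun σ₁ hF hcnt => ?_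
    have hreal : σ₁.real = σ.real := funext fun z =>
      hF.real z (by simp [count, countStep, forLoop, Cmd.WritesReal])
    have hiff : ∀ b, b = ((Test.natLt (.get total []) (.add (.get below []) (.get below []))).not.and
        (Test.natLt (.get total []) (.add (.get above []) (.get above []))).not) → (b.Holds σ₁ ↔
        IsMedian (fun p : S × S => d p.1 p.2) (σ.real lo []) (σ.real .eps []) (d s t)) := by
      rintro _ rfl
      simp only [Test.Holds, NatExpr.eval, State.index, List.map_nil, hcnt, not_lt, ← two_mul]
      exact ⟨fun h => ⟨hb.1, hb.2, h.1, h.2⟩, fun h => ⟨h.below, h.above⟩⟩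
    refine Runs.mono_bound (Runs.ite (fun hc => Runs.realSet ?_) fun hc => Runs.skip ?_) (by simp)
    · rw [hiff _ rfl] at hc
      have : ∀ r, r = d s t → IsMedian (fun p : S × S => d p.1 p.2) (σ.real lo [])
        (σ.real .eps []) r ∧ IsThreshold d r := fun r hr => ⟨hr ▸ hc, Or.inr ⟨s, t, hr⟩⟩
      have hthr := this ((σ₁.setReal thr (σ₁.index [])
        ((RealExpr.get .old [cu, cw]).eval σ₁)).real thr []) (by
          simp [State.index, RealExpr.eval, hreal,
            hF.nat cu (by simp [count, countStep, forLoop, Cmd.WritesNat]),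
            hF.nat cw (by simp [count, countStep, forLoop, Cmd.WritesNat]), hu, hw, hst])
      exact ⟨Or.inr hthr, fun _ _ _ => hthr.1⟩
    · rw [hiff _ rfl] at hc
      refine ⟨by rw [hreal]; exact h.1, fun p hp hm => ?_⟩
      rw [hreal]
      rcases hp with hp | rfl
      · exact h.2 p hp hm
      · exact absurd hm hc
  · rw [e0] at hb
    refine Runs.skip ⟨h.1, fun p hp hm => ?_⟩
    rcases hp with hp | rfl
    · exact h.2 p hp hm
    · exact absurd ⟨hm.lt, hm.gt⟩ hb

/-- Trying each of the |S|² entries, with a count over |S|² entries for each, costs no more in order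
than a flow computation; sorting is unnecessary. -/
theorem runs_select (hC : StepCtx ι d σ) :
    Runs g select σ (230 * (Fintype.card S + 1) ^ 4) fun σ' =>
      IsMedian (fun p : S × S => d p.1 p.2) (σ.real lo []) (σ.real .eps []) (σ'.real thr []) ∧
        IsThreshold d (σ'.real thr []) ∨
      between (fun p : S × S => d p.1 p.2) (σ.real lo []) (σ.real .eps []) = ∅ ∧
        σ'.real thr [] = σ.real lo [] := by
  have hX : 1 ≤ Fintype.card S + 1 := Nat.le_add_left _ _
  have hX4 := Nat.one_le_pow 4 _ hX
  unfold select
  refine Runs.mono (Runs.realSet_seq (Runs.forLoop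
    (B := 208 * (Fintype.card S + 1) ^ 3) (m := Fintype.card S)
    (fun y σ' => SelectInv d (σ.real lo []) (σ.real .eps []) (fun p => (ι p.1 : ℕ) < y) σ')
    ?_ ?_ ?_ ?_ ?_)) (fun _ => ?_) ?_
  · simp [selectStep, count, countStep, forLoop, Cmd.WritesNat]
  · intro σ' hF
    change σ'.nat .numStates [] = _
    rw [hF.nat .numStates (by simp [selectStep, count, countStep, forLoop, Cmd.WritesNat])]
    exact hC.numStates
  · exact fun y σ' r h' => h'.congr (fun _ => Iff.rfl) rfl
  · exact ⟨Or.inl (by simp [State.index, RealExpr.eval]), fun p hp => absurd hp (Nat.not_lt_zero _)⟩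
  · intro k hk σ₁ hF₁ hu h₁
    obtain ⟨s, rfl⟩ := num_surj ι hk
    have hn₁ : σ₁.nat .numStates [] = Fintype.card S := by
      rw [hF₁.nat _ (by simp [selectStep, count, countStep, forLoop, Cmd.WritesNat])]
      exact hC.numStates
    have hreal : ∀ z, z ≠ thr → σ₁.real z = σ.real z := fun z hz => by
      rw [hF₁.real z (by simpa [selectStep, count, countStep, forLoop, Cmd.WritesReal] using hz),
        State.setReal_real_of_ne _ _ _ hz]
    refine Runs.mono (Runs.forLoop (B := 200 * (Fintype.card S + 1) ^ 2) (m := Fintype.card S)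
      (fun y σ' => SelectInv d (σ.real lo []) (σ.real .eps [])
        (fun p => (ι p.1 : ℕ) < ι s ∨ p.1 = s ∧ (ι p.2 : ℕ) < y) σ') ?_ ?_ ?_ ?_ ?_)
      (fun _ => loop_bound (a := 8) hX le_rfl) ?_
    · simp [selectStep, count, countStep, forLoop, Cmd.WritesNat]
    · intro σ' hF
      change σ'.nat .numStates [] = _
      rw [hF.nat .numStates (by simp [selectStep, count, countStep, forLoop, Cmd.WritesNat]), hn₁]
    · exact fun y σ' r h' => h'.congr (fun _ => Iff.rfl) rfl
    · exact h₁.congr (fun p => by simp) rfl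
    · intro k hk σ₂ hF₂ hw h₂
      obtain ⟨t, rfl⟩ := num_surj ι hk
      have hreal₂ : ∀ z, z ≠ thr → σ₂.real z = σ.real z := fun z hz => by
        rw [hF₂.real z (by simpa [selectStep, count, countStep, forLoop, Cmd.WritesReal] using hz),
          hreal z hz]
      have hu₂ : σ₂.nat cu [] = ι s := by
        rw [hF₂.nat cu (by simp [selectStep, count, countStep, forLoop, Cmd.WritesNat]), hu]
      have hC₂ : StepCtx ι d σ₂ :=
        ⟨by rw [hF₂.nat .numStates
            (by simp [selectStep, count, countStep, forLoop, Cmd.WritesNat]), hn₁],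
          fun x y => by rw [hreal₂ _ (by simp), hC.old]⟩
      rw [← hreal₂ lo (by simp), ← hreal₂ .eps (by simp)] at h₂ ⊢
      refine (runs_selectStep hC₂ hu₂ hw h₂).mono_post fun σ₃ _ h₃ => h₃.congr (fun p => ?_) rfl
      rw [num_lt_succ, Prod.ext_iff]
      tauto
    · intro σ₂ _ h₂
      refine h₂.congr (fun p => ?_) rfl
      rw [num_lt_succ]
      simp
  · refine (Nat.add_le_add_left (loop_bound (a := 8) hX le_rfl) _).trans ?_
    simp
    omega
  · rintro σ' _ ⟨h1, h2⟩
    by_cases hne : (between (fun p : S × S => d p.1 p.2) (σ.real lo []) (σ.real .eps [])).Nonempty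
    · obtain ⟨p, hp⟩ := exists_isMedian _ hne
      have hm := h2 p (ι p.1).2 hp
      exact Or.inl ⟨hm, (h1.resolve_left hm.lt.ne').2⟩
    · rcases h1 with h1 | h1
      · exact Or.inr ⟨not_nonempty_iff_eq_empty.1 hne, h1⟩
      · exact Or.inl h1

end Select

/-! ### Bisection -/

section Search

variable {S : Type u} [Fintype S] {ι : S ≃ Fin (Fintype.card S)} {μ ν : SubDist S}
  {d : S → S → ℝ} {σ : State} {g : Prop}

/-- After `k` rounds of a search that started with the value `e₀`, the current value is `e`, and
the thresholds outside the interval from `l` to `e` have been dealt with. -/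
structure SearchInv (μ ν : SubDist S) (d : S → S → ℝ) (e₀ : ℝ) (k : ℕ) (l e : ℝ) : Prop where
  le : e ≤ e₀
  eq : e = e₀ ∨ ∃ v, IsThreshold d v ∧ e = max v (untransported μ ν d v)
  thr : IsThreshold d l
  done : ∀ v, IsThreshold d v → v ≤ l → e ≤ max v (untransported μ ν d v)
  card : (between (fun p : S × S => d p.1 p.2) l e).card * 2 ^ k ≤
    Fintype.card S * Fintype.card S

/-- The new values when the threshold `v` has been examined. -/
structure Tightened (μ ν : SubDist S) (d : S → S → ℝ) (v l e l' e' : ℝ) : Prop where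
  eq : e' = min e (max v (untransported μ ν d v))
  of_lt : v < untransported μ ν d v → l' = v
  of_le : untransported μ ν d v ≤ v → l' = l

variable {e₀ v l e l' e' : ℝ} {k : ℕ}

/-- If `v` is below its untransported mass, every threshold w ≤ v leaves at least as much mass and
cannot improve on the candidate of `v`; so the lower end may move to `v`. Otherwise the candidate is
`v` itself, and only the upper end moves. -/
theorem Tightened.searchInv_of_card (h : Tightened μ ν d v l e l' e') (hv : IsThreshold d v)
    (hl : IsThreshold d l) (he : e ≤ e₀)
    (heq : e = e₀ ∨ ∃ v, IsThreshold d v ∧ e = max v (untransported μ ν d v))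
    (hdone : untransported μ ν d v ≤ v →
      ∀ w, IsThreshold d w → w ≤ l → e' ≤ max w (untransported μ ν d w))
    (hcard : (between (fun p : S × S => d p.1 p.2) l' e').card * 2 ^ k ≤
      Fintype.card S * Fintype.card S) : SearchInv μ ν d e₀ k l' e' := by
  refine ⟨?_, ?_, ?_, ?_, hcard⟩
  · rw [h.eq]; exact (min_le_left _ _).trans he
  · rcases min_choice e (max v (untransported μ ν d v)) with hm | hm
    · rw [h.eq, hm]; exact heq
    · rw [h.eq, hm]; exact Or.inr ⟨v, hv, rfl⟩
  · rcases lt_or_ge v (untransported μ ν d v) with hlt | hle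
    · rwa [h.of_lt hlt]
    · rwa [h.of_le hle]
  · intro w hw hwl
    rcases lt_or_ge v (untransported μ ν d v) with hlt | hle
    · rw [h.of_lt hlt] at hwl
      rw [h.eq, max_eq_right hlt.le]
      exact (min_le_right _ _).trans ((untransported_anti hwl).trans (le_max_right _ _))
    · rw [h.of_le hle] at hwl
      exact hdone hle w hw hwl

/-- If all the mass is transported at threshold 0, the new value is at most 0 and no threshold can
beat it. -/
theorem Tightened.searchInv_zero (hd : ∀ x y, 0 ≤ d x y ∧ d x y ≤ 1)
    (h : Tightened μ ν d 0 0 e l' e') : SearchInv μ ν d e 0 l' e' := by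
  refine h.searchInv_of_card (Or.inl rfl) (Or.inl rfl) le_rfl (Or.inl rfl) (fun hle w hw _ => ?_) ?_
  · rw [h.eq, max_eq_left hle]
    exact (min_le_right _ _).trans ((hw.nonneg hd).trans (le_max_left _ _))
  · rw [pow_zero, mul_one, ← Fintype.card_prod]
    exact card_le_univ _

/-- Whichever end moves to the median, at most half of the entries remain between the two ends. When
none are left, examining `l` again does no harm. -/
theorem SearchInv.next (h : SearchInv μ ν d e₀ k l e) (ht : Tightened μ ν d v l e l' e')
    (hv : IsMedian (fun p : S × S => d p.1 p.2) l e v ∧ IsThreshold d v ∨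
      between (fun p : S × S => d p.1 p.2) l e = ∅ ∧ v = l) :
    SearchInv μ ν d e₀ (k + 1) l' e' := by
  have hT : IsThreshold d v := by
    rcases hv with hv | ⟨-, rfl⟩
    · exact hv.2
    · exact h.thr
  have he' : e' ≤ e := ht.eq ▸ min_le_left _ _
  have hsub : ∀ {a b a' b' : ℝ}, a' ≤ a → b ≤ b' → between (fun p : S × S => d p.1 p.2) a b ⊆
      between (fun p : S × S => d p.1 p.2) a' b' := fun ha hb p hp => by
    simp only [between, mem_filter, mem_univ, true_and] at hp ⊢
    exact ⟨ha.trans_lt hp.1, hp.2.trans_le hb⟩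
  refine ht.searchInv_of_card hT h.thr h.le h.eq (fun _ w hw hwl => he'.trans (h.done w hw hwl)) ?_
  have hc : 2 * (between (fun p : S × S => d p.1 p.2) l' e').card ≤
      (between (fun p : S × S => d p.1 p.2) l e).card := by
    rcases hv with ⟨hm, -⟩ | ⟨hemp, rfl⟩
    · rcases lt_or_ge v (untransported μ ν d v) with hlt | hle
      · rw [ht.of_lt hlt]
        exact (Nat.mul_le_mul_left 2 (card_le_card (hsub le_rfl he'))).trans hm.above
      · rw [ht.of_le hle]
        refine (Nat.mul_le_mul_left 2 (card_le_card (hsub le_rfl ?_))).trans hm.below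
        rw [ht.eq, max_eq_left hle]
        exact min_le_right _ _
    · have hl' : l' = v := by
        rcases lt_or_ge v (untransported μ ν d v) with hlt | hle
        · exact ht.of_lt hlt
        · exact ht.of_le hle
      have := hsub (le_refl v) he'
      rw [hemp, subset_empty] at this
      rw [hl', this]
      simp
  calc _ = 2 * (between (fun p : S × S => d p.1 p.2) l' e').card * 2 ^ k := by rw [pow_succ]; ring
    _ ≤ _ := (Nat.mul_le_mul_right _ hc).trans h.card

/-- Since 2^(3n) > n², no entry remains strictly between `l` and `e`. Thresholds up to `l` have been
dealt with, and a threshold from `e` on is already too large itself. -/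
theorem SearchInv.finish (hd : ∀ x y, 0 ≤ d x y ∧ d x y ≤ 1)
    (h : SearchInv μ ν d e₀ (3 * Fintype.card S) l e)
    (hv : IsThreshold d v) : e ≤ max v (untransported μ ν d v) := by
  have hemp : between (fun p : S × S => d p.1 p.2) l e = ∅ := by
    by_contra hne
    have h1 : 1 ≤ (between (fun p : S × S => d p.1 p.2) l e).card :=
      card_pos.2 (nonempty_iff_ne_empty.2 hne)
    have h2 := (Nat.le_mul_of_pos_left _ h1).trans h.card
    have h3 : Fintype.card S < 2 ^ Fintype.card S := Nat.lt_two_pow_self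
    have h4 : 2 ^ (3 * Fintype.card S) = (2 ^ Fintype.card S) * (2 ^ Fintype.card S) *
        2 ^ Fintype.card S := by ring
    have h5 : Fintype.card S * Fintype.card S < 2 ^ Fintype.card S * 2 ^ Fintype.card S :=
      Nat.mul_self_lt_mul_self h3
    have h6 := Nat.le_mul_of_pos_right (2 ^ Fintype.card S * 2 ^ Fintype.card S)
      (Nat.two_pow_pos (Fintype.card S))
    omega
  rcases le_or_gt v l with hvl | hvl
  · exact h.done v hv hvl
  · rcases hv with rfl | ⟨x, y, rfl⟩
    · exact absurd (h.thr.nonneg hd) (not_le.2 hvl)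
    · refine le_trans (not_lt.1 fun hlt => ?_) (le_max_left _ _)
      have : (x, y) ∈ between (fun p : S × S => d p.1 p.2) l e := by
        simp only [between, mem_filter, mem_univ, true_and]
        exact ⟨hvl, hlt⟩
      rw [hemp] at this
      exact notMem_empty _ this

theorem runs_search (hd : ∀ x y, 0 ≤ d x y ∧ d x y ≤ 1) (hC : StepCtx ι d σ)
    (hμ : ∀ x, σ.real .prob [σ.nat .s [], σ.nat .a [], σ.nat .i [], (ι x : ℕ)] = μ.mass x)
    (hν : ∀ x, σ.real .prob [σ.nat .t [], σ.nat .a [], σ.nat target [], (ι x : ℕ)] = ν.mass x) :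
    Runs g search σ (30000 * (Fintype.card S + 1) ^ 5) fun σ' =>
      ∃ l, SearchInv μ ν d (σ.real .eps []) (3 * Fintype.card S) l (σ'.real .eps []) := by
  have hX : 1 ≤ Fintype.card S + 1 := Nat.le_add_left _ _
  have hX4 := Nat.one_le_pow 4 _ hX
  have hX5 : (Fintype.card S + 1) ^ 4 ≤ (Fintype.card S + 1) ^ 5 :=
    Nat.pow_le_pow_right hX (by norm_num)
  have wn : ∀ z, tighten.WritesNat z ∨ select.WritesNat z →
      z ≠ .numStates ∧ z ≠ .s ∧ z ≠ .a ∧ z ≠ .i ∧ z ≠ .t ∧ z ≠ target ∧ z ≠ rnd := by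
    intro z h
    refine ⟨?_, ?_, ?_, ?_, ?_, ?_, ?_⟩ <;> rintro rfl <;>
      simp [tighten, select, selectStep, count, countStep, computeRest, load, sweeps, sweep,
        dischargeL, dischargeR, forLoop, Cmd.WritesNat] at h
  have wr : ∀ z, tighten.WritesReal z ∨ select.WritesReal z → z ≠ .prob ∧ z ≠ .old := by
    intro z h
    refine ⟨?_, ?_⟩ <;> rintro rfl <;>
      simp [tighten, select, selectStep, count, countStep, computeRest, load, sweeps, sweep,
        dischargeL, dischargeR, forLoop, Cmd.WritesReal] at h
  have ws : ∀ z, select.WritesReal z → z ≠ .eps ∧ z ≠ lo := by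
    intro z h
    refine ⟨?_, ?_⟩ <;> rintro rfl <;>
      simp [select, selectStep, count, countStep, forLoop, Cmd.WritesReal] at h
  have htight : ∀ σ' : State, (∀ z, (z = .numStates ∨ z = .s ∨ z = .a ∨ z = .i ∨ z = .t ∨
        z = target) → σ'.nat z = σ.nat z) → σ'.real .prob = σ.real .prob →
      σ'.real .old = σ.real .old → Runs g tighten σ' (7100 * (Fintype.card S + 1) ^ 4) fun σ₂ =>
        Tightened μ ν d (σ'.real thr []) (σ'.real lo []) (σ'.real .eps []) (σ₂.real lo [])
          (σ₂.real .eps []) := fun σ' hn hp ho =>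
    (runs_tighten ⟨by rw [hn _ (by simp), hC.numStates], fun x y => by rw [ho, hC.old]⟩
      (fun x => by rw [hp, hn _ (by simp), hn _ (by simp), hn _ (by simp), hμ])
      (fun x => by rw [hp, hn _ (by simp), hn _ (by simp), hn _ (by simp), hν])).mono_post
      fun _ _ h => ⟨h.1, h.2.1, h.2.2⟩
  unfold search
  refine Runs.mono (Runs.realSet_seq (Runs.realSet_seq (Runs.seq (htight _ ?_ ?_ ?_)
    fun σ₁ hF₁ h₁ => Runs.forLoop (B := 7330 * (Fintype.card S + 1) ^ 4) (m := 3 * Fintype.card S)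
      (fun k σ' => SearchInv μ ν d (σ.real .eps []) k (σ'.real lo []) (σ'.real .eps []))
      ?_ ?_ ?_ ?_ ?_))) (fun _ => ?_) ?_
  · exact fun _ _ => rfl
  · simp [State.setReal_real_of_ne]
  · simp [State.setReal_real_of_ne]
  · rintro (h | h)
    · exact (wn _ (Or.inr h)).2.2.2.2.2.2 rfl
    · exact (wn _ (Or.inl h)).2.2.2.2.2.2 rfl
  · intro σ' hF
    have : σ'.nat .numStates [] = Fintype.card S := by
      rw [hF.nat, hF₁.nat]
      · exact hC.numStates
      · exact fun h => (wn _ (Or.inl h)).1 rfl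
      · rintro (h | (h | h) | h)
        · cases h
        · exact (wn _ (Or.inr h)).1 rfl
        · exact (wn _ (Or.inl h)).1 rfl
        · cases h
    simp only [NatExpr.eval, State.index, List.map_nil, this]
    ring
  · exact fun _ _ _ h' => h'
  · have h₂ : ∀ τ : State, τ.real lo [] = 0 → τ.real thr [] = 0 →
        τ.real .eps [] = σ.real .eps [] →
        Tightened μ ν d (τ.real thr []) (τ.real lo []) (τ.real .eps []) (σ₁.real lo [])
        (σ₁.real .eps []) → SearchInv μ ν d (σ.real .eps []) 0 (σ₁.real lo [])
        (σ₁.real .eps []) := by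
      intro τ h₀ h₀' h₀'' h
      rw [h₀, h₀', h₀''] at h
      exact h.searchInv_zero hd
    refine h₂ _ ?_ ?_ ?_ h₁
    · simp [State.setReal_real, State.index, RealExpr.eval]
    · simp [State.index, RealExpr.eval]
    · simp [State.setReal_real_of_ne]
  · intro k hk σ₂ hF₂ _ h₂
    have hnat : ∀ z, (z = .numStates ∨ z = .s ∨ z = .a ∨ z = .i ∨ z = .t ∨
        z = target) → σ₂.nat z = σ.nat z := by
      intro z hz
      have h0 : ¬ (tighten.WritesNat z ∨ select.WritesNat z) ∧ z ≠ rnd := by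
        refine ⟨fun h => ?_, by rcases hz with rfl | rfl | rfl | rfl | rfl | rfl <;> simp⟩
        have := wn z h
        tauto
      rw [hF₂.nat, hF₁.nat]
      · rfl
      · exact fun h => h0.1 (Or.inl h)
      · rintro (h | (h | h) | h)
        · exact h0.2 h
        · exact h0.1 (Or.inr h)
        · exact h0.1 (Or.inl h)
        · exact h0.2 h
    have hreal : ∀ z, z = .prob ∨ z = .old → σ₂.real z = σ.real z := by
      intro z hz
      have h0 : ¬ (tighten.WritesReal z ∨ select.WritesReal z) := fun h => by
        have := wr z h
        tauto
      rw [hF₂.real, hF₁.real]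
      · rcases hz with rfl | rfl <;> simp [State.setReal_real_of_ne]
      · exact fun h => h0 (Or.inl h)
      · rintro (h | (h | h) | h)
        · exact h
        · exact h0 (Or.inr h)
        · exact h0 (Or.inl h)
        · exact h
    refine Runs.mono_bound (Runs.seq (runs_select ⟨by rw [hnat _ (by simp), hC.numStates],
      fun x y => by rw [hreal _ (by simp), hC.old]⟩) fun σ₃ hF₃ h₃ => (htight σ₃
      (fun z hz => ?_) ?_ ?_).mono_post fun σ₄ _ h₄ => ?_) ?_
    · rw [hF₃.nat z fun h => ?_, hnat z hz]
      have := wn z (Or.inr h)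
      tauto
    · rw [hF₃.real _ fun h => (wr _ (Or.inr h)).1 rfl, hreal _ (by simp)]
    · rw [hF₃.real _ fun h => (wr _ (Or.inr h)).2 rfl, hreal _ (by simp)]
    · rw [hF₃.real lo fun h => (ws _ h).2 rfl, hF₃.real .eps fun h => (ws _ h).1 rfl] at h₄
      exact h₂.next h₄ h₃
    · omega
  · have h3 : 3 * Fintype.card S + 1 ≤ 3 * (Fintype.card S + 1) := by omega
    have h4 : (3 * Fintype.card S + 1) * (12 + 7330 * (Fintype.card S + 1) ^ 4) ≤
        3 * ((12 + 7330) * (Fintype.card S + 1) ^ 5) := by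
      refine (Nat.mul_le_mul_right _ h3).trans ?_
      rw [mul_assoc]
      exact Nat.mul_le_mul_left 3 (loop_bound (a := 12) hX le_rfl)
    simp only [RealExpr.cost, NatExpr.cost, List.length_nil, Nat.reduceAdd]
    omega
  · exact fun σ' _ h' => ⟨_, h'⟩

end Search

/-! ### The innermost instruction as a whole. -/

section Implementation

/-- The variable `eps` is kept from one ν to the next: it is always 1 or a candidate, and it bounds
from below all candidates of the transitions already searched. -/
theorem runs_step {S : Type u} {Act : Type v} [Fintype S] [Fintype Act] {P : PA S Act}
    {N : InputNumbering P} {d : S → S → ℝ} {s t : S} {a : Act} {μ : {μ // μ ∈ P.trans s a}}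
    {σ : State} {g : Prop} (hd : ∀ x y, 0 ≤ d x y ∧ d x y ≤ 1) (hσ : HoldsInput P N σ)
    (hold : ∀ x y, σ.real .old [(N.state x : ℕ), (N.state y : ℕ)] = d x y)
    (hs : σ.nat .s [] = N.state s) (ht : σ.nat .t [] = N.state t) (ha : σ.nat .a [] = N.act a)
    (hi : σ.nat .i [] = N.tr s a μ) :
    Runs g step σ (((P.trans t a).card + 1) * (31000 * (Fintype.card S + 1) ^ 5))
      fun σ' => IsStepValue P d t a μ.1 (σ'.real .eps []) := by
  have hX5 := Nat.one_le_pow 5 (Fintype.card S + 1) (Nat.le_add_left _ _)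
  have wn : ∀ z, search.WritesNat z → (∃ j, z = .scratch j) ∧ z ≠ target := by
    intro z h
    simp only [search, tighten, select, selectStep, count, countStep, computeRest, load, sweeps,
      sweep, dischargeL, dischargeR, forLoop, Cmd.WritesNat, or_false, false_or] at h
    casesm* _ ∨ _ <;> subst h <;> simp
  have wr : ∀ z, search.WritesReal z → (∃ j, z = .scratch j) ∨ z = .eps := by
    intro z h
    simp only [search, tighten, select, selectStep, count, countStep, computeRest, load, sweeps,
      sweep, dischargeL, dischargeR, forLoop, Cmd.WritesReal, or_false, false_or] at h
    casesm* _ ∨ _ <;> subst h <;> simp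
  unfold step
  refine Runs.mono (Runs.realSet_seq (Runs.forLoop (B := 30000 * (Fintype.card S + 1) ^ 5)
    (m := (P.trans t a).card) (fun k σ' =>
      σ'.real .eps [] ∈ insert 1 (stepCandidates P d t a μ.1) ∧ σ'.real .eps [] ≤ 1 ∧
      ∀ ν : {ν // ν ∈ P.trans t a}, (N.tr t a ν : ℕ) < k → ∀ v, IsThreshold d v →
        σ'.real .eps [] ≤ max v (untransported μ.1 ν.1 d v)) ?_ ?_ ?_ ?_ ?_)) (fun _ => ?_) ?_
  · exact fun h => (wn _ h).2 rfl
  · intro σ' hF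
    have hnat : ∀ z, z = .branch ∨ z = .t ∨ z = .a → σ'.nat z = σ.nat z := by
      intro z hz
      rw [hF.nat]
      · rfl
      · rintro (h | h | h)
        · subst h; simp at hz
        · obtain ⟨⟨j, rfl⟩, -⟩ := wn z h; simp at hz
        · subst h; simp at hz
    simp only [NatExpr.eval, State.index, List.map_cons, List.map_nil]
    rw [hnat .t (by simp), hnat .a (by simp), hnat .branch (by simp), ht, ha, hσ.branch]
  · exact fun _ _ _ h => h
  · refine ⟨Or.inl ?_, ?_, fun ν hν => absurd hν (Nat.not_lt_zero _)⟩ <;>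
      simp [State.index, RealExpr.eval]
  · rintro k hk σ' hF hz ⟨h1, h2, h3⟩
    obtain ⟨ν, hν⟩ : ∃ ν, (N.tr t a ν : ℕ) = k := ⟨(N.tr t a).symm ⟨k, hk⟩, by simp⟩
    have hnat : ∀ z, (∀ j, z ≠ .scratch j) → σ'.nat z = σ.nat z := by
      intro z hz
      rw [hF.nat]
      · rfl
      · rintro (h | h | h)
        · exact hz _ h
        · obtain ⟨⟨j, rfl⟩, -⟩ := wn z h; exact hz _ rfl
        · exact hz _ h
    have hreal : ∀ z, (∀ j, z ≠ .scratch j) → z ≠ .eps → σ'.real z = σ.real z := by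
      intro z hz hz'
      rw [hF.real, State.setReal_real_of_ne _ _ _ hz']
      rintro (h | h | h)
      · exact h
      · rcases wr z h with ⟨j, rfl⟩ | rfl
        · exact hz _ rfl
        · exact hz' rfl
      · exact h
    refine (runs_search (ι := N.state) (μ := μ.1) (ν := ν.1) hd
      ⟨by rw [hnat _ (by simp), hσ.numStates],
        fun x y => by rw [hreal _ (by simp) (by simp), hold]⟩ (fun x => ?_)
      (fun x => ?_)).mono_post ?_
    · rw [hreal _ (by simp) (by simp), hnat _ (by simp), hnat _ (by simp), hnat _ (by simp), hs, ha,
        hi, hσ.prob]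
    · rw [hreal _ (by simp) (by simp), hnat _ (by simp), hnat _ (by simp), ht, ha, hz, ← hν,
        hσ.prob]
    · rintro σ₂ - ⟨l, hinv⟩
      refine ⟨?_, hinv.le.trans h2, fun ν' hν' v hv => ?_⟩
      · rcases hinv.eq with heq | ⟨v, hv, heq⟩
        · rw [heq]; exact h1
        · exact Or.inr ⟨ν.1, ν.2, v, hv, heq⟩
      · rcases Nat.lt_succ_iff_lt_or_eq.1 hν' with hlt | heq
        · exact hinv.le.trans (h3 ν' hlt v hv)
        · have : ν' = ν := (N.tr t a).injective (Fin.ext (heq.trans hν.symm))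
          subst this
          exact hinv.finish hd hv
  · have h1 : 10 + 30000 * (Fintype.card S + 1) ^ 5 + 2 ≤ 31000 * (Fintype.card S + 1) ^ 5 := by
      omega
    have h2 := Nat.mul_le_mul_left ((P.trans t a).card + 1) h1
    simp only [RealExpr.cost, NatExpr.cost, List.length_nil, List.length_cons]
    nlinarith
  · rintro σ' - ⟨h1, h2, h3⟩
    refine isStepValue_of_candidates hd h1 h2 ?_
    rintro _ ⟨ν, hν, v, hv, rfl⟩
    exact h3 ⟨ν, hν⟩ (N.tr t a ⟨ν, hν⟩).2 v hv

theorem step_sameOutside {σ σ' : State} {T : ℕ} (h : Exec step σ T σ') : SameOutside σ σ' where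
  nat z l hz := by
    rw [h.frame.nat]
    intro h
    simp only [step, search, tighten, select, selectStep, count, countStep, computeRest, load,
      sweeps, sweep, dischargeL, dischargeR, forLoop, Cmd.WritesNat, or_false, false_or] at h
    casesm* _ ∨ _ <;> exact hz _ h
  real z l hz hz' := by
    rw [h.frame.real]
    intro h
    simp only [step, search, tighten, select, selectStep, count, countStep, computeRest, load,
      sweeps, sweep, dischargeL, dischargeR, forLoop, Cmd.WritesReal, or_false, false_or] at h
    casesm* _ ∨ _ <;> first | exact hz _ h | exact hz' h

theorem implementsStep_step : ImplementsStep.{u, v} step := by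
  intro S Act _ _ P N d s t a μ σ hd hσ hold hs ht ha hi
  obtain ⟨T, σ', hE, -, hv⟩ := runs_step (g := True) hd hσ hold hs ht ha hi
  exact ⟨T, σ', hE, hv, step_sameOutside hE⟩

end Implementation

/-! ### Correctness of the iteration -/

section Iteration

variable {S : Type u} {Act : Type v} [Fintype S] {P : PA S Act} {d d' : S → S → ℝ}

theorem Lift.mono {ε ε' : ℝ} {R R' : S → S → Prop} {μ ν : SubDist S} (h : Lift ε R μ ν)
    (hε : ε ≤ ε') (hR : ∀ x y, R x y → R' x y) : Lift ε' R' μ ν := fun E =>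
  (h E).trans (add_le_add (ν.prob_mono fun _ ⟨x, hx, hxy⟩ => ⟨x, hx, hR _ _ hxy⟩) hε)

/-- The default value 1 takes care of every ε ≥ 1, so only ε < 1 has to be considered throughout. -/
theorem le_bisimDist_iff {x y : S} {r : ℝ} (hr : r ≤ 1) :
    r ≤ bisimDist P x y ↔ ∀ ε, 0 ≤ ε → ε < 1 → Bisimilar P ε x y → r ≤ ε := by
  refine ⟨fun h ε h0 _ hε => h.trans (csInf_le ⟨0, ?_⟩ (Or.inr ⟨h0, hε⟩)), fun h => ?_⟩
  · rintro _ (rfl | h)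
    · exact zero_le_one
    · exact h.1
  · refine le_csInf ⟨1, Or.inl rfl⟩ ?_
    rintro ε (rfl | hε)
    · exact hr
    · rcases lt_or_ge ε 1 with h1 | h1
      · exact h ε hε.1 h1 hε.2
      · exact hr.trans h1

theorem bisimDist_le {x y : S} {ε : ℝ} (h0 : 0 ≤ ε) (h : Bisimilar P ε x y) :
    bisimDist P x y ≤ ε := by
  refine csInf_le ⟨0, ?_⟩ (Or.inr ⟨h0, h⟩)
  rintro _ (rfl | h)
  · exact zero_le_one
  · exact h.1

theorem bisimDist_le_one (x y : S) : bisimDist P x y ≤ 1 := by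
  refine csInf_le ⟨0, ?_⟩ (Or.inl rfl)
  rintro _ (rfl | h)
  · exact zero_le_one
  · exact h.1

theorem bisimDist_nonneg (x y : S) : 0 ≤ bisimDist P x y := by
  refine le_csInf ⟨1, Or.inl rfl⟩ ?_
  rintro _ (rfl | h)
  · exact zero_le_one
  · exact h.1

/-- The number computed by the innermost instruction of the algorithm. -/
noncomputable def stepValue (P : PA S Act) (d : S → S → ℝ) (t : S) (a : Act) (μ : SubDist S) : ℝ :=
  sInf (insert 1 (feasible P d t a μ))

theorem IsStepValue.eq {t : S} {a : Act} {μ : SubDist S} {r : ℝ} (h : IsStepValue P d t a μ r) :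
    r = stepValue P d t a μ :=
  h.csInf_eq.symm

theorem isStepValue_stepValue (hd : ∀ x y, 0 ≤ d x y ∧ d x y ≤ 1) (t : S) (a : Act)
    (μ : SubDist S) : IsStepValue P d t a μ (stepValue P d t a μ) := by
  obtain ⟨r, hr⟩ := exists_isStepValue P t a μ hd
  rwa [← hr.eq]

theorem stepValue_le_one (hd : ∀ x y, 0 ≤ d x y ∧ d x y ≤ 1) (t : S) (a : Act) (μ : SubDist S) :
    stepValue P d t a μ ≤ 1 :=
  (isStepValue_stepValue hd t a μ).2 (Or.inl rfl)

/-- For ε < 1 the default value 1 cannot be the reason for the inequality, so a matching transition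
exists. -/
theorem stepValue_le_iff (hd : ∀ x y, 0 ≤ d x y ∧ d x y ≤ 1) {t : S} {a : Act} {μ : SubDist S}
    {ε : ℝ} (h0 : 0 ≤ ε) (h1 : ε < 1) :
    stepValue P d t a μ ≤ ε ↔ ∃ ν ∈ P.trans t a, Lift ε (fun x y => d x y ≤ ε) μ ν := by
  have hv := isStepValue_stepValue (P := P) hd t a μ
  constructor
  · intro h
    rcases hv.1 with h2 | ⟨-, -, ν, hν, hf⟩
    · exact absurd (h2 ▸ h) (not_le.2 h1)
    · exact ⟨ν, hν, ((lift_iff_maxFlow _ _ _ _).2 hf).mono h fun x y hxy => hxy.trans h⟩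
  · rintro ⟨ν, hν, hf⟩
    exact hv.2 (Or.inr ⟨h0, h1.le, ν, hν, (lift_iff_maxFlow _ _ _ _).1 hf⟩)

/-- `d'` results from `d` by one pass of the algorithm. -/
def IsUpdate (P : PA S Act) (d d' : S → S → ℝ) : Prop :=
  ∀ x y r, d' x y ≤ r ↔ d x y ≤ r ∧ (∀ a, ∀ μ ∈ P.trans x a, stepValue P d y a μ ≤ r) ∧
    ∀ a, ∀ μ ∈ P.trans y a, stepValue P d x a μ ≤ r

/-- What is known about the matrix `d` computed in `j` passes. -/
structure IterInv (P : PA S Act) (j : ℕ) (d : S → S → ℝ) : Prop where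
  bounds : ∀ x y, 0 ≤ d x y ∧ d x y ≤ 1
  symm : ∀ x y, d x y = d y x
  le_dist : ∀ x y, d x y ≤ bisimDist P x y
  progress : ∀ ε, 0 ≤ ε → ε < 1 → IsBisimulation P ε (fun x y => d x y ≤ ε) ∨
    Nat.card {p : S × S // d p.1 p.2 ≤ ε} + j ≤ Fintype.card S ^ 2

theorem iterInv_zero : IterInv P 0 (fun _ _ => 0) where
  bounds _ _ := ⟨le_rfl, zero_le_one⟩
  symm _ _ := rfl
  le_dist := bisimDist_nonneg
  progress ε h0 _ := Or.inr <| by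
    rw [add_zero, sq, ← Fintype.card_prod, ← Nat.card_eq_fintype_card]
    exact Nat.card_le_card_of_injective _ Subtype.val_injective

/-- For an entry ε < 1, the relation {d ≤ ε} is itself an ε-bisimulation containing the pair. -/
theorem IterInv.eq_bisimDist {j : ℕ} (h : IterInv P j d)
    (hb : ∀ ε, 0 ≤ ε → ε < 1 → IsBisimulation P ε fun x y => d x y ≤ ε) : d = bisimDist P := by
  funext x y
  refine le_antisymm (h.le_dist x y) ?_
  rcases (h.bounds x y).2.lt_or_eq with h1 | h1
  · exact bisimDist_le (h.bounds x y).1 ⟨_, hb _ (h.bounds x y).1 h1, le_rfl⟩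
  · exact h1 ▸ bisimDist_le_one x y

theorem IterInv.isBisimulation_of_lt {j : ℕ} (h : IterInv P j d) (hj : Fintype.card S ^ 2 < j)
    (ε : ℝ) (h0 : 0 ≤ ε) (h1 : ε < 1) : IsBisimulation P ε fun x y => d x y ≤ ε :=
  (h.progress ε h0 h1).resolve_right (by omega)

namespace IsUpdate

variable (h : IsUpdate P d d')
include h

theorem le (x y : S) : d x y ≤ d' x y := ((h x y _).1 le_rfl).1

theorem le_one (hd : ∀ x y, 0 ≤ d x y ∧ d x y ≤ 1) (x y : S) : d' x y ≤ 1 :=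
  (h x y 1).2 ⟨(hd x y).2, fun _ _ _ => stepValue_le_one hd _ _ _,
    fun _ _ _ => stepValue_le_one hd _ _ _⟩

theorem symm (hd : ∀ x y, d x y = d y x) (x y : S) : d' x y = d' y x := by
  refine eq_of_forall_ge_iff fun r => ?_
  rw [h x y, h y x, hd x y, and_comm (a := ∀ a, ∀ μ ∈ P.trans x a, _)]

/-- Seen at a single level ε, a pass is one refinement step of the relation {d ≤ ε}, in which no
other level takes part. -/
theorem le_iff (hd : ∀ x y, 0 ≤ d x y ∧ d x y ≤ 1) {ε : ℝ} (h0 : 0 ≤ ε) (h1 : ε < 1) (x y : S) :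
    d' x y ≤ ε ↔ d x y ≤ ε ∧
      (∀ a, ∀ μ ∈ P.trans x a, ∃ ν ∈ P.trans y a, Lift ε (fun x y => d x y ≤ ε) μ ν) ∧
      ∀ a, ∀ μ ∈ P.trans y a, ∃ ν ∈ P.trans x a, Lift ε (fun x y => d x y ≤ ε) μ ν := by
  simp only [h x y, stepValue_le_iff hd h0 h1]

theorem le_iff_of_isBisimulation (hd : ∀ x y, 0 ≤ d x y ∧ d x y ≤ 1) {ε : ℝ} (h0 : 0 ≤ ε)
    (h1 : ε < 1) (hb : IsBisimulation P ε fun x y => d x y ≤ ε) (x y : S) :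
    d' x y ≤ ε ↔ d x y ≤ ε :=
  ⟨(h.le x y).trans, fun hxy => (h.le_iff hd h0 h1 x y).2
    ⟨hxy, hb.2 x y hxy, hb.2 y x (hb.1 x y hxy)⟩⟩

theorem eq_of_isBisimulation (hd : ∀ x y, 0 ≤ d x y ∧ d x y ≤ 1)
    (hb : ∀ ε, 0 ≤ ε → ε < 1 → IsBisimulation P ε fun x y => d x y ≤ ε) : d' = d := by
  funext x y
  refine le_antisymm ?_ (h.le x y)
  rcases (hd x y).2.lt_or_eq with h1 | h1
  · exact (h.le_iff_of_isBisimulation hd (hd x y).1 h1 (hb _ (hd x y).1 h1) x y).2 le_rfl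
  · exact h1 ▸ h.le_one hd x y

/-- A level on which the pass removes no pair is a fixed point of refinement. This also justifies
the stopping test. -/
theorem isBisimulation (hd : ∀ x y, 0 ≤ d x y ∧ d x y ≤ 1) (hs : ∀ x y, d x y = d y x) {ε : ℝ}
    (h0 : 0 ≤ ε) (h1 : ε < 1) (heq : ∀ x y, d x y ≤ ε → d' x y ≤ ε) :
    IsBisimulation P ε fun x y => d x y ≤ ε :=
  ⟨fun x y hxy => (hs x y).symm.trans_le hxy,
    fun x y hxy => ((h.le_iff hd h0 h1 x y).1 (heq x y hxy)).2.1⟩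

theorem iterInv {j : ℕ} (hd : IterInv P j d) : IterInv P (j + 1) d' where
  bounds x y := ⟨(hd.bounds x y).1.trans (h.le x y), h.le_one hd.bounds x y⟩
  symm := h.symm hd.symm
  le_dist x y := by
    -- An ε-bisimulation `R` is contained in {d ≤ ε} by the invariant, so its matching transitions
    -- still match with respect to the larger relation.
    refine (le_bisimDist_iff (h.le_one hd.bounds x y)).2 fun ε h0 h1 hε => ?_
    obtain ⟨R, hR, hxy⟩ := hε
    have hsub : ∀ x y, R x y → d x y ≤ ε := fun x y hxy =>
      (hd.le_dist x y).trans (bisimDist_le h0 ⟨R, hR, hxy⟩)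
    refine (h.le_iff hd.bounds h0 h1 x y).2 ⟨hsub x y hxy, fun a μ hμ => ?_, fun a μ hμ => ?_⟩
    · obtain ⟨ν, hν, hl⟩ := hR.2 x y hxy a μ hμ
      exact ⟨ν, hν, hl.mono le_rfl hsub⟩
    · obtain ⟨ν, hν, hl⟩ := hR.2 y x (hR.1 x y hxy) a μ hμ
      exact ⟨ν, hν, hl.mono le_rfl hsub⟩
  progress ε h0 h1 := by
    by_cases hb : IsBisimulation P ε fun x y => d x y ≤ ε
    · left
      have : (fun x y => d' x y ≤ ε) = fun x y => d x y ≤ ε := by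
        funext x y
        exact propext (h.le_iff_of_isBisimulation hd.bounds h0 h1 hb x y)
      rwa [this]
    · right
      have hc := (hd.progress ε h0 h1).resolve_left hb
      -- A level that is not yet a bisimulation loses a pair in this pass, which pays for the
      -- increase of the pass count.
      have hlt : Nat.card {p : S × S // d' p.1 p.2 ≤ ε} < Nat.card {p : S × S // d p.1 p.2 ≤ ε} := by
        obtain ⟨x, y, hxy, hxy'⟩ : ∃ x y, d x y ≤ ε ∧ ¬ d' x y ≤ ε := by
          by_contra! hne
          exact hb (h.isBisimulation hd.bounds hd.symm h0 h1 hne)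
        refine Set.ncard_lt_ncard (s := {p : S × S | d' p.1 p.2 ≤ ε})
          (t := {p : S × S | d p.1 p.2 ≤ ε}) ⟨fun p hp => (h.le _ _).trans hp, fun hsub => ?_⟩
        exact hxy' (hsub (show (x, y) ∈ {p : S × S | d p.1 p.2 ≤ ε} from hxy))
      omega

end IsUpdate

end Iteration

/-! ### The outer loops of the algorithm -/

section Loops

variable {g : Prop} {B : ℕ} {σ : State}

/-- The rule for counting loops whose body is only known to restore the counter. -/
theorem Runs.forLoop_of_invariant {z : NatVar} {e : NatExpr} {c : Cmd} {m : ℕ}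
    (I : ℕ → State → Prop) (he : ∀ k σ', I k σ' → e.eval σ' = m)
    (hI : ∀ k σ' r, I k σ' → I k (σ'.setNat z [] r)) (h0 : I 0 σ)
    (body : ∀ k < m, ∀ σ', σ'.nat z [] = k → I k σ' →
      Runs g c σ' B fun σ₁ => σ₁.nat z [] = k ∧ I (k + 1) σ₁) :
    Runs g (BisimDistance.forLoop z e c) σ ((m + 1) * (7 + e.cost + B)) (I m) := by
  have key : ∀ r k, k + r = m → ∀ σ', σ'.nat z [] = k → I k σ' →
      Runs g (.loop (.natLt (.get z []) e) (c ;; .natSet z [] (.add (.get z []) (.const 1)))) σ'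
        (r * (7 + e.cost + B) + 3 + e.cost) (I m) := by
    intro r
    induction r with
    | zero =>
      intro k hk σ' hc hIk
      obtain rfl : k = m := by omega
      refine (loop_of_not ?_ hIk).mono_bound ?_
      · simp [Test.Holds, he _ _ hIk, NatExpr.eval, State.index, hc]
      · simp; omega
    | succ r ih =>
      intro k hk σ' hc hIk
      have hb : (Test.natLt (.get z []) e).Holds σ' := by
        simp only [Test.Holds, he _ _ hIk, NatExpr.eval, State.index, List.map_nil, hc]
        omega
      refine (loop_of_holds (B₂ := r * (7 + e.cost + B) + 3 + e.cost)
        (Q' := fun σ₂ => σ₂.nat z [] = k + 1 ∧ I (k + 1) σ₂) hb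
        (seq (B₂ := 4) (body k (by omega) σ' hc hIk) ?_)
        fun σ₂ _ h₂ => ih (k + 1) (by omega) σ₂ h₂.1 h₂.2).mono_bound ?_
      · rintro σ₁ - ⟨hc₁, hI₁⟩
        exact natSet ⟨by simp [State.index, NatExpr.eval, hc₁], hI _ _ _ hI₁⟩
      · simp only [Test.cost, NatExpr.cost, List.length_nil, add_mul]; omega
  refine (natSet_seq (key m 0 (by omega) _ ?_ (hI _ _ _ h0))).mono_bound ?_
  · simp [State.index, NatExpr.eval]
  · simp only [NatExpr.cost, List.length_nil, add_mul]; omega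

/-- The rule for a loop over all pairs of states. The invariant may depend on the set of pairs
which have been dealt with. -/
theorem Runs.forPairs {S : Type u} [Fintype S] {ι : S ≃ Fin (Fintype.card S)} {c : Cmd}
    (I : (S → S → Prop) → State → Prop)
    (hc : ¬ c.WritesNat .x ∧ ¬ c.WritesNat .y ∧ ¬ c.WritesNat .numStates)
    (hn : σ.nat .numStates [] = Fintype.card S)
    (hx : ∀ D σ' r, I D σ' → I D (σ'.setNat .x [] r))
    (hy : ∀ D σ' r, I D σ' → I D (σ'.setNat .y [] r)) (h0 : I (fun _ _ => False) σ)
    (body : ∀ D x y σ', σ'.nat .x [] = (ι x : ℕ) → σ'.nat .y [] = (ι y : ℕ) → I D σ' →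
      Runs g c σ' B (I fun x' y' => D x' y' ∨ x' = x ∧ y' = y)) :
    Runs g (BisimDistance.forLoop .x (.get .numStates [])
      (BisimDistance.forLoop .y (.get .numStates []) c)) σ
      ((Fintype.card S + 1) * (8 + (Fintype.card S + 1) * (8 + B))) (I fun _ _ => True) := by
  have hI : ∀ {D D' : S → S → Prop} {σ' : State}, (∀ x y, D x y ↔ D' x y) → I D σ' → I D' σ' := by
    intro D D' σ' h h'
    have : D = D' := by funext x y; exact propext (h x y)
    exact this ▸ h'
  refine Runs.mono (Runs.forLoop (fun k => I fun x _ => (ι x : ℕ) < k) (m := Fintype.card S)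
    (B := (Fintype.card S + 1) * (8 + B)) ?_ ?_
    (fun k => hx _) (hI (by simp) h0) ?_) (fun _ => by simp) fun σ' _ => hI (by simp)
  · simp [BisimDistance.forLoop, Cmd.WritesNat, hc]
  · intro σ' hF
    simp only [NatExpr.eval, State.index, List.map_nil]
    rw [hF.nat _ (by simp [BisimDistance.forLoop, Cmd.WritesNat, hc]), hn]
  · intro k hk σ₁ hF₁ hx₁ h₁
    obtain ⟨x, rfl⟩ := num_surj ι hk
    refine Runs.mono (Runs.forLoop (fun k => I fun x' y' => (ι x' : ℕ) < ι x ∨ x' = x ∧ (ι y' : ℕ) < k)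
      (m := Fintype.card S) (B := B) hc.2.1 ?_ (fun k => hy _) (hI (by simp) h₁) ?_)
      (fun _ => by simp) fun σ' _ => hI fun x' y' => ?_
    · intro σ' hF
      simp only [NatExpr.eval, State.index, List.map_nil]
      rw [hF.nat _ (by simp [BisimDistance.forLoop, Cmd.WritesNat, hc]),
        hF₁.nat _ (by simp [BisimDistance.forLoop, Cmd.WritesNat, hc]), hn]
    · intro k hk σ₂ hF₂ hy₂ h₂
      obtain ⟨y, rfl⟩ := num_surj ι hk
      refine (body _ x y σ₂ ?_ hy₂ h₂).mono_post fun σ' _ => hI fun x' y' => ?_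
      · rw [hF₂.nat _ (by simp [BisimDistance.forLoop, Cmd.WritesNat, hc]), hx₁]
      · rw [num_lt_succ ι]; tauto
    · rw [num_lt_succ ι]; simp

end Loops

/-! ### Raising the entries of `new` for one transition. -/

section Algorithm

variable {S : Type u} {Act : Type v} [Fintype S] [Fintype Act] {P : PA S Act}
  {N : InputNumbering P} {d : S → S → ℝ} {g : Prop} {B : ℕ} {K : Cmd} {σ σ' : State}

theorem HoldsInput.congr (h : HoldsInput P N σ) (h₁ : σ'.nat .numStates = σ.nat .numStates)
    (h₂ : σ'.nat .numActs = σ.nat .numActs) (h₃ : σ'.nat .branch = σ.nat .branch)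
    (h₄ : σ'.real .prob = σ.real .prob) : HoldsInput P N σ' where
  numStates := h₁ ▸ h.numStates
  numActs := h₂ ▸ h.numActs
  branch := h₃ ▸ h.branch
  prob := h₄ ▸ h.prob

/-- The array `z` contains the matrix `d`. -/
def HoldsMatrix (N : InputNumbering P) (z : RealVar) (d : S → S → ℝ) (σ : State) : Prop :=
  ∀ x y, σ.real z [(N.state x : ℕ), (N.state y : ℕ)] = d x y

/-- The program `K`, run on the matrix `d`, computes the step value within `B` steps (if `g`). -/
def RunsStep (N : InputNumbering P) (d : S → S → ℝ) (g : Prop) (B : ℕ) (K : Cmd) : Prop :=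
  ∀ (s t : S) (a : Act) (μ : {μ // μ ∈ P.trans s a}) (σ : State), HoldsInput P N σ →
    HoldsMatrix N .old d σ → σ.nat .s [] = N.state s → σ.nat .t [] = N.state t →
    σ.nat .a [] = N.act a → σ.nat .i [] = N.tr s a μ →
    Runs g K σ B fun σ' => σ'.real .eps [] = stepValue P d t a μ.1 ∧ SameOutside σ σ'

/-- The transitions in `G` have been taken into account in the array `new`. -/
structure UpdateInv (N : InputNumbering P) (d : S → S → ℝ) (G : ℕ → ℕ → ℕ → ℕ → Prop)
    (σ : State) : Prop where
  input : HoldsInput P N σ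
  old : HoldsMatrix N .old d σ
  new : ∀ x y r, σ.real .new [(N.state x : ℕ), (N.state y : ℕ)] ≤ r ↔ d x y ≤ r ∧
    (∀ a (μ : {μ // μ ∈ P.trans x a}), G (N.state x) (N.state y) (N.act a) (N.tr x a μ) →
      stepValue P d y a μ.1 ≤ r) ∧
    ∀ a (μ : {μ // μ ∈ P.trans y a}), G (N.state y) (N.state x) (N.act a) (N.tr y a μ) →
      stepValue P d x a μ.1 ≤ r

theorem UpdateInv.setNat {G : ℕ → ℕ → ℕ → ℕ → Prop} (h : UpdateInv N d G σ) {z : NatVar}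
    (h₁ : NatVar.numStates ≠ z) (h₂ : NatVar.numActs ≠ z) (h₃ : NatVar.branch ≠ z) (r : ℕ) :
    UpdateInv N d G (σ.setNat z [] r) where
  input := h.input.congr (σ.setNat_nat_of_ne _ _ h₁ _) (σ.setNat_nat_of_ne _ _ h₂ _)
    (σ.setNat_nat_of_ne _ _ h₃ _) rfl
  old := h.old
  new := h.new

theorem UpdateInv.of_iff {G G' : ℕ → ℕ → ℕ → ℕ → Prop} (h : UpdateInv N d G σ)
    (hG : ∀ s t a (μ : {μ // μ ∈ P.trans s a}), G (N.state s) (N.state t) (N.act a) (N.tr s a μ) ↔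
      G' (N.state s) (N.state t) (N.act a) (N.tr s a μ)) : UpdateInv N d G' σ where
  input := h.input
  old := h.old
  new x y r := by
    rw [h.new x y r]
    simp only [hG]

/-- The innermost part of a pass. -/
def raise (K : Cmd) : Cmd :=
  K ;;
  .ite (.realLt (.get .new [.s, .t]) (.get .eps []))
    (.realSet .new [.s, .t] (.get .eps [])) .skip ;;
  .ite (.realLt (.get .new [.t, .s]) (.get .eps []))
    (.realSet .new [.t, .s] (.get .eps [])) .skip

theorem State.setReal_self (σ : State) (z : RealVar) (l : List ℕ) :
    σ.setReal z l (σ.real z l) = σ := by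
  cases σ
  simp only [State.setReal, State.mk.injEq, true_and]
  funext z' l'
  split_ifs with h
  · rw [h.1, h.2]
  · rfl

theorem runs_max {u v : NatVar} :
    Runs g (.ite (.realLt (.get .new [u, v]) (.get .eps [])) (.realSet .new [u, v] (.get .eps []))
      .skip) σ 11 fun σ' => σ' = σ.setReal .new [σ.nat u [], σ.nat v []]
        (max (σ.real .new [σ.nat u [], σ.nat v []]) (σ.real .eps [])) := by
  refine Runs.mono_bound (Runs.ite (fun hb => Runs.realSet ?_) fun hb => Runs.skip ?_) ?_
  · simp only [Test.Holds, RealExpr.eval, State.index, List.map_cons, List.map_nil] at hb ⊢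
    rw [max_eq_right hb.le]
  · simp only [Test.Holds, RealExpr.eval, State.index, List.map_cons, List.map_nil, not_lt] at hb
    rw [max_eq_left hb]
    exact (State.setReal_self _ _ _).symm
  · simp

/-- Of `K` only `SameOutside` is known. Its text yields no frame, as it may overwrite the loop
counters and restore them; hence the conclusion records the counters explicitly. -/
theorem runs_raise (hK : RunsStep N d g B K) {G : ℕ → ℕ → ℕ → ℕ → Prop} {s t : S} {a : Act}
    {μ : {μ // μ ∈ P.trans s a}} (h : UpdateInv N d G σ) (hs : σ.nat .s [] = N.state s)
    (ht : σ.nat .t [] = N.state t) (ha : σ.nat .a [] = N.act a) (hi : σ.nat .i [] = N.tr s a μ) :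
    Runs g (raise K) σ (B + 22) fun σ' => σ'.nat .s [] = N.state s ∧ σ'.nat .t [] = N.state t ∧
      σ'.nat .a [] = N.act a ∧ σ'.nat .i [] = N.tr s a μ ∧
      UpdateInv N d (fun s' t' a' i' => G s' t' a' i' ∨
        s' = N.state s ∧ t' = N.state t ∧ a' = N.act a ∧ i' = N.tr s a μ) σ' := by
  classical
  refine (Runs.seq (hK s t a μ σ h.input h.old hs ht ha hi) fun σ₁ _ h₁ => Runs.seq runs_max
    fun σ₂ _ h₂ => runs_max.mono_post fun σ₃ _ h₃ => ?_).mono_bound le_rfl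
  obtain ⟨hv, hS⟩ := h₁
  have hnat : ∀ z, (∀ j, z ≠ .scratch j) → σ₃.nat z = σ.nat z := fun z hz => by
    rw [h₃, h₂]
    funext l
    exact hS.nat z l hz
  have hreal : ∀ z, z ≠ .new → z ≠ .eps → (∀ j, z ≠ .scratch j) → σ₃.real z = σ.real z :=
    fun z h1 h2 h3 => by
    rw [h₃, h₂, State.setReal_real_of_ne _ _ _ h1, State.setReal_real_of_ne _ _ _ h1]
    funext l
    exact hS.real z l h3 h2
  refine ⟨by rw [hnat _ (by simp), hs], by rw [hnat _ (by simp), ht], by rw [hnat _ (by simp), ha],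
    by rw [hnat _ (by simp), hi], h.input.congr (hnat _ (by simp)) (hnat _ (by simp))
    (hnat _ (by simp)) (hreal _ (by simp) (by simp) (by simp)), fun x y => ?_, fun x y r => ?_⟩
  · rw [hreal _ (by simp) (by simp) (by simp), h.old]
  · have hs₁ : σ₁.nat .s [] = N.state s := by rw [hS.nat _ _ (by simp), hs]
    have ht₁ : σ₁.nat .t [] = N.state t := by rw [hS.nat _ _ (by simp), ht]
    -- The second assignment sees the result of the first; for s = t the same entry is raised twice,
    -- to the same value.
    have key : σ₃.real .new [(N.state x : ℕ), (N.state y : ℕ)] ≤ r ↔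
        σ.real .new [(N.state x : ℕ), (N.state y : ℕ)] ≤ r ∧
        (x = s ∧ y = t ∨ x = t ∧ y = s → stepValue P d t a μ.1 ≤ r) := by
      rw [h₃, h₂]
      have hn := fun l => hS.real .new l (by simp) (by simp)
      simp only [State.setReal_real, State.setReal_nat, hs₁, ht₁, hv, hn, true_and,
        List.cons.injEq, and_true, num_inj, reduceCtorEq, false_and, if_false]
      by_cases h1 : x = s <;> by_cases h2 : y = t <;> by_cases h3 : x = t <;> by_cases h4 : y = s <;>
        simp_all
    rw [key, h.new x y r]
    constructor
    · rintro ⟨⟨h1, h2, h3⟩, h4⟩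
      refine ⟨h1, fun a' μ' => ?_, fun a' μ' => ?_⟩
      · rintro (h5 | ⟨h5, h6, h7, h8⟩)
        · exact h2 a' μ' h5
        · obtain rfl := (num_inj N.state).1 h5
          obtain rfl := (num_inj N.state).1 h6
          obtain rfl := N.act.injective (Fin.ext h7)
          obtain rfl := (N.tr x a').injective (Fin.ext h8)
          exact h4 (Or.inl ⟨rfl, rfl⟩)
      · rintro (h5 | ⟨h5, h6, h7, h8⟩)
        · exact h3 a' μ' h5
        · obtain rfl := (num_inj N.state).1 h5
          obtain rfl := (num_inj N.state).1 h6
          obtain rfl := N.act.injective (Fin.ext h7)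
          obtain rfl := (N.tr y a').injective (Fin.ext h8)
          exact h4 (Or.inr ⟨rfl, rfl⟩)
    · rintro ⟨h1, h2, h3⟩
      refine ⟨⟨h1, fun a' μ' h5 => h2 a' μ' (Or.inl h5), fun a' μ' h5 => h3 a' μ' (Or.inl h5)⟩, ?_⟩
      rintro (⟨rfl, rfl⟩ | ⟨rfl, rfl⟩)
      · exact h2 a μ (Or.inr ⟨rfl, rfl, rfl, rfl⟩)
      · exact h3 a μ (Or.inr ⟨rfl, rfl, rfl, rfl⟩)

end Algorithm

/-! ### One pass over all transitions, and the comparison with the previous matrix. -/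

section Algorithm

variable {S : Type u} {Act : Type v} [Fintype S] [Fintype Act] {P : PA S Act}
  {N : InputNumbering P} {d d' : S → S → ℝ} {g : Prop} {B L : ℕ} {K : Cmd} {σ : State}
  {G : ℕ → ℕ → ℕ → ℕ → Prop}

theorem runs_transitions (hK : RunsStep N d g B K) {s t : S} {a : Act}
    (h : UpdateInv N d G σ) (hs : σ.nat .s [] = N.state s)
    (ht : σ.nat .t [] = N.state t) (ha : σ.nat .a [] = N.act a) (hL : (P.trans s a).card ≤ L) :
    Runs g (forLoop .i (.get .branch [.s, .a]) (raise K)) σ ((L + 1) * (32 + B)) fun σ' =>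
      σ'.nat .s [] = N.state s ∧ σ'.nat .t [] = N.state t ∧ σ'.nat .a [] = N.act a ∧
      UpdateInv N d (fun s' t' a' i' => G s' t' a' i' ∨
        s' = N.state s ∧ t' = N.state t ∧ a' = N.act a) σ' := by
  refine Runs.mono (Runs.forLoop_of_invariant (m := (P.trans s a).card) (B := B + 22)
    (fun k σ' => σ'.nat .s [] = N.state s ∧ σ'.nat .t [] = N.state t ∧ σ'.nat .a [] = N.act a ∧
      UpdateInv N d (fun s' t' a' i' => G s' t' a' i' ∨
        s' = N.state s ∧ t' = N.state t ∧ a' = N.act a ∧ i' < k) σ')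
    ?_ ?_ ?_ ?_) (fun _ => ?_) ?_
  · rintro k σ' ⟨h1, -, h3, h4⟩
    simp only [NatExpr.eval, State.index, List.map_cons, List.map_nil, h1, h3, h4.input.branch]
  · rintro k σ' r ⟨h1, h2, h3, h4⟩
    exact ⟨by rwa [State.setNat_nat_of_ne _ _ _ (by simp)],
      by rwa [State.setNat_nat_of_ne _ _ _ (by simp)],
      by rwa [State.setNat_nat_of_ne _ _ _ (by simp)],
      h4.setNat (by simp) (by simp) (by simp) r⟩
  · exact ⟨hs, ht, ha, h.of_iff fun _ _ _ _ => by simp⟩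
  · rintro k hk σ' hi ⟨h1, h2, h3, h4⟩
    obtain ⟨μ, rfl⟩ : ∃ μ, (N.tr s a μ : ℕ) = k := ⟨(N.tr s a).symm ⟨k, hk⟩, by simp⟩
    refine (runs_raise hK h4 h1 h2 h3 hi).mono_post fun σ₁ _ ⟨h5, h6, h7, h8, h9⟩ =>
      ⟨h8, h5, h6, h7, h9.of_iff fun s' t' a' μ' => ?_⟩
    rw [Nat.lt_succ_iff_lt_or_eq]
    tauto
  · exact Nat.mul_le_mul (by omega) (by simp; omega)
  · rintro σ' - ⟨h1, h2, h3, h4⟩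
    refine ⟨h1, h2, h3, h4.of_iff fun s' t' a' μ' => or_congr_right ?_⟩
    -- The bound on the transition number can be dropped at the end, because every number of a
    -- transition is below the branching.
    refine and_congr_right fun h5 => and_congr_right fun h6 => ⟨fun h7 => h7.1, fun h7 => ⟨h7, ?_⟩⟩
    obtain rfl := (num_inj N.state).1 h5
    obtain rfl := N.act.injective (Fin.ext h7)
    exact (N.tr s' a' μ').2

theorem runs_actions (hK : RunsStep N d g B K) {s t : S} (h : UpdateInv N d G σ)
    (hs : σ.nat .s [] = N.state s) (ht : σ.nat .t [] = N.state t)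
    (hL : ∀ s a, (P.trans s a).card ≤ L) :
    Runs g (forLoop .a (.get .numActs []) (forLoop .i (.get .branch [.s, .a]) (raise K))) σ
      ((Fintype.card Act + 1) * (8 + (L + 1) * (32 + B))) fun σ' =>
      σ'.nat .s [] = N.state s ∧ σ'.nat .t [] = N.state t ∧
      UpdateInv N d (fun s' t' a' i' => G s' t' a' i' ∨ s' = N.state s ∧ t' = N.state t) σ' := by
  refine Runs.mono (Runs.forLoop_of_invariant (m := Fintype.card Act)
    (fun k σ' => σ'.nat .s [] = N.state s ∧ σ'.nat .t [] = N.state t ∧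
      UpdateInv N d (fun s' t' a' i' => G s' t' a' i' ∨
        s' = N.state s ∧ t' = N.state t ∧ a' < k) σ')
    ?_ ?_ ?_ ?_) (fun _ => le_rfl) ?_
  · rintro k σ' ⟨-, -, h3⟩
    exact h3.input.numActs
  · rintro k σ' r ⟨h1, h2, h3⟩
    exact ⟨by rwa [State.setNat_nat_of_ne _ _ _ (by simp)],
      by rwa [State.setNat_nat_of_ne _ _ _ (by simp)],
      h3.setNat (by simp) (by simp) (by simp) r⟩
  · exact ⟨hs, ht, h.of_iff fun _ _ _ _ => by simp⟩
  · rintro k hk σ' ha ⟨h1, h2, h3⟩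
    obtain ⟨a, rfl⟩ := num_surj N.act hk
    refine (runs_transitions hK h3 h1 h2 ha (hL s a)).mono_post fun σ₁ _ ⟨h5, h6, h7, h8⟩ =>
      ⟨h7, h5, h6, h8.of_iff fun s' t' a' μ' => ?_⟩
    rw [Nat.lt_succ_iff_lt_or_eq]
    tauto
  · rintro σ' - ⟨h1, h2, h3⟩
    exact ⟨h1, h2, h3.of_iff fun s' t' a' μ' => by simp⟩

theorem runs_targets (hK : RunsStep N d g B K) {s : S} (h : UpdateInv N d G σ)
    (hs : σ.nat .s [] = N.state s) (hL : ∀ s a, (P.trans s a).card ≤ L) :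
    Runs g (forLoop .t (.get .numStates []) (forLoop .a (.get .numActs [])
      (forLoop .i (.get .branch [.s, .a]) (raise K)))) σ
      ((Fintype.card S + 1) * (8 + (Fintype.card Act + 1) * (8 + (L + 1) * (32 + B)))) fun σ' =>
      σ'.nat .s [] = N.state s ∧
      UpdateInv N d (fun s' t' a' i' => G s' t' a' i' ∨ s' = N.state s) σ' := by
  refine Runs.mono (Runs.forLoop_of_invariant (m := Fintype.card S)
    (fun k σ' => σ'.nat .s [] = N.state s ∧
      UpdateInv N d (fun s' t' a' i' => G s' t' a' i' ∨ s' = N.state s ∧ t' < k) σ')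
    ?_ ?_ ?_ ?_) (fun _ => le_rfl) ?_
  · rintro k σ' ⟨-, h3⟩
    exact h3.input.numStates
  · rintro k σ' r ⟨h1, h3⟩
    exact ⟨by rwa [State.setNat_nat_of_ne _ _ _ (by simp)],
      h3.setNat (by simp) (by simp) (by simp) r⟩
  · exact ⟨hs, h.of_iff fun _ _ _ _ => by simp⟩
  · rintro k hk σ' ht ⟨h1, h3⟩
    obtain ⟨t, rfl⟩ := num_surj N.state hk
    refine (runs_actions hK h3 h1 ht hL).mono_post fun σ₁ _ ⟨h5, h6, h8⟩ =>
      ⟨h6, h5, h8.of_iff fun s' t' a' μ' => ?_⟩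
    rw [Nat.lt_succ_iff_lt_or_eq]
    tauto
  · rintro σ' - ⟨h1, h3⟩
    exact ⟨h1, h3.of_iff fun s' t' a' μ' => by simp⟩

theorem runs_updateAll (hK : RunsStep N d g B K) (h : HoldsInput P N σ)
    (hd : HoldsMatrix N .old d σ) (hL : ∀ s a, (P.trans s a).card ≤ L) :
    Runs g (updateAll K) σ ((Fintype.card S + 1) * (8 + (Fintype.card S + 1) * (8 + 6)) +
      (Fintype.card S + 1) * (8 + (Fintype.card S + 1) * (8 + (Fintype.card Act + 1) *
        (8 + (L + 1) * (32 + B))))) fun σ' =>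
      HoldsInput P N σ' ∧ HoldsMatrix N .old d σ' ∧
      ∃ d', IsUpdate P d d' ∧ HoldsMatrix N .new d' σ' := by
  classical
  refine Runs.seq (Runs.forPairs (ι := N.state) (B := 6) (fun D σ' =>
    HoldsMatrix N .old d σ' ∧ ∀ x y, D x y →
      σ'.real .new [(N.state x : ℕ), (N.state y : ℕ)] = d x y) ?_ h.numStates ?_ ?_ ?_ ?_)
    fun σ₁ hF₁ h₁ => Runs.mono (Runs.forLoop_of_invariant (m := Fintype.card S)
    (fun k => UpdateInv N d fun s' _ _ _ => s' < k) ?_ ?_ ?_ ?_) (fun _ => le_rfl) ?_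
  · simp [Cmd.WritesNat]
  · exact fun _ _ _ h => h
  · exact fun _ _ _ h => h
  · exact ⟨hd, fun _ _ h => h.elim⟩
  · rintro D x y σ' hx hy ⟨h1, h2⟩
    refine Runs.realSet ⟨fun x' y' => ?_, fun x' y' h => ?_⟩
    · rw [State.setReal_real_of_ne _ _ _ (by simp), h1]
    · simp only [State.setReal_real, State.index, List.map_cons, List.map_nil, hx, hy, true_and,
        List.cons.injEq, and_true, num_inj, RealExpr.eval]
      split_ifs with h3
      · rw [h3.1, h3.2, h1]
      · exact h2 x' y' (h.resolve_right h3)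
  · exact fun k σ' h => h.input.numStates
  · exact fun k σ' r h => h.setNat (by simp) (by simp) (by simp) r
  · refine ⟨h.congr ?_ ?_ ?_ ?_, h₁.1, fun x y r => ?_⟩
    · exact hF₁.nat _ (by simp [forLoop, Cmd.WritesNat])
    · exact hF₁.nat _ (by simp [forLoop, Cmd.WritesNat])
    · exact hF₁.nat _ (by simp [forLoop, Cmd.WritesNat])
    · exact hF₁.real _ (by simp [forLoop, Cmd.WritesReal])
    · rw [h₁.2 x y trivial]
      simp
  · intro k hk σ' hs h'
    obtain ⟨s, rfl⟩ := num_surj N.state hk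
    refine (runs_targets hK h' hs hL).mono_post fun σ₁ _ ⟨h5, h8⟩ =>
      ⟨h5, h8.of_iff fun s' t' a' μ' => ?_⟩
    rw [Nat.lt_succ_iff_lt_or_eq]
  · refine fun σ' _ h' => ⟨h'.input, h'.old, _, fun x y r => ?_, fun x y => rfl⟩
    rw [h'.new x y r]
    simp

theorem runs_compareAndCopy (h : HoldsInput P N σ) (hd : HoldsMatrix N .old d σ)
    (hd' : HoldsMatrix N .new d' σ) :
    Runs g compareAndCopy σ (2 + (Fintype.card S + 1) * (8 + (Fintype.card S + 1) * (8 + 27)))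
      fun σ' => HoldsInput P N σ' ∧ HoldsMatrix N .old d' σ' ∧
        (σ'.nat .changed [] = 0 ↔ d' = d) := by
  classical
  refine Runs.natSet_seq (Runs.mono (Runs.forPairs (ι := N.state) (B := 27) (fun D σ' =>
    HoldsMatrix N .new d' σ' ∧ (∀ x y, D x y →
      σ'.real .old [(N.state x : ℕ), (N.state y : ℕ)] = d' x y) ∧ (∀ x y, ¬ D x y →
      σ'.real .old [(N.state x : ℕ), (N.state y : ℕ)] = d x y) ∧
    (σ'.nat .changed [] = 0 ↔ ∀ x y, D x y → d' x y = d x y)) ?_ ?_ ?_ ?_ ?_ ?_)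
    (fun _ => le_rfl) ?_)
  · simp [Cmd.WritesNat]
  · rw [State.setNat_nat_of_ne _ _ _ (by simp), h.numStates]
  · exact fun _ _ _ h => ⟨h.1, h.2.1, h.2.2.1, by
      rw [State.setNat_nat_of_ne _ _ _ (by simp)]; exact h.2.2.2⟩
  · exact fun _ _ _ h => ⟨h.1, h.2.1, h.2.2.1, by
      rw [State.setNat_nat_of_ne _ _ _ (by simp)]; exact h.2.2.2⟩
  · exact ⟨hd', fun _ _ h => h.elim, fun x y _ => hd x y, by simp [State.index, NatExpr.eval]⟩
  · rintro D x y σ' hx hy ⟨h1, h2, h3, h4⟩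
    have hold : ∀ σ₁ : State, σ₁.nat .x = σ'.nat .x → σ₁.nat .y = σ'.nat .y → σ₁.real = σ'.real →
        (σ₁.nat .changed [] = 0 ↔ ∀ x' y', D x' y' ∨ x' = x ∧ y' = y → d' x' y' = d x' y') →
        Runs g (.realSet .old [.x, .y] (.get .new [.x, .y])) σ₁ 6 fun σ' =>
          HoldsMatrix N .new d' σ' ∧ (∀ x' y', D x' y' ∨ x' = x ∧ y' = y →
            σ'.real .old [(N.state x' : ℕ), (N.state y' : ℕ)] = d' x' y') ∧
          (∀ x' y', ¬ (D x' y' ∨ x' = x ∧ y' = y) →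
            σ'.real .old [(N.state x' : ℕ), (N.state y' : ℕ)] = d x' y') ∧
          (σ'.nat .changed [] = 0 ↔ ∀ x' y', D x' y' ∨ x' = x ∧ y' = y → d' x' y' = d x' y') := by
      intro σ₁ hx₁ hy₁ hr hch
      refine Runs.realSet ⟨fun x' y' => ?_, fun x' y' h => ?_, fun x' y' h => ?_, hch⟩
      · rw [State.setReal_real_of_ne _ _ _ (by simp), hr, h1]
      · simp only [State.setReal_real, State.index, List.map_cons, List.map_nil, hx₁, hy₁, hx, hy,
          true_and, List.cons.injEq, and_true, num_inj, RealExpr.eval, hr]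
        split_ifs with h5
        · rw [h5.1, h5.2, h1]
        · exact h2 x' y' (h.resolve_right h5)
      · simp only [State.setReal_real, State.index, List.map_cons, List.map_nil, hx₁, hy₁, hx, hy,
          true_and, List.cons.injEq, and_true, num_inj, RealExpr.eval, hr]
        rw [if_neg fun h5 => h (Or.inr h5)]
        exact h3 x' y' fun h5 => h (Or.inl h5)
    -- The rule for pairs does not say that the current pair is a fresh one. If it was treated
    -- before, `old` already holds the new value and the comparison reports no change, which is
    -- harmless.
    have hb : (Test.and (.not (.realLt (.get .new [.x, .y]) (.get .old [.x, .y])))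
        (.not (.realLt (.get .old [.x, .y]) (.get .new [.x, .y])))).Holds σ' ↔
        D x y ∨ d' x y = d x y := by
      simp only [Test.Holds, RealExpr.eval, State.index, List.map_cons, List.map_nil, hx, hy,
        not_lt, h1 x y]
      by_cases h5 : D x y
      · simp [h5, h2 x y h5]
      · rw [h3 x y h5, ← le_antisymm_iff, or_iff_right h5, eq_comm]
    refine Runs.mono_bound (Runs.seq (Runs.ite (Q := fun σ₁ => σ₁.nat .x = σ'.nat .x ∧
      σ₁.nat .y = σ'.nat .y ∧ σ₁.real = σ'.real ∧
      (σ₁.nat .changed [] = 0 ↔ ∀ x' y', D x' y' ∨ x' = x ∧ y' = y → d' x' y' = d x' y'))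
      (fun h5 => Runs.skip ⟨rfl, rfl, rfl, ?_⟩) fun h5 => Runs.natSet ⟨?_, ?_, rfl, ?_⟩)
      fun σ₁ _ ⟨h5, h6, h7, h8⟩ => hold σ₁ h5 h6 h7 h8) ?_
    · rw [h4]
      refine ⟨fun h6 x' y' => ?_, fun h6 x' y' h7 => h6 x' y' (Or.inl h7)⟩
      rintro (h7 | ⟨rfl, rfl⟩)
      · exact h6 x' y' h7
      · exact (hb.1 h5).elim (h6 _ _) id
    · exact State.setNat_nat_of_ne _ _ _ (by simp) _
    · exact State.setNat_nat_of_ne _ _ _ (by simp) _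
    · simp only [State.index, List.map_nil, State.setNat_nat_self, NatExpr.eval, one_ne_zero,
        false_iff]
      exact fun h6 => h5 (hb.2 (Or.inr (h6 x y (Or.inr ⟨rfl, rfl⟩))))
    · simp
  · rintro σ' hF ⟨-, h2, -, h4⟩
    refine ⟨h.congr ?_ ?_ ?_ ?_, fun x y => h2 x y trivial, ?_⟩
    · rw [hF.nat _ (by simp [forLoop, Cmd.WritesNat]), State.setNat_nat_of_ne _ _ _ (by simp)]
    · rw [hF.nat _ (by simp [forLoop, Cmd.WritesNat]), State.setNat_nat_of_ne _ _ _ (by simp)]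
    · rw [hF.nat _ (by simp [forLoop, Cmd.WritesNat]), State.setNat_nat_of_ne _ _ _ (by simp)]
    · rw [hF.real _ (by simp [forLoop, Cmd.WritesReal]), State.setNat_real]
    · rw [h4]
      simp [funext_iff]

end Algorithm

/-! ### The whole algorithm and its running time. -/

section Algorithm

variable {S : Type u} {Act : Type v} [Fintype S] [Fintype Act] {P : PA S Act}
  {N : InputNumbering P} {d : S → S → ℝ} {g : Prop} {B L U : ℕ} {K : Cmd} {σ : State}

theorem runs_pass (hK : RunsStep N d g B K) (h : HoldsInput P N σ)
    (hd : HoldsMatrix N .old d σ) (hL : ∀ s a, (P.trans s a).card ≤ L) :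
    Runs g (updateAll K ;; compareAndCopy) σ
      ((Fintype.card S + 1) * (8 + (Fintype.card S + 1) * (8 + 6)) +
      (Fintype.card S + 1) * (8 + (Fintype.card S + 1) * (8 + (Fintype.card Act + 1) *
        (8 + (L + 1) * (32 + B)))) +
      (2 + (Fintype.card S + 1) * (8 + (Fintype.card S + 1) * (8 + 27)))) fun σ' =>
      ∃ d', IsUpdate P d d' ∧ HoldsInput P N σ' ∧ HoldsMatrix N .old d' σ' ∧
        (σ'.nat .changed [] = 0 ↔ d' = d) :=
  Runs.seq (runs_updateAll hK h hd hL) fun _ _ ⟨h1, h2, d', h3, h4⟩ =>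
    (runs_compareAndCopy h1 h2 h4).mono_post fun _ _ h5 => ⟨d', h3, h5⟩

/-- Induction on the number `r` of passes still allowed when `j` have been made. The loop stops
after a pass without change, at which point all levels are bisimulations. -/
theorem runs_iteration {c : Cmd} (hc : ∀ d : S → S → ℝ, (∀ x y, 0 ≤ d x y ∧ d x y ≤ 1) →
      ∀ σ, HoldsInput P N σ → HoldsMatrix N .old d σ → Runs g c σ U fun σ' =>
        ∃ d', IsUpdate P d d' ∧ HoldsInput P N σ' ∧ HoldsMatrix N .old d' σ' ∧
          (σ'.nat .changed [] = 0 ↔ d' = d)) :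
    ∀ r j (d : S → S → ℝ) (σ : State), j + r = Fintype.card S ^ 2 + 1 → HoldsInput P N σ →
      HoldsMatrix N .old d σ → IterInv P j d → σ.nat .changed [] ≠ 0 →
      Runs g (.loop (.natLt (.const 0) (.get .changed [])) c) σ ((r + 1) * (4 + U) + 4)
        (HoldsMatrix N .old (bisimDist P)) := by
  have htest : ∀ σ : State, (Test.natLt (.const 0) (.get .changed [])).Holds σ ↔
      σ.nat .changed [] ≠ 0 := fun σ => by
    simp [Test.Holds, NatExpr.eval, State.index, Nat.pos_iff_ne_zero]
  intro r
  induction r with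
  | zero =>
    intro j d σ hj hσ hd hI hch
    refine (Runs.loop_of_holds ((htest σ).2 hch) (hc d hI.bounds σ hσ hd) fun σ' _ h' =>
      Runs.loop_of_not ?_ ?_).mono_bound (by simp)
    -- Here j = |S|² + 1, so all levels are bisimulations already; this pass only confirms that
    -- nothing changes.
    all_goals
      obtain ⟨d', h1, -, h3, h4⟩ := h'
      have hb := hI.isBisimulation_of_lt (by omega)
      have heq := h1.eq_of_isBisimulation hI.bounds hb
    · rw [htest, not_not, h4, heq]
    · rwa [heq, hI.eq_bisimDist hb] at h3
  | succ r ih =>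
    intro j d σ hj hσ hd hI hch
    refine (Runs.loop_of_holds (B₂ := (r + 1) * (4 + U) + 4) ((htest σ).2 hch)
      (hc d hI.bounds σ hσ hd) fun σ' _ h' => ?_).mono_bound (by simp [add_mul]; omega)
    obtain ⟨d', h1, h2, h3, h4⟩ := h'
    by_cases h5 : σ'.nat .changed [] = 0
    · refine (Runs.loop_of_not (by rw [htest, not_not, h5]) ?_).mono_bound (by simp)
      obtain rfl := h4.1 h5
      rwa [hI.eq_bisimDist fun ε h6 h7 => h1.isBisimulation hI.bounds hI.symm h6 h7
        fun _ _ h => h] at h3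
    · exact ih (j + 1) d' σ' (by omega) h2 h3 (h1.iterInv hI) h5

theorem runs_algorithmA (hK : ∀ d : S → S → ℝ, (∀ x y, 0 ≤ d x y ∧ d x y ≤ 1) →
      RunsStep N d g B K) (h : HoldsInput P N σ) (hL : ∀ s a, (P.trans s a).card ≤ L) :
    Runs g (algorithmA K) σ ((Fintype.card S + 1) * (8 + (Fintype.card S + 1) * (8 + 4)) +
      (2 + ((Fintype.card S ^ 2 + 1 + 1) * (4 +
      ((Fintype.card S + 1) * (8 + (Fintype.card S + 1) * (8 + 6)) +
      (Fintype.card S + 1) * (8 + (Fintype.card S + 1) * (8 + (Fintype.card Act + 1) *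
        (8 + (L + 1) * (32 + B)))) +
      (2 + (Fintype.card S + 1) * (8 + (Fintype.card S + 1) * (8 + 27))))) + 4)))
      (HoldsMatrix N .old (bisimDist P)) := by
  classical
  refine Runs.seq (Runs.forPairs (ι := N.state) (B := 4) (fun D σ' => ∀ x y, D x y →
      σ'.real .old [(N.state x : ℕ), (N.state y : ℕ)] = 0) ?_ h.numStates ?_ ?_ ?_ ?_)
    fun σ₁ hF₁ h₁ => Runs.natSet_seq (runs_iteration (fun d hd σ hσ hold =>
      runs_pass (hK d hd) hσ hold hL) _ 0 (fun _ _ => 0) _ (by omega) ?_ ?_ iterInv_zero ?_)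
  · simp [Cmd.WritesNat]
  · exact fun _ _ _ h => h
  · exact fun _ _ _ h => h
  · exact fun _ _ h => h.elim
  · rintro D x y σ' hx hy h'
    refine Runs.realSet fun x' y' h => ?_
    simp only [State.setReal_real, State.index, List.map_cons, List.map_nil, hx, hy, true_and,
      List.cons.injEq, and_true, num_inj, RealExpr.eval]
    split_ifs with h3
    · rfl
    · exact h' x' y' (h.resolve_right h3)
  · refine h.congr ?_ ?_ ?_ ?_
    · rw [State.setNat_nat_of_ne _ _ _ (by simp), hF₁.nat _ (by simp [forLoop, Cmd.WritesNat])]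
    · rw [State.setNat_nat_of_ne _ _ _ (by simp), hF₁.nat _ (by simp [forLoop, Cmd.WritesNat])]
    · rw [State.setNat_nat_of_ne _ _ _ (by simp), hF₁.nat _ (by simp [forLoop, Cmd.WritesNat])]
    · rw [State.setNat_real, hF₁.real _ (by simp [forLoop, Cmd.WritesReal])]
  · exact fun x y => h₁ x y trivial
  · simp [State.index, NatExpr.eval]

/-- As all three parameters are positive, k + 1 ≤ 2k at every nesting level, and the constants
multiply to 95235000 plus a small remainder. The exponent 9 is 2 for the passes, 2 for the pairs of
states and 5 for the instruction. -/
theorem time_bound {n m L : ℕ} (hn : 0 < n) (hm : 0 < m) (hL : 0 < L) :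
    (n + 1) * (8 + (n + 1) * (8 + 4)) + (2 + ((n ^ 2 + 1 + 1) * (4 +
      ((n + 1) * (8 + (n + 1) * (8 + 6)) + (n + 1) * (8 + (n + 1) * (8 + (m + 1) *
        (8 + (L + 1) * (32 + (L + 1) * (31000 * (n + 1) ^ 5))))) +
      (2 + (n + 1) * (8 + (n + 1) * (8 + 27))))) + 4)) ≤
    10 ^ 8 * (n ^ 9 * m * L ^ 2) := by
  have key : ∀ {k B b Y : ℕ} (a : ℕ), 0 < k → 0 < Y → B ≤ b * Y →
      (k + 1) * (a + B) ≤ 2 * (a + b) * (k * Y) := fun {k B b Y} a hk hY hB => by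
    have h1 : k + 1 ≤ 2 * k := by omega
    have h2 : a ≤ a * Y := Nat.le_mul_of_pos_right a hY
    calc (k + 1) * (a + B) ≤ 2 * k * (a * Y + b * Y) := by gcongr
      _ = _ := by ring
  have h5 : (n + 1) ^ 5 ≤ 32 * n ^ 5 := by
    calc (n + 1) ^ 5 ≤ (2 * n) ^ 5 := Nat.pow_le_pow_left (by omega) 5
      _ = _ := by ring
  have h0 : (L + 1) * (31000 * (n + 1) ^ 5) ≤ 1984000 * (L * n ^ 5) := by
    calc (L + 1) * (31000 * (n + 1) ^ 5) ≤ (2 * L) * (31000 * (32 * n ^ 5)) := by gcongr; omega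
      _ = _ := by ring
  have p5 : 0 < n ^ 5 := Nat.pow_pos hn
  have k1 := key 32 hL (by positivity) h0
  have k2 := key 8 hm (by positivity) k1
  have k3 := key 8 hn (by positivity) k2
  have k4 := key 8 hn (by positivity) k3
  have small : ∀ b, (n + 1) * (8 + (n + 1) * (8 + b)) ≤
      2 * (8 + 2 * (8 + b)) * (n * (n * (m * (L * (L * n ^ 5))))) := fun b => by
    refine (key (Y := n * 1) 8 hn (by omega) (key 8 hn zero_lt_one (mul_one b).ge)).trans ?_
    have : n * (n * 1) ≤ n * (n * (m * (L * (L * n ^ 5)))) := by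
      gcongr
      exact Nat.succ_le_of_lt (by positivity)
    gcongr
  set Y := n * (n * (m * (L * (L * n ^ 5)))) with hY
  have hY0 : 0 < Y := by positivity
  have hn2 : n ^ 2 + 1 + 1 ≤ 3 * n ^ 2 := by
    have : 0 < n ^ 2 := by positivity
    omega
  have hW : n ^ 9 * m * L ^ 2 = n ^ 2 * Y := by rw [hY]; ring
  have hYW : Y ≤ n ^ 2 * Y := Nat.le_mul_of_pos_left _ (by positivity)
  have s4 := small 4
  have s6 := small 6
  have s27 := small 27
  have hU : 4 + ((n + 1) * (8 + (n + 1) * (8 + 6)) + (n + 1) * (8 + (n + 1) * (8 + (m + 1) *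
        (8 + (L + 1) * (32 + (L + 1) * (31000 * (n + 1) ^ 5))))) +
      (2 + (n + 1) * (8 + (n + 1) * (8 + 27)))) ≤ 31745000 * Y := by
    omega
  have hT := Nat.mul_le_mul hn2 hU
  have e : 3 * n ^ 2 * (31745000 * Y) = 95235000 * (n ^ 2 * Y) := by ring
  rw [hW]
  omega

theorem card_le_maxBranching (P : PA S Act) (s : S) (a : Act) :
    (P.trans s a).card ≤ P.maxBranching :=
  (Finset.le_sup (f := fun a => (P.trans s a).card) (mem_univ a)).trans
    (Finset.le_sup (f := fun s => univ.sup fun a => (P.trans s a).card) (mem_univ s))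

/-- Nothing is known about the time of an arbitrary implementation, so the time guard is false and
the bound 0 is void. -/
theorem ImplementsStep.runsStep (hK : ImplementsStep.{u, v} K) (N : InputNumbering P)
    (hd : ∀ x y, 0 ≤ d x y ∧ d x y ≤ 1) : RunsStep N d False 0 K := by
  intro s t a μ σ hσ hold hs ht ha hi
  obtain ⟨T, σ', hE, hv, hS⟩ := hK S Act P N d s t a μ σ hd hσ hold hs ht ha hi
  exact ⟨T, σ', hE, False.elim, hv.eq, hS⟩

theorem runsStep_step (N : InputNumbering P) (hd : ∀ x y, 0 ≤ d x y ∧ d x y ≤ 1) :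
    RunsStep N d True ((P.maxBranching + 1) * (31000 * (Fintype.card S + 1) ^ 5)) step := by
  intro s t a μ σ hσ hold hs ht ha hi
  obtain ⟨T, σ', hE, hT, hv⟩ := runs_step (g := True) hd hσ hold hs ht ha hi
  refine ⟨T, σ', hE, fun h => (hT h).trans ?_, hv.eq, step_sameOutside hE⟩
  gcongr
  exact card_le_maxBranching P t a

end Algorithm

end BisimDistance

theorem mainTheorem4 :
    -- whatever implementation of the innermost instruction is used, the algorithm halts and
    -- outputs the distance between all pairs of states
    (∀ K : Cmd, ImplementsStep.{u, v} K →
      ∀ (S : Type u) (Act : Type v) [Fintype S] [Fintype Act] (P : PA S Act) (N : InputNumbering P)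
        (σ : State), HoldsInput P N σ →
        ∃ T σ', Exec (algorithmA K) σ T σ' ∧
          ∀ s t : S, σ'.real .old [(N.state s : ℕ), (N.state t : ℕ)] = bisimDist P s t) ∧
    -- with a suitable implementation, it runs in the stated time
    (∃ K : Cmd, ImplementsStep.{u, v} K ∧ ∃ C : ℕ,
      ∀ (S : Type u) (Act : Type v) [Fintype S] [Fintype Act] (P : PA S Act) (N : InputNumbering P)
        (σ : State), HoldsInput P N σ →
        0 < Fintype.card S → 0 < Fintype.card Act → 0 < P.maxBranching →
        ∀ T σ', Exec (algorithmA K) σ T σ' →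
          T ≤ C * (Fintype.card S ^ 9 * Fintype.card Act * P.maxBranching ^ 2)) := by
  refine ⟨fun K hK S Act _ _ P N σ hσ => ?_, StepProgram.step, implementsStep_step, 10 ^ 8,
    fun S Act _ _ P N σ hσ hS hA hb T σ' hE => ?_⟩
  · obtain ⟨T, σ', hE, -, h⟩ := runs_algorithmA (g := False) (fun d hd => hK.runsStep N hd) hσ
      (card_le_maxBranching P)
    exact ⟨T, σ', hE, h⟩
  -- The given execution coincides with the one whose length has been bounded.
  · obtain ⟨T', σ'', hE', hT, -⟩ := runs_algorithmA (g := True) (fun d hd => runsStep_step N hd) hσ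
      (card_le_maxBranching P)
    rw [(hE.deterministic hE').1]
    exact (hT trivial).trans (time_bound hS hA hb)
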